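/- **Conventions.** Everything is over $\mathbb{C}$. A *Lie conformal superalgebra* is a $\mathbb{Z}/2$-graded $\mathbb{C}[\partial]$-module $R$ (with $\partial$ even) with an even bilinear $\lambda$-bracket $R\otimes R\to\mathbb{C}[\lambda]\otimes R$, $a\otimes b\mapsto[a_\lambda b]$, such that, for homogeneous $a,b,c$ of parities $p(a),p(b),p(c)$, $$[\partial a_\lambda b]=-\lambda[a_\lambda b],\quad [a_\lambda\partial b]=(\partial+\lambda)[a_\lambda b],\quad [b_\lambda a]=-(-1)^{p(a)p(b)}[a_{-\lambda-\partial}b],$$ $$[a_\lambda[b_\mu c]]=[[a_\lambda b]_{\lambda+\mu}c]+(-1)^{p(a)p(b)}[b_\mu[a_\lambda c]].$$ A *central extension* of $R$ by $K$ is a short exact sequence $0\to K\to S\to R\to0$ of Lie conformal superalgebras which splits as a sequence of $\mathbb{Z}/2$-graded $\mathbb{C}[\partial]$-modules, with $K$ central in $S$ and $\partial K=0$. It is *trivial* if there is a homomorphism of Lie conformal superalgebras $R\to S$ which splits $S\to R$. It is *one-dimensional* if $\dim K=1$ ($K$ even or odd). Two central extensions of $R$ are *isomorphic* if there are isomorphisms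 $S\cong S'$ and $K\cong K'$ of Lie conformal superalgebras compatible with the two sequences and with the identity map of $R$. A *$2$-cocycle* on $R$ is a bilinear map $\alpha_\lambda:R\otimes R\to\mathbb{C}[\lambda]$, zero on pairs of elements of different parity, such that for homogeneous $a,b,c$ $$\alpha_\lambda(\partial a,b)=-\lambda\alpha_\lambda(a,b),\quad \alpha_\lambda(a,\partial b)=\lambda\alpha_\lambda(a,b),\quad \alpha_\lambda(b,a)=-(-1)^{p(a)p(b)}\alpha_{-\lambda}(a,b),$$ $$\alpha_\lambda(a,[b_\mu c])=\alpha_{\lambda+\mu}([a_\lambda b],c)+(-1)^{p(a)p(b)}\alpha_\mu(b,[a_\lambda c]).$$ It defines a one-dimensional central extension $S=R\oplus\mathbb{C}$ of $R$ (with $\partial=0$ on the even central summand $\mathbb{C}$) with $\lambda$-bracket $[a_\lambda b]+\alpha_\lambda(a,b)$ for $a,b\in R$. We write $\alpha_\lambda(a,b)=\sum_{n\ge0}\alpha_n(a,b)\,\lambda^n/n!$. For $N\ge0$ let $\wedge(N)$ be the Grassmann superalgebra in the odd variables $\xi_1,\dots,\xi_N$, let $\partial_i=\partial/\partial\xi_i$,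 and let $W(N)$ be the Lie superalgebra of all derivations of $\wedge(N)$. Let $W_N=\mathbb{C}[\partial]\otimes(W(N)\oplus\wedge(N))$ be the Lie conformal superalgebra with $\lambda$-bracket determined, for homogeneous $a,b\in W(N)$ and $f,g\in\wedge(N)$, by sesquilinearity, skew-symmetry and $$[a_\lambda b]=[a,b],\qquad [a_\lambda f]=a(f)-\lambda(-1)^{p(a)p(f)}fa,\qquad [f_\lambda g]=-\partial(fg)-2\lambda fg.$$ **Proposition.** (a) For $N=0,1,2$, $W_N$ has, up to isomorphism, a unique non-trivial one-dimensional central extension. It is defined by the $2$-cocycle $\alpha$ on $W_N$ with the following entries, together with those obtained from them by skew-symmetry; $\alpha_\lambda(x,y)=0$ for all other pairs $(x,y)$ of elements of the basis $\{\xi_{i_1}\cdots\xi_{i_k}\partial_j\}\cup\{\xi_{i_1}\cdots\xi_{i_k}\}$ ($i_1<\dots<i_k$) of $W(N)\oplus\wedge(N)$, and for the listed pairs $\alpha_n$ vanishes for all $n$ other than the one listed. - $W_0$: $\alpha_3(1,1)=\tfrac12$. - $W_1$: $\alpha_1(\xi_1\partial_1,\xi_1\partial_1)=\tfrac13$, $\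 \alpha_2(\xi_1\partial_1,1)=\tfrac13$, $\ \alpha_2(\partial_1,\xi_1)=-\tfrac13$. - $W_2$: $\alpha_1(\xi_1\partial_2,\xi_2\partial_1)=\tfrac16$, $\ \alpha_1(\xi_1\partial_1,\xi_2\partial_2)=-\tfrac16$, $\ \alpha_1(\xi_1\xi_2\partial_2,\partial_1)=-\tfrac16$, $\ \alpha_1(\xi_1\xi_2\partial_1,\partial_2)=\tfrac16$. (b) For $N\ge3$ every central extension of $W_N$ is trivial. -/

import Mathlib

noncomputable section

namespace LieConf

/-! ### Vector-valued polynomials -/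

/-- `ℂ[λ] ⊗ M`, the polynomials in one variable with coefficients in `M`;
`PolynomialModule.single ℂ n m` is the monomial `λⁿ m`. -/
abbrev Poly (M : Type*) [AddCommGroup M] [Module ℂ M] := PolynomialModule ℂ M

section Poly

variable {M P : Type*} [AddCommGroup M] [Module ℂ M] [AddCommGroup P] [Module ℂ P]

/-- The linear map on `ℂ[λ] ⊗ M` given on monomials by `λⁿ m ↦ f n m`. -/
def lift (f : ℕ → M →ₗ[ℂ] P) : Poly M →ₗ[ℂ] P :=
  (Finsupp.lsum ℂ f) ∘ₗ (PolynomialModule.coeffLinearEquiv ℂ ℂ).toLinearMap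

@[simp] theorem lift_single (f : ℕ → M →ₗ[ℂ] P) (n : ℕ) (m : M) :
    lift f (PolynomialModule.single ℂ n m) = f n m := by
  simp [lift]

/-- Substitution of an operator for the variable (written on the left of the coefficients):
`∑ λⁿ cₙ ↦ ∑ Tⁿ cₙ`. -/
def subst (T : Module.End ℂ M) : Poly M →ₗ[ℂ] M := lift fun n => T ^ n

/-- Multiplication by the variable. -/
def shift : Module.End ℂ (Poly M) := lift fun n => PolynomialModule.lsingle ℂ (n + 1)

@[simp] theorem shift_single (n : ℕ) (m : M) :
    shift (PolynomialModule.single ℂ n m) = PolynomialModule.single ℂ (n + 1) m := by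
  rw [shift, lift_single]; rfl

/-- The value of `p ∈ ℂ[λ] ⊗ M` at a number `λ`. -/
abbrev ev (l : ℂ) : Poly M →ₗ[ℂ] M := PolynomialModule.eval l

/-- A vector-valued polynomial is determined by its values at all complex numbers, so an identity
between polynomials in `λ` (or in `λ, μ`) may be stated for all numbers `λ` (and `μ`). -/
theorem poly_ext {p q : Poly M} (h : ∀ l : ℂ, ev l p = ev l q) : p = q := by
  rw [← sub_eq_zero]
  set r := p - q with hr
  have h0 : ∀ l : ℂ, ev l r = 0 := fun l => by rw [hr, map_sub, h l, sub_self]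
  apply PolynomialModule.coeff_injective
  ext n
  rw [PolynomialModule.coeff_zero, Finsupp.zero_apply,
    ← Module.forall_dual_apply_eq_zero_iff ℂ]
  intro φ
  have key : ∀ s : Poly M, ∀ l : ℂ,
      (∑ k ∈ s.coeff.support, Polynomial.monomial k (φ (s.coeff k))).eval l = φ (ev l s) := by
    intro s l
    simp only [Polynomial.eval_finsetSum, Polynomial.eval_monomial, ev,
      PolynomialModule.eval_apply, Finsupp.sum, map_sum, map_smul, smul_eq_mul, mul_comm]
  have hz : (∑ k ∈ r.coeff.support, Polynomial.monomial k (φ (r.coeff k))) = 0 := by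
    apply Polynomial.funext
    intro l
    rw [key, h0]; simp
  have := congrArg (fun t => Polynomial.coeff t n) hz
  simp only [Polynomial.finsetSum_coeff, Polynomial.coeff_monomial, Polynomial.coeff_zero] at this
  by_cases hn : n ∈ r.coeff.support
  · simpa [hn] using this
  · rw [Finsupp.notMem_support_iff.1 hn, map_zero]

end Poly

/-! ### Lie conformal superalgebras -/

/-- The sign `(-1)^{ij}` of the rule of signs. -/
def sgn (i j : ZMod 2) : ℂ := (-1) ^ (i.val * j.val)

/-- A Lie conformal superalgebra structure on the complex vector space `R`: a `ℤ/2`-grading, an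
even operator `D = ∂`, and an (even) `λ`-bracket `R ⊗ R → ℂ[λ] ⊗ R`. The axioms are polynomial
identities in `λ`, `μ` and are stated for all numerical values of the variables; `[a_{-λ-∂} b]`
means `∑ (-λ-∂)ⁿ cₙ` if `[a_λ b] = ∑ λⁿ cₙ`. -/
structure LieConformalSuperalgebra (R : Type*) [AddCommGroup R] [Module ℂ R] where
  grade : ZMod 2 → Submodule ℂ R
  isCompl : IsCompl (grade 0) (grade 1)
  D : Module.End ℂ R
  D_mem : ∀ i a, a ∈ grade i → D a ∈ grade i
  bracket : R →ₗ[ℂ] R →ₗ[ℂ] Poly R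
  bracket_mem : ∀ i j a b, a ∈ grade i → b ∈ grade j →
    ∀ n, (bracket a b).coeff n ∈ grade (i + j)
  sesq_left : ∀ (l : ℂ) a b, ev l (bracket (D a) b) = -(l • ev l (bracket a b))
  sesq_right : ∀ (l : ℂ) a b,
    ev l (bracket a (D b)) = D (ev l (bracket a b)) + l • ev l (bracket a b)
  skew : ∀ i j a b, a ∈ grade i → b ∈ grade j → ∀ l : ℂ,
    ev l (bracket b a) = -(sgn i j • subst (-(l • (1 : Module.End ℂ R)) - D) (bracket a b))
  jacobi : ∀ i j a b c, a ∈ grade i → b ∈ grade j → ∀ l m : ℂ,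
    ev l (bracket a (ev m (bracket b c))) =
      ev (l + m) (bracket (ev l (bracket a b)) c)
        + sgn i j • ev m (bracket b (ev l (bracket a c)))

variable {R S K S' K' : Type*} [AddCommGroup R] [Module ℂ R] [AddCommGroup S] [Module ℂ S]
  [AddCommGroup K] [Module ℂ K] [AddCommGroup S'] [Module ℂ S'] [AddCommGroup K'] [Module ℂ K']

/-- Homomorphisms of Lie conformal superalgebras. -/
structure Hom (𝓡 : LieConformalSuperalgebra R) (𝓢 : LieConformalSuperalgebra S) where
  f : R →ₗ[ℂ] S
  map_grade : ∀ i a, a ∈ 𝓡.grade i → f a ∈ 𝓢.grade i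
  map_D : ∀ a, f (𝓡.D a) = 𝓢.D (f a)
  map_bracket : ∀ a b, 𝓢.bracket (f a) (f b) = PolynomialModule.map ℂ f (𝓡.bracket a b)

/-- A central extension `0 → K → S → R → 0` of Lie conformal superalgebras: a short exact sequence
which splits as a sequence of `ℤ/2`-graded `ℂ[∂]`-modules, in which `K` is central in `S` and `∂`
acts on `K` by zero. -/
structure CentralExtension (𝓚 : LieConformalSuperalgebra K) (𝓢 : LieConformalSuperalgebra S)
    (𝓡 : LieConformalSuperalgebra R) where
  ι : Hom 𝓚 𝓢
  π : Hom 𝓢 𝓡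
  ι_injective : Function.Injective ι.f
  π_surjective : Function.Surjective π.f
  exact : LinearMap.range ι.f = LinearMap.ker π.f
  central : ∀ k s, 𝓢.bracket (ι.f k) s = 0
  D_zero : ∀ k, 𝓚.D k = 0
  split : ∃ s : R →ₗ[ℂ] S, (∀ i a, a ∈ 𝓡.grade i → s a ∈ 𝓢.grade i) ∧
    (∀ a, s (𝓡.D a) = 𝓢.D (s a)) ∧ ∀ a, π.f (s a) = a

/-- The extension is trivial if it splits as an extension of Lie conformal superalgebras. -/
def CentralExtension.IsTrivial {𝓚 : LieConformalSuperalgebra K} {𝓢 : LieConformalSuperalgebra S}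
    {𝓡 : LieConformalSuperalgebra R} (E : CentralExtension 𝓚 𝓢 𝓡) : Prop :=
  ∃ s : Hom 𝓡 𝓢, ∀ a, E.π.f (s.f a) = a

/-- Isomorphism of central extensions of `R`: isomorphisms `S ≃ S'` and `K ≃ K'` of Lie conformal
superalgebras which are compatible with the maps of the two sequences and with the identity of
`R`. -/
def CentralExtension.IsIso {𝓚 : LieConformalSuperalgebra K} {𝓢 : LieConformalSuperalgebra S}
    {𝓚' : LieConformalSuperalgebra K'} {𝓢' : LieConformalSuperalgebra S'}
    {𝓡 : LieConformalSuperalgebra R} (E : CentralExtension 𝓚 𝓢 𝓡)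
    (E' : CentralExtension 𝓚' 𝓢' 𝓡) : Prop :=
  ∃ (φ : Hom 𝓢 𝓢') (κ : Hom 𝓚 𝓚'), Function.Bijective φ.f ∧ Function.Bijective κ.f ∧
    (∀ k, φ.f (E.ι.f k) = E'.ι.f (κ.f k)) ∧ ∀ s, E'.π.f (φ.f s) = E.π.f s

/-! ### Two-cocycles and the extensions they define -/

/-- A (reduced) `2`-cocycle `α_λ : R ⊗ R → ℂ[λ]` with values in the trivial module `ℂ` (even, with
`∂ = 0`). -/
structure TwoCocycle (𝓡 : LieConformalSuperalgebra R) where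
  α : R →ₗ[ℂ] R →ₗ[ℂ] Poly ℂ
  even : ∀ a b, a ∈ 𝓡.grade 0 → b ∈ 𝓡.grade 1 → α a b = 0
  sesq_left : ∀ (l : ℂ) a b, ev l (α (𝓡.D a) b) = -(l * ev l (α a b))
  sesq_right : ∀ (l : ℂ) a b, ev l (α a (𝓡.D b)) = l * ev l (α a b)
  skew : ∀ i j a b, a ∈ 𝓡.grade i → b ∈ 𝓡.grade j → ∀ l : ℂ,
    ev l (α b a) = -(sgn i j * ev (-l) (α a b))
  cocycle : ∀ i j a b c, a ∈ 𝓡.grade i → b ∈ 𝓡.grade j → ∀ l m : ℂ,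
    ev l (α a (ev m (𝓡.bracket b c))) =
      ev (l + m) (α (ev l (𝓡.bracket a b)) c) + sgn i j * ev m (α b (ev l (𝓡.bracket a c)))

theorem ev_map (f : R →ₗ[ℂ] S) (p : Poly R) (l : ℂ) :
    ev l (PolynomialModule.map ℂ f p) = f (ev l p) := by
  induction p using PolynomialModule.induction_linear with
  | zero => simp
  | add x y hx hy => simp only [map_add, hx, hy]
  | single n m => simp

theorem subst_map (f : R →ₗ[ℂ] S) (T : Module.End ℂ R) (U : Module.End ℂ S)
    (h : ∀ a, U (f a) = f (T a)) (p : Poly R) :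
    subst U (PolynomialModule.map ℂ f p) = f (subst T p) := by
  induction p using PolynomialModule.induction_linear with
  | zero => simp
  | add x y hx hy => simp only [map_add, hx, hy]
  | single n m =>
    simp only [PolynomialModule.map_single, subst, lift_single]
    induction n generalizing m with
    | zero => simp
    | succ n ih => rw [pow_succ, pow_succ, Module.End.mul_apply, Module.End.mul_apply, h, ih]

theorem subst_smul_one (p : Poly R) (l : ℂ) :
    subst (l • (1 : Module.End ℂ R)) p = ev l p := by
  induction p using PolynomialModule.induction_linear with
  | zero => simp
  | add x y hx hy => simp only [map_add, hx, hy]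
  | single n m => simp [subst, smul_pow]

theorem coeff_map (f : R →ₗ[ℂ] S) (p : Poly R) (n : ℕ) :
    (PolynomialModule.map ℂ f p).coeff n = f (p.coeff n) := by
  simp [PolynomialModule.map]

theorem ev_mem {p : Poly R} {A : Submodule ℂ R} (h : ∀ n, p.coeff n ∈ A) (l : ℂ) :
    ev l p ∈ A := by
  rw [ev, PolynomialModule.eval_apply]
  exact Submodule.sum_mem _ fun n _ => A.smul_mem _ (h n)

/-- The grading of the even line `ℂ`. -/
def lineGrade (i : ZMod 2) : Submodule ℂ ℂ := if i = 0 then ⊤ else ⊥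

/-- The even line `ℂ` with `∂ = 0` and zero bracket. -/
def line : LieConformalSuperalgebra ℂ where
  grade := lineGrade
  isCompl := by simpa [lineGrade] using isCompl_top_bot
  D := 0
  D_mem := by simp
  bracket := 0
  bracket_mem := by simp
  sesq_left := by simp
  sesq_right := by simp
  skew := by simp
  jacobi := by simp

namespace TwoCocycle

variable {𝓡 : LieConformalSuperalgebra R} (c : TwoCocycle 𝓡)

/-- The bracket `[(a,x)_λ (b,y)] = ([a_λ b], α_λ(a,b))` on `R ⊕ ℂ`. -/
def extBracket : (R × ℂ) →ₗ[ℂ] (R × ℂ) →ₗ[ℂ] Poly (R × ℂ) :=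
  (𝓡.bracket.compr₂ (PolynomialModule.map ℂ (LinearMap.inl ℂ R ℂ))
    + c.α.compr₂ (PolynomialModule.map ℂ (LinearMap.inr ℂ R ℂ))).compl₁₂
    (LinearMap.fst ℂ R ℂ) (LinearMap.fst ℂ R ℂ)

theorem extBracket_apply (a b : R × ℂ) : c.extBracket a b =
    PolynomialModule.map ℂ (LinearMap.inl ℂ R ℂ) (𝓡.bracket a.1 b.1)
      + PolynomialModule.map ℂ (LinearMap.inr ℂ R ℂ) (c.α a.1 b.1) := rfl

theorem ev_extBracket (a b : R × ℂ) (l : ℂ) : ev l (c.extBracket a b) =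
    (ev l (𝓡.bracket a.1 b.1), ev l (c.α a.1 b.1)) := by
  rw [extBracket_apply, map_add, ev_map, ev_map]; simp

/-- The Lie conformal superalgebra `R ⊕ ℂ` defined by a `2`-cocycle on `R`. -/
def ext : LieConformalSuperalgebra (R × ℂ) where
  grade i := (𝓡.grade i).prod (lineGrade i)
  isCompl := by
    have h : IsCompl (lineGrade 0) (lineGrade 1) := line.isCompl
    constructor
    · rw [disjoint_iff, Submodule.prod_inf_prod, 𝓡.isCompl.inf_eq_bot, h.inf_eq_bot,
        Submodule.prod_bot]
    · rw [codisjoint_iff, Submodule.prod_sup_prod, 𝓡.isCompl.sup_eq_top, h.sup_eq_top,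
        Submodule.prod_top]
  D := LinearMap.prodMap 𝓡.D 0
  D_mem i a h := ⟨𝓡.D_mem i _ h.1, by simp⟩
  bracket := c.extBracket
  bracket_mem := by
    rintro i j a b ⟨ha, -⟩ ⟨hb, -⟩ n
    rw [extBracket_apply, PolynomialModule.coeff_add, Finsupp.add_apply, coeff_map, coeff_map]
    refine ⟨by simpa using 𝓡.bracket_mem i j _ _ ha hb n, ?_⟩
    have hs : ∀ a b, a ∈ 𝓡.grade 1 → b ∈ 𝓡.grade 0 → c.α a b = 0 := by
      intro a b ha hb
      apply poly_ext
      intro l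
      rw [c.skew 0 1 b a hb ha, c.even b a hb ha]; simp
    have ht : ∀ x, x ∈ lineGrade 0 := by simp [lineGrade]
    fin_cases i <;> fin_cases j
    · exact ht _
    · have := c.even a.1 b.1 ha hb
      simp [this]
    · have := hs a.1 b.1 ha hb
      simp [this]
    · exact ht _
  sesq_left l a b := by
    simp only [ev_extBracket, LinearMap.prodMap_apply, 𝓡.sesq_left, c.sesq_left]
    simp
  sesq_right l a b := by
    simp only [ev_extBracket, LinearMap.prodMap_apply, 𝓡.sesq_right, c.sesq_right]
    simp
  skew i j a b ha hb l := by
    rw [ev_extBracket, 𝓡.skew i j _ _ ha.1 hb.1, c.skew i j _ _ ha.1 hb.1, extBracket_apply,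
      map_add, subst_map _ (-(l • (1 : Module.End ℂ R)) - 𝓡.D),
      subst_map _ ((-l) • (1 : Module.End ℂ ℂ)), subst_smul_one]
    · ext <;> simp
    · intro x; simp
    · intro x; simp
  jacobi i j a b d ha hb l m := by
    simp only [ev_extBracket]
    rw [𝓡.jacobi i j _ _ _ ha.1 hb.1, c.cocycle i j _ _ _ ha.1 hb.1]
    simp

/-- The central extension `0 → ℂ → R ⊕ ℂ → R → 0` defined by a `2`-cocycle on `R`. -/
def centralExtension : CentralExtension line c.ext 𝓡 where
  ι :=
    { f := LinearMap.inr ℂ R ℂ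
      map_grade := fun i a h => ⟨by simp, h⟩
      map_D := fun a => by simp [ext, line]
      map_bracket := fun a b => by simp [ext, line, extBracket_apply] }
  π :=
    { f := LinearMap.fst ℂ R ℂ
      map_grade := fun i a h => h.1
      map_D := fun a => by simp [ext]
      map_bracket := fun a b => by
        apply poly_ext
        intro l
        rw [ev_map]
        simp [ext, ev_extBracket] }
  ι_injective := LinearMap.inr_injective
  π_surjective := LinearMap.fst_surjective
  exact := by rw [LinearMap.range_inr]
  central k s := by simp [ext, extBracket_apply]
  D_zero k := by simp [line]
  split := ⟨LinearMap.inl ℂ R ℂ, fun i a h => ⟨h, by simp⟩, fun a => by simp [ext], fun a => rfl⟩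

end TwoCocycle

/-! ### The Grassmann algebra and its derivations -/

/-- The Grassmann algebra `∧(N)`. -/
abbrev Lam (N : ℕ) := ExteriorAlgebra ℂ (Fin N → ℂ)

/-- The even and odd parts of `∧(N)`. -/
def par (N : ℕ) (i : ZMod 2) : Submodule ℂ (Lam N) :=
  CliffordAlgebra.evenOdd (0 : QuadraticForm ℂ (Fin N → ℂ)) i

/-- The parity automorphism `f ↦ (-1)^{p(f)} f` of `∧(N)`. -/
def inv (N : ℕ) : Module.End ℂ (Lam N) :=
  (CliffordAlgebra.involute (Q := (0 : QuadraticForm ℂ (Fin N → ℂ)))).toLinearMap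

/-- Multiplication on the left by `f`. -/
abbrev lmul {N : ℕ} (f : Lam N) : Module.End ℂ (Lam N) := LinearMap.mulLeft ℂ f

section Grassmann

variable {N : ℕ}

theorem sgn_zero_left (j : ZMod 2) : sgn 0 j = 1 := by simp [sgn]

theorem sgn_zero_right (j : ZMod 2) : sgn j 0 = 1 := by simp [sgn]

theorem sgn_one_one : sgn 1 1 = -1 := by simp [sgn, ZMod.val_one]

theorem sgn_comm (i j : ZMod 2) : sgn i j = sgn j i := by simp [sgn, mul_comm]

theorem sgn_mul_self (i j : ZMod 2) : sgn i j * sgn i j = 1 := by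
  rw [sgn, ← mul_pow]; simp

theorem zmod_two_cases (i : ZMod 2) : i = 0 ∨ i = 1 := by
  fin_cases i
  · exact Or.inl rfl
  · exact Or.inr rfl

theorem one_add_one : (1 + 1 : ZMod 2) = 0 := rfl

theorem sgn_add_left (i j k : ZMod 2) : sgn (i + j) k = sgn i k * sgn j k := by
  rcases zmod_two_cases i with rfl | rfl <;> rcases zmod_two_cases j with rfl | rfl <;>
    rcases zmod_two_cases k with rfl | rfl <;>
    simp [sgn_zero_left, sgn_zero_right, sgn_one_one, one_add_one]

theorem sgn_add_right (i j k : ZMod 2) : sgn k (i + j) = sgn k i * sgn k j := by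
  rw [sgn_comm, sgn_add_left, sgn_comm i, sgn_comm j]

theorem par_isCompl (N : ℕ) : IsCompl (par N 0) (par N 1) :=
  CliffordAlgebra.evenOdd_isCompl _

theorem par_mul {i j : ZMod 2} {f g : Lam N} (hf : f ∈ par N i) (hg : g ∈ par N j) :
    f * g ∈ par N (i + j) :=
  SetLike.mul_mem_graded (A := CliffordAlgebra.evenOdd (0 : QuadraticForm ℂ (Fin N → ℂ))) hf hg

theorem inv_par {i : ZMod 2} {f : Lam N} (hf : f ∈ par N i) : inv N f = sgn 1 i • f := by
  rcases zmod_two_cases i with rfl | rfl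
  · rw [sgn_zero_right, one_smul]
    exact CliffordAlgebra.involute_eq_of_mem_even hf
  · rw [sgn_one_one, neg_one_smul]
    exact CliffordAlgebra.involute_eq_of_mem_odd hf

theorem par_decomp (f : Lam N) : ∃ g ∈ par N 0, ∃ h ∈ par N 1, g + h = f :=
  Submodule.mem_sup.1 ((par_isCompl N).sup_eq_top ▸ Submodule.mem_top)

theorem end_ext {P : Type*} [AddCommGroup P] [Module ℂ P] {A B : Lam N →ₗ[ℂ] P}
    (h : ∀ i, ∀ f ∈ par N i, A f = B f) : A = B := by
  refine LinearMap.ext fun f => ?_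
  obtain ⟨g, hg, k, hk, rfl⟩ := par_decomp f
  rw [map_add, map_add, h 0 g hg, h 1 k hk]

theorem par_induction {j : ZMod 2} {p : Lam N → Prop} (h0 : j = 0 → ∀ r : ℂ, p (algebraMap ℂ _ r))
    (h1 : j = 1 → ∀ v, p (ExteriorAlgebra.ι ℂ v))
    (ha : ∀ f g, f ∈ par N j → g ∈ par N j → p f → p g → p (f + g))
    (hm : ∀ v w f, f ∈ par N j → p f →
      p (ExteriorAlgebra.ι ℂ v * (ExteriorAlgebra.ι ℂ w * f)))
    {f : Lam N} (hf : f ∈ par N j) : p f := by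
  rcases zmod_two_cases j with rfl | rfl
  · refine CliffordAlgebra.even_induction (Q := (0 : QuadraticForm ℂ (Fin N → ℂ)))
      (motive := fun f _ => p f) (h0 rfl) (fun x y hx hy => ha x y hx hy) ?_ f hf
    intro v w x hx hp
    rw [mul_assoc]
    exact hm v w x hx hp
  · refine CliffordAlgebra.odd_induction (Q := (0 : QuadraticForm ℂ (Fin N → ℂ)))
      (P := fun f _ => p f) (h1 rfl) (fun x y hx hy => ha x y hx hy) ?_ f hf
    intro v w x hx hp
    rw [mul_assoc]
    exact hm v w x hx hp

theorem ι_swap (v w : Fin N → ℂ) :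
    ExteriorAlgebra.ι ℂ v * ExteriorAlgebra.ι ℂ w =
      -(ExteriorAlgebra.ι ℂ w * ExteriorAlgebra.ι ℂ v) :=
  eq_neg_of_add_eq_zero_left (ExteriorAlgebra.ι_add_mul_swap v w)

theorem ι_mul_comm {j : ZMod 2} {g : Lam N} (hg : g ∈ par N j) (v : Fin N → ℂ) :
    ExteriorAlgebra.ι ℂ v * g = sgn 1 j • (g * ExteriorAlgebra.ι ℂ v) := by
  refine par_induction (p := fun g => ExteriorAlgebra.ι ℂ v * g =
    sgn 1 j • (g * ExteriorAlgebra.ι ℂ v)) ?_ ?_ ?_ ?_ hg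
  · rintro rfl r
    rw [sgn_zero_right, one_smul]
    exact (Algebra.commutes r _).symm
  · rintro rfl w
    rw [sgn_one_one, ι_swap, neg_one_smul]
  · intro f g _ _ hf hg
    rw [mul_add, hf, hg, add_mul, smul_add]
  · intro w u f _ hf
    rw [← mul_assoc, ι_swap, neg_mul, mul_assoc, ← mul_assoc (ExteriorAlgebra.ι ℂ v), ι_swap v u,
      neg_mul, mul_assoc, hf]
    simp [mul_assoc]

theorem lam_comm {i j : ZMod 2} {f g : Lam N} (hf : f ∈ par N i) (hg : g ∈ par N j) :
    g * f = sgn i j • (f * g) := by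
  refine par_induction (p := fun f => g * f = sgn i j • (f * g)) ?_ ?_ ?_ ?_ hf
  · rintro rfl r
    rw [sgn_zero_left, one_smul]
    exact (Algebra.commutes r _).symm
  · rintro rfl w
    rw [ι_mul_comm hg, smul_smul, sgn_mul_self, one_smul]
  · intro f f' _ _ hf hf'
    rw [mul_add, hf, hf', add_mul, smul_add]
  · intro w u f _ hf
    have h : ∀ v, g * ExteriorAlgebra.ι ℂ v = sgn 1 j • (ExteriorAlgebra.ι ℂ v * g) := by
      intro v
      rw [ι_mul_comm hg, smul_smul, sgn_mul_self, one_smul]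
    rw [← mul_assoc, h, smul_mul_assoc, mul_assoc _ g, ← mul_assoc g, h, smul_mul_assoc,
      mul_assoc _ g, hf]
    simp only [mul_smul_comm, smul_smul, mul_assoc]
    rw [← mul_assoc, sgn_mul_self, one_mul]

/-- The derivations of `∧(N)` of parity `i`:
`D(fg) = D(f) g + (-1)^{i p(f)} f D(g)`. -/
def der (N : ℕ) (i : ZMod 2) : Submodule ℂ (Module.End ℂ (Lam N)) where
  carrier := {D | ∀ j, ∀ f ∈ par N j, D f ∈ par N (i + j) ∧
    ∀ g, D (f * g) = D f * g + sgn i j • (f * D g)}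
  add_mem' := by
    intro D E hD hE j f hf
    refine ⟨Submodule.add_mem _ (hD j f hf).1 (hE j f hf).1, fun g => ?_⟩
    simp only [LinearMap.add_apply, (hD j f hf).2, (hE j f hf).2, add_mul, mul_add, smul_add]
    abel
  zero_mem' := by
    intro j f _
    simp
  smul_mem' := by
    intro c D hD j f hf
    refine ⟨Submodule.smul_mem _ c (hD j f hf).1, fun g => ?_⟩
    simp only [LinearMap.smul_apply, (hD j f hf).2, smul_add, smul_mul_assoc, mul_smul_comm]
    rw [smul_comm]

/-- The space `W(N)` of all derivations of `∧(N)`, the sum of the even and the odd ones. -/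
def Der (N : ℕ) : Submodule ℂ (Module.End ℂ (Lam N)) := der N 0 ⊔ der N 1

theorem der_le (i : ZMod 2) : der N i ≤ Der N := by
  rcases zmod_two_cases i with rfl | rfl
  · exact le_sup_left
  · exact le_sup_right

/-- The even part of an operator on `∧(N)`. -/
def evenPart : Module.End ℂ (Lam N) →ₗ[ℂ] Module.End ℂ (Lam N) :=
  (2⁻¹ : ℂ) • (LinearMap.id + (LinearMap.mulLeft ℂ (inv N)) ∘ₗ (LinearMap.mulRight ℂ (inv N)))

/-- The odd part of an operator on `∧(N)`. -/
def oddPart : Module.End ℂ (Lam N) →ₗ[ℂ] Module.End ℂ (Lam N) :=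
  (2⁻¹ : ℂ) • (LinearMap.id - (LinearMap.mulLeft ℂ (inv N)) ∘ₗ (LinearMap.mulRight ℂ (inv N)))

/-- `(-1)^{p(a)p(b)} b a` for operators `a`, `b` on `∧(N)`, extended bilinearly. -/
def swapMul : Module.End ℂ (Lam N) →ₗ[ℂ] Module.End ℂ (Lam N) →ₗ[ℂ] Module.End ℂ (Lam N) :=
  (LinearMap.mul ℂ (Module.End ℂ (Lam N))).flip.comp evenPart
    + ((LinearMap.mul ℂ (Module.End ℂ (Lam N))).flip.comp oddPart).compl₂
      ((LinearMap.mulLeft ℂ (inv N)) ∘ₗ (LinearMap.mulRight ℂ (inv N)))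

/-- Operators on `∧(N)` of parity `i`. -/
def IsPar (i : ZMod 2) (D : Module.End ℂ (Lam N)) : Prop :=
  ∀ j, ∀ f ∈ par N j, D f ∈ par N (i + j)

theorem IsPar.conj {i : ZMod 2} {D : Module.End ℂ (Lam N)} (h : IsPar i D) :
    inv N * (D * inv N) = sgn 1 i • D := by
  refine end_ext ?_
  intro j f hf
  simp only [Module.End.mul_apply, LinearMap.smul_apply]
  rw [inv_par hf, map_smul, map_smul, inv_par (h j f hf), smul_smul, sgn_add_right, mul_comm,
    mul_assoc, sgn_mul_self, mul_one]

theorem IsPar.swapMul {i j : ZMod 2} {a b : Module.End ℂ (Lam N)} (ha : IsPar i a)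
    (hb : IsPar j b) : swapMul a b = sgn i j • (b * a) := by
  simp only [LieConf.swapMul, evenPart, oddPart, LinearMap.add_apply, LinearMap.comp_apply,
    LinearMap.compl₂_apply, LinearMap.flip_apply, LinearMap.smul_apply, LinearMap.id_apply,
    LinearMap.mulLeft_apply, LinearMap.mulRight_apply, LinearMap.sub_apply, LinearMap.mul_apply',
    ha.conj, hb.conj]
  rcases zmod_two_cases i with rfl | rfl
  · simp only [sgn_zero_left, sgn_zero_right, one_smul, sub_self, smul_zero, mul_zero, add_zero]
    rw [← two_smul ℂ a, smul_smul]; norm_num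
  · have h0 : a + (-1 : ℂ) • a = 0 := by module
    have h1 : (2⁻¹ : ℂ) • (a - (-1 : ℂ) • a) = a := by module
    rw [sgn_one_one, h0, h1, smul_zero, mul_zero, zero_add, smul_mul_assoc]

theorem isPar_lmul {i : ZMod 2} {f : Lam N} (hf : f ∈ par N i) : IsPar i (lmul f) :=
  fun _ _ hg => par_mul hf hg

theorem isPar_der {i : ZMod 2} {D : Module.End ℂ (Lam N)} (h : D ∈ der N i) : IsPar i D :=
  fun j f hf => (h j f hf).1

theorem isPar_mul {i j : ZMod 2} {a b : Module.End ℂ (Lam N)} (ha : IsPar i a)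
    (hb : IsPar j b) : IsPar (i + j) (a * b) := by
  intro k f hf
  rw [add_assoc]
  exact ha _ _ (hb _ _ hf)

/-- `(-1)^{p(a)p(f)} f a` for `f ∈ ∧(N)` and `a` an operator, extended bilinearly. -/
def swapLmul (a : Module.End ℂ (Lam N)) (f : Lam N) : Module.End ℂ (Lam N) := swapMul a (lmul f)

/-- `(-1)^{p(a)p(f)} a(f)`, extended bilinearly. -/
def swapApply (a : Module.End ℂ (Lam N)) (f : Lam N) : Lam N :=
  evenPart a f + oddPart a (inv N f)

theorem swapApply_par {i j : ZMod 2} {a : Module.End ℂ (Lam N)} {f : Lam N} (ha : IsPar i a)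
    (hf : f ∈ par N j) : swapApply a f = sgn i j • a f := by
  simp only [swapApply, evenPart, oddPart, LinearMap.add_apply, LinearMap.comp_apply,
    LinearMap.smul_apply, LinearMap.id_apply,
    LinearMap.mulLeft_apply, LinearMap.mulRight_apply, LinearMap.sub_apply, ha.conj, inv_par hf]
  rcases zmod_two_cases i with rfl | rfl
  · simp only [sgn_zero_left, sgn_zero_right, one_smul, sub_self, smul_zero, add_zero]
    rw [← two_smul ℂ (a f), smul_smul]; norm_num
  · simp only [sgn_one_one, neg_one_smul, add_neg_cancel, smul_zero, zero_add,
      map_smul, sub_neg_eq_add]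
    rw [← two_smul ℂ (sgn 1 j • a f), smul_smul]; norm_num

/-- The commutator of superalgebra `a b - (-1)^{p(a)p(b)} b a`. -/
def comm (a b : Module.End ℂ (Lam N)) : Module.End ℂ (Lam N) := a * b - swapMul a b

theorem comm_der {i j : ZMod 2} {a b : Module.End ℂ (Lam N)} (ha : a ∈ der N i)
    (hb : b ∈ der N j) : comm a b ∈ der N (i + j) := by
  rw [comm, (isPar_der ha).swapMul (isPar_der hb)]
  intro k f hf
  constructor
  · refine Submodule.sub_mem _ (isPar_mul (isPar_der ha) (isPar_der hb) k f hf)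
      (Submodule.smul_mem _ _ ?_)
    rw [add_comm i]
    exact isPar_mul (isPar_der hb) (isPar_der ha) k f hf
  · intro g
    simp only [LinearMap.sub_apply, LinearMap.smul_apply, Module.End.mul_apply, (ha k f hf).2,
      (hb k f hf).2, map_add, map_smul, (ha _ _ (hb k f hf).1).2, (hb _ _ (ha k f hf).1).2,
      sgn_add_right, sgn_add_left, sub_mul, mul_sub, smul_mul_assoc, mul_smul_comm, smul_add,
      smul_sub, smul_smul, ← mul_assoc]
    rw [sgn_comm j i, sgn_mul_self i j]
    module

theorem lmul_der {i j : ZMod 2} {a : Module.End ℂ (Lam N)} {f : Lam N} (ha : a ∈ der N i)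
    (hf : f ∈ par N j) : lmul f * a ∈ der N (i + j) := by
  rw [add_comm i]
  intro k g hg
  refine ⟨isPar_mul (isPar_lmul hf) (isPar_der ha) k g hg, fun h => ?_⟩
  simp only [Module.End.mul_apply, LinearMap.mulLeft_apply, (ha k g hg).2, mul_add,
    mul_smul_comm, ← mul_assoc, lam_comm hf hg, sgn_add_left, smul_smul, smul_mul_assoc]
  rw [mul_comm (sgn j k) (sgn i k), mul_assoc (sgn i k), sgn_mul_self, mul_one]

theorem der_induction {p : Module.End ℂ (Lam N) → Prop}
    (h : ∀ i, ∀ a ∈ der N i, p a) (hadd : ∀ a b, p a → p b → p (a + b))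
    {a : Module.End ℂ (Lam N)} (ha : a ∈ Der N) : p a := by
  obtain ⟨a0, h0, a1, h1, rfl⟩ := Submodule.mem_sup.1 ha
  exact hadd _ _ (h 0 _ h0) (h 1 _ h1)

theorem lam_induction {p : Lam N → Prop}
    (h : ∀ i, ∀ a ∈ par N i, p a) (hadd : ∀ a b, p a → p b → p (a + b)) (f : Lam N) : p f := by
  obtain ⟨a0, h0, a1, h1, rfl⟩ := par_decomp f
  exact hadd _ _ (h 0 _ h0) (h 1 _ h1)

theorem comm_mem {a b : Module.End ℂ (Lam N)} (ha : a ∈ Der N) (hb : b ∈ Der N) :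
    comm a b ∈ Der N := by
  refine der_induction (p := fun a => comm a b ∈ Der N) (fun i a ha => ?_) (fun a a' h h' => ?_) ha
  · refine der_induction (p := fun b => comm a b ∈ Der N) (fun j b hb => ?_)
      (fun b b' h h' => ?_) hb
    · exact der_le _ (comm_der ha hb)
    · have : comm a (b + b') = comm a b + comm a b' := by
        simp only [comm, mul_add, map_add]; abel
      rw [this]; exact Submodule.add_mem _ h h'
  · have : comm (a + a') b = comm a b + comm a' b := by
      simp only [comm, add_mul, map_add, LinearMap.add_apply]; abel
    rw [this]; exact Submodule.add_mem _ h h'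

theorem lmul_add (f g : Lam N) : lmul (f + g) = lmul f + lmul g := by
  refine LinearMap.ext fun h => ?_
  simp [add_mul]

theorem lmul_smul (r : ℂ) (f : Lam N) : lmul (r • f) = r • lmul f := by
  refine LinearMap.ext fun h => ?_
  simp

theorem lmul_mem {a : Module.End ℂ (Lam N)} (ha : a ∈ Der N) (f : Lam N) :
    lmul f * a ∈ Der N := by
  refine der_induction (p := fun a => lmul f * a ∈ Der N) (fun i a ha => ?_)
    (fun a a' h h' => ?_) ha
  · refine lam_induction (p := fun f => lmul f * a ∈ Der N) (fun j f hf => ?_)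
      (fun f f' h h' => ?_) f
    · exact der_le _ (lmul_der ha hf)
    · rw [lmul_add, add_mul]; exact Submodule.add_mem _ h h'
  · rw [mul_add]; exact Submodule.add_mem _ h h'

theorem swapLmul_mem {a : Module.End ℂ (Lam N)} (ha : a ∈ Der N) (f : Lam N) :
    swapLmul a f ∈ Der N := by
  refine der_induction (p := fun a => swapLmul a f ∈ Der N) (fun i a ha => ?_)
    (fun a a' h h' => ?_) ha
  · refine lam_induction (p := fun f => swapLmul a f ∈ Der N) (fun j f hf => ?_)
      (fun f f' h h' => ?_) f
    · rw [swapLmul, (isPar_der ha).swapMul (isPar_lmul hf)]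
      exact Submodule.smul_mem _ _ (der_le _ (lmul_der ha hf))
    · rw [swapLmul, lmul_add, map_add]; exact Submodule.add_mem _ h h'
  · rw [swapLmul, map_add]; exact Submodule.add_mem _ h h'

/-- The odd derivation `∂ᵢ = ∂/∂ξᵢ`. -/
def dξ (i : Fin N) : Module.End ℂ (Lam N) :=
  CliffordAlgebra.contractLeft (Q := (0 : QuadraticForm ℂ (Fin N → ℂ))) (LinearMap.proj i)

theorem dξ_ι_mul (i : Fin N) (v : Fin N → ℂ) (f : Lam N) :
    dξ i (ExteriorAlgebra.ι ℂ v * f) = v i • f - ExteriorAlgebra.ι ℂ v * dξ i f :=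
  CliffordAlgebra.contractLeft_ι_mul (Q := (0 : QuadraticForm ℂ (Fin N → ℂ))) (d := LinearMap.proj i) v f

theorem dξ_algebraMap_mul (i : Fin N) (r : ℂ) (f : Lam N) :
    dξ i (algebraMap ℂ _ r * f) = algebraMap ℂ _ r * dξ i f :=
  CliffordAlgebra.contractLeft_algebraMap_mul (Q := (0 : QuadraticForm ℂ (Fin N → ℂ))) (d := LinearMap.proj i) r f

theorem dξ_algebraMap (i : Fin N) (r : ℂ) : dξ i (algebraMap ℂ (Lam N) r) = 0 :=
  CliffordAlgebra.contractLeft_algebraMap (0 : QuadraticForm ℂ (Fin N → ℂ)) (LinearMap.proj i) r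

theorem dξ_ι (i : Fin N) (v : Fin N → ℂ) :
    dξ i (ExteriorAlgebra.ι ℂ v) = algebraMap ℂ (Lam N) (v i) :=
  CliffordAlgebra.contractLeft_ι (0 : QuadraticForm ℂ (Fin N → ℂ)) (LinearMap.proj i) v

theorem algebraMap_par (r : ℂ) : algebraMap ℂ (Lam N) r ∈ par N 0 :=
  SetLike.algebraMap_mem_graded
    (CliffordAlgebra.evenOdd (0 : QuadraticForm ℂ (Fin N → ℂ))) r

theorem ι_par (v : Fin N → ℂ) : ExteriorAlgebra.ι ℂ v ∈ par N 1 :=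
  CliffordAlgebra.ι_mem_evenOdd_one _ v

theorem dξ_mem_der (i : Fin N) : dξ i ∈ der N 1 := by
  intro j f hf
  constructor
  · refine par_induction (p := fun f => dξ i f ∈ par N (1 + j)) ?_ ?_ ?_ ?_ hf
    · rintro rfl r
      rw [dξ_algebraMap]; exact Submodule.zero_mem _
    · rintro rfl v
      rw [dξ_ι]; exact algebraMap_par _
    · intro f g _ _ hf hg
      rw [map_add]; exact Submodule.add_mem _ hf hg
    · intro v w f hf h
      have e1 : ∀ k : ZMod 2, 1 + (1 + k) = k := by
        intro k; rw [← add_assoc, one_add_one, zero_add]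
      rw [dξ_ι_mul, dξ_ι_mul]
      refine Submodule.sub_mem _ (Submodule.smul_mem _ _ (par_mul (ι_par w) hf)) ?_
      rw [← e1 (1 + j)]
      refine par_mul (ι_par v) (Submodule.sub_mem _ (Submodule.smul_mem _ _ ?_)
        (par_mul (ι_par w) h))
      rw [e1]; exact hf
  · intro g
    refine par_induction (p := fun f => dξ i (f * g) = dξ i f * g + sgn 1 j • (f * dξ i g))
      ?_ ?_ ?_ ?_ hf
    · rintro rfl r
      rw [dξ_algebraMap, dξ_algebraMap_mul, sgn_zero_right]; simp
    · rintro rfl v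
      rw [dξ_ι, dξ_ι_mul, sgn_one_one, ← Algebra.smul_def]; module
    · intro f f' _ _ hf hf'
      rw [add_mul, map_add, hf, hf', map_add, add_mul, add_mul]; module
    · intro v w f hf h
      rw [dξ_ι_mul, dξ_ι_mul, mul_assoc, mul_assoc, dξ_ι_mul, dξ_ι_mul, h]
      simp only [mul_sub, sub_mul, mul_add, smul_mul_assoc, mul_smul_comm, mul_assoc]
      abel

end Grassmann

/-! ### Brackets on free `ℂ[∂]`-modules -/

section Free

variable {M : Type*} [AddCommGroup M] [Module ℂ M]

/-- The map `u ↦ λᵏ ∂ˡ u` from `M` to `ℂ[λ] ⊗ ℂ[∂] ⊗ M`. -/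
def mono (k l : ℕ) : M →ₗ[ℂ] Poly (Poly M) :=
  PolynomialModule.lsingle ℂ k ∘ₗ PolynomialModule.lsingle ℂ l

theorem mono_apply (k l : ℕ) (u : M) :
    mono k l u = PolynomialModule.single ℂ k (PolynomialModule.single ℂ l u) := rfl

/-- The bilinear map `[u_λ v] = A(u,v) + λ B(u,v) + ∂ C(u,v)`. -/
def genBracket (A B C : M →ₗ[ℂ] M →ₗ[ℂ] M) : M →ₗ[ℂ] M →ₗ[ℂ] Poly (Poly M) :=
  A.compr₂ (mono 0 0) + B.compr₂ (mono 1 0) + C.compr₂ (mono 0 1)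

theorem genBracket_apply (A B C : M →ₗ[ℂ] M →ₗ[ℂ] M) (u v : M) :
    genBracket A B C u v = mono 0 0 (A u v) + mono 1 0 (B u v) + mono 0 1 (C u v) := rfl

/-- The operator of multiplication by `∂` in `ℂ[λ] ⊗ ℂ[∂] ⊗ M`. -/
def innerShift : Module.End ℂ (Poly (Poly M)) := PolynomialModule.map ℂ shift

/-- The extension of a bracket `[u_λ v]`, `u, v ∈ M`, to `ℂ[∂] ⊗ M` by sesquilinearity:
`[∂ᵐu _λ ∂ⁿv] = (-λ)ᵐ (∂ + λ)ⁿ [u_λ v]`. -/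
def sesqExtend (g : M →ₗ[ℂ] M →ₗ[ℂ] Poly (Poly M)) :
    Poly M →ₗ[ℂ] Poly M →ₗ[ℂ] Poly (Poly M) :=
  lift fun m =>
    { toFun := fun u => lift fun n =>
        ((-shift) ^ m * (innerShift + shift) ^ n : Module.End ℂ (Poly (Poly M))) ∘ₗ g u
      map_add' := by
        intro u v
        apply PolynomialModule.hom_ext
        intro n
        refine LinearMap.ext fun x => ?_
        simp [PolynomialModule.lsingle, LinearMap.add_apply]
      map_smul' := by
        intro c u
        apply PolynomialModule.hom_ext
        intro n
        refine LinearMap.ext fun x => ?_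
        simp [PolynomialModule.lsingle] }

theorem sesqExtend_single (g : M →ₗ[ℂ] M →ₗ[ℂ] Poly (Poly M)) (m n : ℕ) (u v : M) :
    sesqExtend g (PolynomialModule.single ℂ m u) (PolynomialModule.single ℂ n v) =
      ((-shift) ^ m * (innerShift + shift) ^ n : Module.End ℂ (Poly (Poly M))) (g u v) := by
  simp [sesqExtend]

/-- The elements of `ℂ[∂] ⊗ M` with coefficients in a subspace. -/
def coeffsIn (A : Submodule ℂ M) : Submodule ℂ (Poly M) where
  carrier := {p | ∀ n, p.coeff n ∈ A}
  add_mem' hp hq n := Submodule.add_mem _ (hp n) (hq n)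
  zero_mem' _ := Submodule.zero_mem _
  smul_mem' c _ hp n := Submodule.smul_mem _ c (hp n)

theorem single_mem {A : Submodule ℂ M} (n : ℕ) {u : M} (h : u ∈ A) :
    PolynomialModule.single ℂ n u ∈ coeffsIn A := by
  intro k
  rw [PolynomialModule.coeff_single, Finsupp.single_apply]
  split_ifs
  · exact h
  · exact A.zero_mem

theorem coeffsIn_induction {A : Submodule ℂ M} {p : Poly M → Prop} (h0 : p 0)
    (ha : ∀ x y, p x → p y → p (x + y)) (hs : ∀ n, ∀ u ∈ A, p (PolynomialModule.single ℂ n u))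
    {x : Poly M} (hx : x ∈ coeffsIn A) : p x := by
  have e : x = ∑ n ∈ x.coeff.support, PolynomialModule.single ℂ n (x.coeff n) := by
    apply PolynomialModule.coeff_injective
    rw [PolynomialModule.coeff_sum]
    simp only [PolynomialModule.coeff_single]
    exact x.coeff.sum_single.symm
  rw [e]
  exact Finset.sum_induction _ p ha h0 fun n _ => hs n _ (hx n)

theorem coeffsIn_isCompl {A B : Submodule ℂ M} (h : IsCompl A B) :
    IsCompl (coeffsIn A) (coeffsIn B) := by
  constructor
  · rw [Submodule.disjoint_def]
    intro x hx hy
    apply PolynomialModule.coeff_injective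
    ext n
    exact Submodule.disjoint_def.1 h.disjoint _ (hx n) (hy n)
  · rw [codisjoint_iff, eq_top_iff]
    rintro x -
    induction x using PolynomialModule.induction_linear with
    | zero => exact Submodule.zero_mem _
    | add x y hx hy => exact Submodule.add_mem _ hx hy
    | single n m =>
      obtain ⟨a, ha, b, hb, rfl⟩ := Submodule.mem_sup.1
        (h.sup_eq_top ▸ Submodule.mem_top : m ∈ A ⊔ B)
      rw [PolynomialModule.single_add]
      exact Submodule.add_mem _ (Submodule.mem_sup_left (single_mem n ha))
        (Submodule.mem_sup_right (single_mem n hb))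

theorem shift_mem {A : Submodule ℂ M} {x : Poly M} (h : x ∈ coeffsIn A) :
    shift x ∈ coeffsIn A := by
  refine coeffsIn_induction (p := fun x => shift x ∈ coeffsIn A) ?_ ?_ ?_ h
  · rw [map_zero]; exact Submodule.zero_mem _
  · intro x y hx hy
    rw [map_add]; exact Submodule.add_mem _ hx hy
  · intro n u hu
    rw [shift_single]; exact single_mem _ hu

theorem innerShift_mem {A : Submodule ℂ M} {x : Poly (Poly M)} (h : x ∈ coeffsIn (coeffsIn A)) :
    innerShift x ∈ coeffsIn (coeffsIn A) := by
  intro n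
  rw [innerShift, coeff_map]
  exact shift_mem (h n)

theorem sesqExtend_mem {A B C : Submodule ℂ M} {g : M →ₗ[ℂ] M →ₗ[ℂ] Poly (Poly M)}
    (h : ∀ u ∈ A, ∀ v ∈ B, g u v ∈ coeffsIn (coeffsIn C)) {x y : Poly M}
    (hx : x ∈ coeffsIn A) (hy : y ∈ coeffsIn B) :
    sesqExtend g x y ∈ coeffsIn (coeffsIn C) := by
  have hpow : ∀ (T : Module.End ℂ (Poly (Poly M))),
      (∀ z ∈ coeffsIn (coeffsIn C), T z ∈ coeffsIn (coeffsIn C)) →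
      ∀ n : ℕ, ∀ z ∈ coeffsIn (coeffsIn C), (T ^ n) z ∈ coeffsIn (coeffsIn C) := by
    intro T hT n
    induction n with
    | zero => intro z hz; simpa using hz
    | succ n ih => intro z hz; rw [pow_succ]; exact ih _ (hT _ hz)
  refine coeffsIn_induction (p := fun x => sesqExtend g x y ∈ coeffsIn (coeffsIn C)) ?_ ?_ ?_ hx
  · rw [map_zero]; exact Submodule.zero_mem _
  · intro x x' hx hx'
    rw [map_add]; exact Submodule.add_mem _ hx hx'
  intro m u hu
  refine coeffsIn_induction (p := fun y => sesqExtend g (PolynomialModule.single ℂ m u) y ∈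
    coeffsIn (coeffsIn C)) ?_ ?_ ?_ hy
  · rw [map_zero]; exact Submodule.zero_mem _
  · intro x x' hx hx'
    rw [map_add]; exact Submodule.add_mem _ hx hx'
  intro n v hv
  rw [sesqExtend_single]
  refine hpow _ (fun z hz => ?_) m _ (hpow _ (fun z hz => ?_) n _ (h u hu v hv))
  · exact Submodule.neg_mem _ (shift_mem hz)
  · exact Submodule.add_mem _ (innerShift_mem hz) (shift_mem hz)

theorem ev_shift (l : ℂ) (p : Poly M) : ev l (shift p) = l • ev l p := by
  induction p using PolynomialModule.induction_linear with
  | zero => simp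
  | add x y hx hy => simp only [map_add, hx, hy, smul_add]
  | single n m => simp [pow_succ', mul_smul]

theorem ev_innerShift (l : ℂ) (p : Poly (Poly M)) : ev l (innerShift p) = shift (ev l p) :=
  ev_map _ _ _

theorem shift_innerShift : Commute (shift : Module.End ℂ (Poly (Poly M))) innerShift := by
  apply PolynomialModule.hom_ext
  intro n
  refine LinearMap.ext fun x => ?_
  change shift (innerShift (PolynomialModule.single ℂ n x)) =
    innerShift (shift (PolynomialModule.single ℂ n x))
  simp only [innerShift, shift_single, PolynomialModule.map_single]

theorem sesqExtend_left (g : M →ₗ[ℂ] M →ₗ[ℂ] Poly (Poly M)) (p q : Poly M) :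
    sesqExtend g (shift p) q = -shift (sesqExtend g p q) := by
  induction p using PolynomialModule.induction_linear with
  | zero => simp
  | add x y hx hy => simp only [map_add, LinearMap.add_apply, hx, hy, neg_add]
  | single m u =>
  induction q using PolynomialModule.induction_linear with
  | zero => simp
  | add x y hx hy => simp only [map_add, hx, hy, neg_add]
  | single n v =>
    rw [shift_single, sesqExtend_single, sesqExtend_single, pow_succ', mul_assoc]
    rfl

theorem sesqExtend_right (g : M →ₗ[ℂ] M →ₗ[ℂ] Poly (Poly M)) (p q : Poly M) :
    sesqExtend g p (shift q) = innerShift (sesqExtend g p q) + shift (sesqExtend g p q) := by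
  induction p using PolynomialModule.induction_linear with
  | zero => simp
  | add x y hx hy => simp only [map_add, LinearMap.add_apply, hx, hy]; abel
  | single m u =>
  induction q using PolynomialModule.induction_linear with
  | zero => simp
  | add x y hx hy => simp only [map_add, hx, hy]; abel
  | single n v =>
    have hc : Commute ((-shift : Module.End ℂ (Poly (Poly M))) ^ m) (innerShift + shift) :=
      Commute.pow_left (Commute.neg_left (R := Module.End ℂ (Poly (Poly M)))
        (shift_innerShift.add_right (Commute.refl _))) m
    rw [shift_single, sesqExtend_single, sesqExtend_single, pow_succ', ← mul_assoc, hc.eq,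
      mul_assoc]
    rfl

/-! Axioms for the bracket on `ℂ[∂] ⊗ M`, checked on a faithful representation. -/

section FreeRep

variable {E : Type*} [Ring E] [Algebra ℂ E] {G : ZMod 2 → Submodule ℂ M}
  {A B C : M →ₗ[ℂ] M →ₗ[ℂ] M}

/-- The extension of a family of maps from `M` to `ℂ[∂] ⊗ M`, on which `∂` acts as `-l`. -/
def rep (ρ : ℂ → M →ₗ[ℂ] E) (l : ℂ) : Poly M →ₗ[ℂ] E := ρ l ∘ₗ ev (-l)

theorem rep_single (ρ : ℂ → M →ₗ[ℂ] E) (l : ℂ) (m : ℕ) (u : M) :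
    rep ρ l (PolynomialModule.single ℂ m u) = (-l) ^ m • ρ l u := by
  simp [rep]

theorem rep_shift (ρ : ℂ → M →ₗ[ℂ] E) (l : ℂ) (p : Poly M) :
    rep ρ l (shift p) = -l • rep ρ l p := by
  rw [rep, LinearMap.comp_apply, ev_shift, map_smul]; rfl

theorem rep_ext (ρ : ℂ → M →ₗ[ℂ] E) (hinj : ∀ l u, ρ l u = 0 → u = 0) {p q : Poly M}
    (h : ∀ l, rep ρ l p = rep ρ l q) : p = q := by
  apply poly_ext
  intro l
  rw [← sub_eq_zero]
  apply hinj (-l)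
  have := h (-l)
  rw [rep, LinearMap.comp_apply, LinearMap.comp_apply, neg_neg] at this
  rw [map_sub, this, sub_self]

theorem rep_genBracket (ρ : ℂ → M →ₗ[ℂ] E) (u v : M) (l m : ℂ) :
    rep ρ (l + m) (ev l (genBracket A B C u v)) =
      ρ (l + m) (A u v + l • B u v - (l + m) • C u v) := by
  rw [genBracket_apply, mono_apply, mono_apply, mono_apply]
  simp only [map_add, map_sub, map_smul, PolynomialModule.eval_single, pow_zero, one_smul, pow_one,
    rep_single]
  module

theorem rep_sesqExtend (ρ : ℂ → M →ₗ[ℂ] E)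
    (hρ : ∀ i j u v, u ∈ G i → v ∈ G j → ∀ l m : ℂ,
      ρ (l + m) (A u v + l • B u v - (l + m) • C u v) =
        ρ l u * ρ m v - sgn i j • (ρ m v * ρ l u))
    {i j : ZMod 2} {p q : Poly M} (hp : p ∈ coeffsIn (G i))
    (hq : q ∈ coeffsIn (G j)) (l m : ℂ) :
    rep ρ (l + m) (ev l (sesqExtend (genBracket A B C) p q)) =
      rep ρ l p * rep ρ m q - sgn i j • (rep ρ m q * rep ρ l p) := by
  refine coeffsIn_induction (p := fun p => rep ρ (l + m)
      (ev l (sesqExtend (genBracket A B C) p q)) =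
      rep ρ l p * rep ρ m q - sgn i j • (rep ρ m q * rep ρ l p)) ?_ ?_ ?_ hp
  · simp
  · intro x y hx hy
    simp only [map_add, LinearMap.add_apply, hx, hy, add_mul, mul_add, smul_add]; abel
  intro k u hu
  refine coeffsIn_induction (p := fun q => rep ρ (l + m) (ev l (sesqExtend (genBracket A B C)
      (PolynomialModule.single ℂ k u) q)) = rep ρ l (PolynomialModule.single ℂ k u) * rep ρ m q
        - sgn i j • (rep ρ m q * rep ρ l (PolynomialModule.single ℂ k u))) ?_ ?_ ?_ hq
  · simp
  · intro x y hx hy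
    simp only [map_add, hx, hy, add_mul, mul_add, smul_add]; abel
  intro n v hv
  have h1 : ∀ k : ℕ, ∀ z : Poly (Poly M), ev l (((-shift) ^ k : Module.End ℂ (Poly (Poly M))) z) =
      (-l) ^ k • ev l z := by
    intro k
    induction k with
    | zero => intro z; simp
    | succ k ih =>
      intro z
      rw [pow_succ, Module.End.mul_apply, ih, LinearMap.neg_apply, map_neg, ev_shift, pow_succ,
        ← neg_smul, smul_smul]
  have h2 : ∀ n : ℕ, ∀ z : Poly (Poly M), rep ρ (l + m)
      (ev l (((innerShift + shift) ^ n : Module.End ℂ (Poly (Poly M))) z)) =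
      (-m) ^ n • rep ρ (l + m) (ev l z) := by
    intro n
    induction n with
    | zero => intro z; simp
    | succ n ih =>
      intro z
      rw [pow_succ, Module.End.mul_apply, ih, LinearMap.add_apply, map_add, ev_shift,
        ev_innerShift, map_add, rep_shift, map_smul, ← add_smul, smul_smul, pow_succ]
      congr 2; ring
  rw [sesqExtend_single, Module.End.mul_apply, h1, map_smul, h2, rep_genBracket,
    hρ i j u v hu hv, rep_single, rep_single]
  simp only [smul_mul_assoc, mul_smul_comm, smul_sub, smul_smul]
  congr 2 <;> ring

theorem rep_subst (ρ : ℂ → M →ₗ[ℂ] E) (n l : ℂ) (z : Poly (Poly M)) :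
    rep ρ n (subst (-(l • (1 : Module.End ℂ (Poly M))) - shift) z) = rep ρ n (ev (n - l) z) := by
  induction z using PolynomialModule.induction_linear with
  | zero => simp
  | add x y hx hy => simp only [map_add, hx, hy]
  | single k x =>
    rw [subst, lift_single, PolynomialModule.eval_single]
    induction k generalizing x with
    | zero => simp
    | succ k ih =>
      rw [pow_succ, Module.End.mul_apply, ih, map_smul, map_smul, LinearMap.sub_apply, map_sub,
        rep_shift, LinearMap.neg_apply, LinearMap.smul_apply, Module.End.one_apply, map_neg,
        map_smul, pow_succ, mul_smul]
      module

theorem free_mem (hmem : ∀ i j u v, u ∈ G i → v ∈ G j →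
      A u v ∈ G (i + j) ∧ B u v ∈ G (i + j) ∧ C u v ∈ G (i + j))
    {i j : ZMod 2} {p q : Poly M} (hp : p ∈ coeffsIn (G i)) (hq : q ∈ coeffsIn (G j)) :
    sesqExtend (genBracket A B C) p q ∈ coeffsIn (coeffsIn (G (i + j))) := by
  refine sesqExtend_mem (fun u hu v hv => ?_) hp hq
  obtain ⟨h1, h2, h3⟩ := hmem i j u v hu hv
  rw [genBracket_apply, mono_apply, mono_apply, mono_apply]
  exact Submodule.add_mem _ (Submodule.add_mem _ (single_mem _ (single_mem _ h1))
    (single_mem _ (single_mem _ h2))) (single_mem _ (single_mem _ h3))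

theorem free_left (l : ℂ) (a b : Poly M) : ev l (sesqExtend (genBracket A B C) (shift a) b) =
    -(l • ev l (sesqExtend (genBracket A B C) a b)) := by
  rw [sesqExtend_left, map_neg, ev_shift]

theorem free_right (l : ℂ) (a b : Poly M) : ev l (sesqExtend (genBracket A B C) a (shift b)) =
    shift (ev l (sesqExtend (genBracket A B C) a b))
      + l • ev l (sesqExtend (genBracket A B C) a b) := by
  rw [sesqExtend_right, map_add, ev_shift, ev_innerShift]

theorem free_skew (ρ : ℂ → M →ₗ[ℂ] E) (hinj : ∀ l u, ρ l u = 0 → u = 0)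
    (hρ : ∀ i j u v, u ∈ G i → v ∈ G j → ∀ l m : ℂ,
      ρ (l + m) (A u v + l • B u v - (l + m) • C u v) =
        ρ l u * ρ m v - sgn i j • (ρ m v * ρ l u))
    {i j : ZMod 2} {a b : Poly M} (ha : a ∈ coeffsIn (G i)) (hb : b ∈ coeffsIn (G j)) (l : ℂ) :
    ev l (sesqExtend (genBracket A B C) b a) = -(sgn i j •
      subst (-(l • (1 : Module.End ℂ (Poly M))) - shift) (sesqExtend (genBracket A B C) a b)) := by
  apply rep_ext ρ hinj
  intro n
  rw [map_neg, map_smul, rep_subst]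
  have h1 := rep_sesqExtend ρ hρ hb ha l (n - l)
  have h2 := rep_sesqExtend ρ hρ ha hb (n - l) l
  rw [add_sub_cancel] at h1
  rw [sub_add_cancel] at h2
  rw [h1, h2, smul_sub, smul_smul, sgn_mul_self, sgn_comm j i]
  module

theorem free_jacobi (ρ : ℂ → M →ₗ[ℂ] E) (hinj : ∀ l u, ρ l u = 0 → u = 0)
    (hρ : ∀ i j u v, u ∈ G i → v ∈ G j → ∀ l m : ℂ,
      ρ (l + m) (A u v + l • B u v - (l + m) • C u v) =
        ρ l u * ρ m v - sgn i j • (ρ m v * ρ l u))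
    (hmem : ∀ i j u v, u ∈ G i → v ∈ G j →
      A u v ∈ G (i + j) ∧ B u v ∈ G (i + j) ∧ C u v ∈ G (i + j))
    (hG : IsCompl (G 0) (G 1))
    {i j : ZMod 2} {a b c : Poly M} (ha : a ∈ coeffsIn (G i)) (hb : b ∈ coeffsIn (G j)) (l m : ℂ) :
    ev l (sesqExtend (genBracket A B C) a (ev m (sesqExtend (genBracket A B C) b c))) =
      ev (l + m) (sesqExtend (genBracket A B C) (ev l (sesqExtend (genBracket A B C) a b)) c)
      + sgn i j •
        ev m (sesqExtend (genBracket A B C) b (ev l (sesqExtend (genBracket A B C) a c))) := by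
  have hm : ∀ {i j : ZMod 2} {x y : Poly M}, x ∈ coeffsIn (G i) → y ∈ coeffsIn (G j) →
      ∀ t, ev t (sesqExtend (genBracket A B C) x y) ∈ coeffsIn (G (i + j)) :=
    fun hx hy t => ev_mem (free_mem hmem hx hy) t
  have main : ∀ k, ∀ c ∈ coeffsIn (G k),
      ev l (sesqExtend (genBracket A B C) a (ev m (sesqExtend (genBracket A B C) b c))) =
      ev (l + m) (sesqExtend (genBracket A B C) (ev l (sesqExtend (genBracket A B C) a b)) c)
      + sgn i j •
        ev m (sesqExtend (genBracket A B C) b (ev l (sesqExtend (genBracket A B C) a c))) := by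
    intro k c hc
    apply rep_ext ρ hinj
    intro n
    obtain ⟨r, hr⟩ : ∃ r, r = n - l - m := ⟨_, rfl⟩
    have n1 : n = l + (m + r) := by rw [hr]; ring
    have n2 : n = (l + m) + r := by rw [hr]; ring
    have n3 : n = m + (l + r) := by rw [hr]; ring
    have h1 := rep_sesqExtend ρ hρ ha (hm hb hc m) l (m + r)
    have h2 := rep_sesqExtend ρ hρ (hm ha hb l) hc (l + m) r
    have h3 := rep_sesqExtend ρ hρ hb (hm ha hc l) m (l + r)
    rw [rep_sesqExtend ρ hρ hb hc, ← n1] at h1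
    rw [rep_sesqExtend ρ hρ ha hb, ← n2] at h2
    rw [rep_sesqExtend ρ hρ ha hc, ← n3] at h3
    rw [map_add, map_smul, h1, h2, h3]
    generalize rep ρ l a = x
    generalize rep ρ m b = y
    generalize rep ρ r c = z
    have s1 := sgn_mul_self i j
    rw [sgn_add_right, sgn_add_left, sgn_add_right, sgn_comm j i]
    generalize sgn i j = s at s1 ⊢
    simp only [mul_sub, sub_mul, smul_sub, mul_smul_comm, smul_mul_assoc, smul_smul, mul_assoc]
    obtain rfl | rfl := mul_self_eq_one_iff.1 s1 <;> module
  obtain ⟨c0, h0, c1, h1, rfl⟩ := Submodule.mem_sup.1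
    ((coeffsIn_isCompl hG).sup_eq_top ▸ Submodule.mem_top :
      c ∈ coeffsIn (G 0) ⊔ coeffsIn (G 1))
  simp only [map_add, main 0 c0 h0, main 1 c1 h1, smul_add]
  abel

end FreeRep

end Free

/-! ### The Lie conformal superalgebras `W_N` -/

section WN

variable {N : ℕ}

/-- `W(N) ⊕ ∧(N)`. -/
def Gen (N : ℕ) := Der N × Lam N

instance (N : ℕ) : AddCommGroup (Gen N) := inferInstanceAs (AddCommGroup (Der N × Lam N))

instance (N : ℕ) : Module ℂ (Gen N) := inferInstanceAs (Module ℂ (Der N × Lam N))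

/-- The element `a + f` of `W(N) ⊕ ∧(N)`. -/
def Gen.mk (a : Der N) (f : Lam N) : Gen N := (a, f)

/-- The component in `W(N)`, as an operator on `∧(N)`. -/
def Gen.op (u : Gen N) : Module.End ℂ (Lam N) := u.1.1

/-- The component in `∧(N)`. -/
def Gen.fn (u : Gen N) : Lam N := u.2

theorem Gen.op_mem (u : Gen N) : u.op ∈ Der N := u.1.2

theorem Gen.ext {u v : Gen N} (h : u.op = v.op) (h' : u.fn = v.fn) : u = v :=
  Prod.ext (Subtype.ext h) h'

@[simp] theorem Gen.op_mk (a : Der N) (f : Lam N) : (Gen.mk a f).op = a := rfl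

@[simp] theorem Gen.fn_mk (a : Der N) (f : Lam N) : (Gen.mk a f).fn = f := rfl

@[simp] theorem Gen.op_add (u v : Gen N) : (u + v).op = u.op + v.op := rfl

@[simp] theorem Gen.fn_add (u v : Gen N) : (u + v).fn = u.fn + v.fn := rfl

@[simp] theorem Gen.op_sub (u v : Gen N) : (u - v).op = u.op - v.op := rfl

@[simp] theorem Gen.fn_sub (u v : Gen N) : (u - v).fn = u.fn - v.fn := rfl

@[simp] theorem Gen.op_smul (c : ℂ) (u : Gen N) : (c • u).op = c • u.op := rfl

@[simp] theorem Gen.fn_smul (c : ℂ) (u : Gen N) : (c • u).fn = c • u.fn := rfl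

@[simp] theorem Gen.op_zero : (0 : Gen N).op = 0 := rfl

@[simp] theorem Gen.fn_zero : (0 : Gen N).fn = 0 := rfl

/-- The underlying space `ℂ[∂] ⊗ (W(N) ⊕ ∧(N))` of `W_N`. -/
abbrev WSpace (N : ℕ) := Poly (Gen N)

/-- The grading of `W(N) ⊕ ∧(N)`. -/
def genGrade (N : ℕ) (i : ZMod 2) : Submodule ℂ (Gen N) where
  carrier := {u | u.op ∈ der N i ∧ u.fn ∈ par N i}
  add_mem' hu hv := ⟨Submodule.add_mem _ hu.1 hv.1, Submodule.add_mem _ hu.2 hv.2⟩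
  zero_mem' := ⟨Submodule.zero_mem _, Submodule.zero_mem _⟩
  smul_mem' c _ hu := ⟨Submodule.smul_mem _ c hu.1, Submodule.smul_mem _ c hu.2⟩

/-- For `u = a + f`, `v = b + g` in `W(N) ⊕ ∧(N)` the bracket is
`[u_λ v] = brA u v + λ brB u v + ∂ brC u v`; this is the part without `λ` and `∂`, namely
`[a,b] + a(g) - (-1)^{p(b)p(f)} b(f)`. -/
def brA : Gen N →ₗ[ℂ] Gen N →ₗ[ℂ] Gen N :=
  LinearMap.mk₂ ℂ
    (fun u v => Gen.mk ⟨comm u.op v.op, comm_mem u.op_mem v.op_mem⟩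
      (u.op v.fn - swapApply v.op u.fn))
    (by
      intro u u' v
      refine Gen.ext ?_ ?_
      · simp only [comm, Gen.op_mk, Gen.fn_mk, Gen.op_add, Gen.fn_add, add_mul, map_add, LinearMap.add_apply]
        abel
      · simp only [swapApply, Gen.op_mk, Gen.fn_mk, Gen.op_add, Gen.fn_add, map_add,
          LinearMap.add_apply]
        abel)
    (by
      intro c u v
      refine Gen.ext ?_ ?_
      · simp only [comm, Gen.op_mk, Gen.fn_mk, Gen.op_smul, Gen.fn_smul, smul_mul_assoc, map_smul,
          LinearMap.smul_apply, smul_sub]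
      · simp only [swapApply, Gen.op_mk, Gen.fn_mk, Gen.op_smul, Gen.fn_smul, map_smul,
          LinearMap.smul_apply, smul_sub, smul_add])
    (by
      intro u v v'
      refine Gen.ext ?_ ?_
      · simp only [comm, Gen.op_mk, Gen.fn_mk, Gen.op_add, Gen.fn_add, mul_add, map_add]
        abel
      · simp only [swapApply, Gen.op_mk, Gen.fn_mk, Gen.op_add, Gen.fn_add, map_add,
          LinearMap.add_apply]
        abel)
    (by
      intro c u v
      refine Gen.ext ?_ ?_
      · simp only [comm, Gen.op_mk, Gen.fn_mk, Gen.op_smul, Gen.fn_smul, mul_smul_comm, map_smul, smul_sub]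
      · simp only [swapApply, Gen.op_mk, Gen.fn_mk, Gen.op_smul, Gen.fn_smul, map_smul,
          LinearMap.smul_apply, smul_sub, smul_add])

/-- The coefficient of `λ`: `-(-1)^{p(a)p(g)} g a - f b - 2 f g`. -/
def brB : Gen N →ₗ[ℂ] Gen N →ₗ[ℂ] Gen N :=
  LinearMap.mk₂ ℂ
    (fun u v => Gen.mk ⟨-swapLmul u.op v.fn - lmul u.fn * v.op,
        Submodule.sub_mem _ (Submodule.neg_mem _ (swapLmul_mem u.op_mem v.fn))
          (lmul_mem v.op_mem u.fn)⟩
      (-((2 : ℂ) • (u.fn * v.fn))))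
    (by
      intro u u' v
      refine Gen.ext ?_ ?_
      · simp only [swapLmul, lmul_add, Gen.op_mk, Gen.fn_mk, Gen.op_add, Gen.fn_add, add_mul,
          map_add, LinearMap.add_apply]
        abel
      · simp only [Gen.op_mk, Gen.fn_mk, Gen.op_add, Gen.fn_add, add_mul, smul_add]
        abel)
    (by
      intro c u v
      refine Gen.ext ?_ ?_
      · simp only [swapLmul, lmul_smul, Gen.op_mk, Gen.fn_mk, Gen.op_smul, Gen.fn_smul, smul_mul_assoc, map_smul, LinearMap.smul_apply, smul_sub, smul_neg]
      · simp only [Gen.op_mk, Gen.fn_mk, Gen.op_smul, Gen.fn_smul, smul_mul_assoc, smul_neg, smul_comm c (2 : ℂ)])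
    (by
      intro u v v'
      refine Gen.ext ?_ ?_
      · simp only [swapLmul, lmul_add, Gen.op_mk, Gen.fn_mk, Gen.op_add, Gen.fn_add, mul_add,
          map_add]
        abel
      · simp only [Gen.op_mk, Gen.fn_mk, Gen.op_add, Gen.fn_add, mul_add, smul_add]
        abel)
    (by
      intro c u v
      refine Gen.ext ?_ ?_
      · simp only [swapLmul, lmul_smul, Gen.op_mk, Gen.fn_mk, Gen.op_smul, Gen.fn_smul, mul_smul_comm, map_smul, smul_sub, smul_neg]
      · simp only [Gen.op_mk, Gen.fn_mk, Gen.op_smul, Gen.fn_smul, mul_smul_comm, smul_neg, smul_comm c (2 : ℂ)])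

/-- The coefficient of `∂`: `- f b - f g`. -/
def brC : Gen N →ₗ[ℂ] Gen N →ₗ[ℂ] Gen N :=
  LinearMap.mk₂ ℂ
    (fun u v => Gen.mk ⟨-(lmul u.fn * v.op), Submodule.neg_mem _ (lmul_mem v.op_mem u.fn)⟩
      (-(u.fn * v.fn)))
    (by
      intro u u' v
      refine Gen.ext ?_ ?_
      · simp only [lmul_add, Gen.op_mk, Gen.fn_mk, Gen.op_add, Gen.fn_add, add_mul, Gen.op_mk, Gen.fn_mk, Gen.op_add, Gen.fn_add]
        abel
      · simp only [Gen.op_mk, Gen.fn_mk, Gen.op_add, Gen.fn_add, add_mul]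
        abel)
    (by
      intro c u v
      refine Gen.ext ?_ ?_
      · simp only [lmul_smul, Gen.op_mk, Gen.fn_mk, Gen.op_smul, Gen.fn_smul, smul_mul_assoc, smul_neg]
      · simp only [Gen.op_mk, Gen.fn_mk, Gen.op_smul, Gen.fn_smul, smul_mul_assoc, smul_neg])
    (by
      intro u v v'
      refine Gen.ext ?_ ?_
      · simp only [Gen.op_mk, Gen.fn_mk, Gen.op_add, Gen.fn_add, mul_add]
        abel
      · simp only [Gen.op_mk, Gen.fn_mk, Gen.op_add, Gen.fn_add, mul_add]
        abel)
    (by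
      intro c u v
      refine Gen.ext ?_ ?_
      · simp only [Gen.op_mk, Gen.fn_mk, Gen.op_smul, Gen.fn_smul, mul_smul_comm, smul_neg]
      · simp only [Gen.op_mk, Gen.fn_mk, Gen.op_smul, Gen.fn_smul, mul_smul_comm, smul_neg])

/-- The `λ`-bracket of two elements of `W(N) ⊕ ∧(N)`, a polynomial in `λ` with coefficients in
`ℂ[∂] ⊗ (W(N) ⊕ ∧(N))`. For homogeneous `a, b ∈ W(N)` and `f, g ∈ ∧(N)` it is given by
`[a_λ b] = [a, b]`, `[a_λ f] = a(f) - λ (-1)^{p(a)p(f)} f a`, `[f_λ g] = -∂(fg) - 2λ fg` and, by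
skew-commutativity, `[f_λ b] = -(-1)^{p(b)p(f)} b(f) - (λ + ∂) f b`. -/
def wGenBracket : Gen N →ₗ[ℂ] Gen N →ₗ[ℂ] Poly (WSpace N) := genBracket brA brB brC

/-- The `λ`-bracket of `W_N`. -/
def wBracket : WSpace N →ₗ[ℂ] WSpace N →ₗ[ℂ] Poly (WSpace N) := sesqExtend wGenBracket

end WN

section Rep

variable {N : ℕ}

/-- The substitution `∂ ↦ ∂ + l` in `ℂ[∂] ⊗ ∧(N)`. -/
def tau (l : ℂ) : Module.End ℂ (Poly (Lam N)) :=
  lift fun n => ((shift + l • (1 : Module.End ℂ (Poly (Lam N)))) ^ n) ∘ₗ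
    PolynomialModule.lsingle ℂ 0

/-- The action of an operator on `∧(N)` on coefficients. -/
def opMap : Module.End ℂ (Lam N) →ₗ[ℂ] Module.End ℂ (Poly (Lam N)) where
  toFun a := PolynomialModule.map ℂ a
  map_add' a b := by
    apply PolynomialModule.hom_ext
    intro n
    refine LinearMap.ext fun x => ?_
    simp
  map_smul' c a := by
    apply PolynomialModule.hom_ext
    intro n
    refine LinearMap.ext fun x => ?_
    simp

theorem end_poly_ext {P : Type*} [AddCommGroup P] [Module ℂ P] {A B : Poly (Lam N) →ₗ[ℂ] P}
    (h : ∀ n x, A (PolynomialModule.single ℂ n x) = B (PolynomialModule.single ℂ n x)) :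
    A = B := by
  apply PolynomialModule.hom_ext
  intro n
  refine LinearMap.ext fun x => ?_
  exact h n x

theorem opMap_single (a : Module.End ℂ (Lam N)) (n : ℕ) (x : Lam N) :
    opMap a (PolynomialModule.single ℂ n x) = PolynomialModule.single ℂ n (a x) :=
  PolynomialModule.map_single _ _ _ _

theorem opMap_mul (a b : Module.End ℂ (Lam N)) : opMap (a * b) = opMap a * opMap b := by
  apply end_poly_ext
  intro n x
  rw [Module.End.mul_apply, opMap_single, opMap_single, opMap_single]; rfl

theorem opMap_shift (a : Module.End ℂ (Lam N)) : opMap a * shift = shift * opMap a := by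
  apply end_poly_ext
  intro n x
  rw [Module.End.mul_apply, Module.End.mul_apply, opMap_single, shift_single, shift_single,
    opMap_single]

theorem tau_single (l : ℂ) (n : ℕ) (x : Lam N) : tau l (PolynomialModule.single ℂ n x) =
    ((shift + l • 1) ^ n : Module.End ℂ (Poly (Lam N))) (PolynomialModule.single ℂ 0 x) := by
  rw [tau, lift_single]; rfl

theorem tau_shift (l : ℂ) : (tau l : Module.End ℂ (Poly (Lam N))) * shift =
    shift * tau l + l • tau l := by
  apply end_poly_ext
  intro n x
  rw [Module.End.mul_apply, shift_single, tau_single, pow_succ', Module.End.mul_apply,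
    ← tau_single]
  rfl

theorem tau_shift_pow (l m : ℂ) (n : ℕ) :
    (tau l : Module.End ℂ (Poly (Lam N))) * (shift + m • 1) ^ n =
      (shift + (l + m) • 1) ^ n * tau l := by
  induction n with
  | zero => simp
  | succ n ih =>
    have h : (tau l : Module.End ℂ (Poly (Lam N))) * (shift + m • 1) =
        (shift + (l + m) • 1) * tau l := by
      rw [mul_add, tau_shift, add_mul, mul_smul_comm, smul_mul_assoc, mul_one, one_mul, add_smul,
        add_assoc]
    rw [pow_succ, ← mul_assoc, ih, mul_assoc, h, ← mul_assoc, ← pow_succ]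

theorem tau_mul (l m : ℂ) : (tau l : Module.End ℂ (Poly (Lam N))) * tau m = tau (l + m) := by
  apply end_poly_ext
  intro n x
  rw [Module.End.mul_apply, tau_single m, ← Module.End.mul_apply, tau_shift_pow,
    Module.End.mul_apply, tau_single, tau_single, pow_zero]
  rfl

theorem opMap_tau (l : ℂ) (a : Module.End ℂ (Lam N)) : tau l * opMap a = opMap a * tau l := by
  apply end_poly_ext
  intro n x
  have h : Commute (opMap a) ((shift + l • (1 : Module.End ℂ (Poly (Lam N)))) ^ n) := by
    refine Commute.pow_right (Commute.add_right (opMap_shift a) ?_) n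
    exact (Commute.one_right _).smul_right l
  rw [Module.End.mul_apply, Module.End.mul_apply, opMap_single, tau_single, tau_single,
    ← Module.End.mul_apply (opMap a), h.eq, Module.End.mul_apply, opMap_single]

/-- The action of `a + f ∈ W(N) ⊕ ∧(N)` on `ℂ[∂] ⊗ ∧(N)` for the numerical value `l` of `λ`:
`a_λ g = a(g)`, `f_λ g = -(∂ + λ) f g`, and `∂` is shifted by `λ`. -/
def repGen (l : ℂ) : Gen N →ₗ[ℂ] Module.End ℂ (Poly (Lam N)) where
  toFun u := (opMap u.op - (shift + l • 1) * opMap (lmul u.fn)) * tau l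
  map_add' u v := by
    simp only [Gen.op_add, Gen.fn_add, lmul_add, map_add, mul_add]
    rw [← add_mul]; congr 1; abel
  map_smul' c u := by
    simp only [Gen.op_smul, Gen.fn_smul, lmul_smul, map_smul,
      mul_smul_comm, RingHom.id_apply]
    rw [← smul_sub, smul_mul_assoc]

theorem repGen_apply (l : ℂ) (u : Gen N) : repGen l u =
    (opMap u.op - (shift + l • 1) * opMap (lmul u.fn)) * tau l := rfl

theorem der_lmul {i j : ZMod 2} {a : Module.End ℂ (Lam N)} {f : Lam N} (ha : a ∈ der N i)
    (hf : f ∈ par N j) : a * lmul f = lmul (a f) + sgn i j • (lmul f * a) := by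
  refine LinearMap.ext fun g => ?_
  exact (ha j f hf).2 g

theorem lmul_lmul (f g : Lam N) : lmul (f * g) = lmul f * lmul g := by
  refine LinearMap.ext fun h => ?_
  exact mul_assoc f g h

theorem lmul_sub (f g : Lam N) : lmul (f - g) = lmul f - lmul g := by
  refine LinearMap.ext fun h => ?_
  exact sub_mul f g h

/-- The identity in an associative algebra behind `rep_wGenBracket`. -/
theorem rep_identity {E : Type*} [Ring E] [Algebra ℂ E] (l m s : ℂ) (hs : s * s = 1)
    (a b f g d tl tm t ag bf : E) (hda : a * d = d * a) (hdb : b * d = d * b)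
    (hdf : f * d = d * f) (hdg : g * d = d * g)
    (hlb : tl * b = b * tl) (hlg : tl * g = g * tl) (hma : tm * a = a * tm)
    (hmf : tm * f = f * tm) (hld : tl * d = d * tl + l • tl) (hmd : tm * d = d * tm + m • tm)
    (hlm : tl * tm = t) (hml : tm * tl = t) (hag : a * g = ag + s • (g * a))
    (hbf : b * f = bf + s • (f * b)) (hgf : g * f = s • (f * g)) :
    (a * b - s • (b * a) - (l * s) • (g * a) + m • (f * b)
        - (d + (l + m) • 1) * (ag - s • bf + (m - l) • (f * g))) * t =
      (a - (d + l • 1) * f) * tl * ((b - (d + m • 1) * g) * tm)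
        - s • ((b - (d + m • 1) * g) * tm * ((a - (d + l • 1) * f) * tl)) := by
  have h1 : tl * ((b - (d + m • 1) * g) * tm) = (b - (d + (l + m) • 1) * g) * t := by
    have : tl * ((b - (d + m • 1) * g)) = (b - (d + (l + m) • 1) * g) * tl := by
      rw [mul_sub, hlb, ← mul_assoc, mul_add, hld, mul_smul_comm, mul_one, sub_mul, mul_assoc _ g,
        ← hlg, ← mul_assoc _ tl]
      simp only [add_mul, smul_mul_assoc, one_mul, add_smul, add_assoc]
    rw [← mul_assoc, this, mul_assoc, hlm]
  have h2 : tm * ((a - (d + l • 1) * f) * tl) = (a - (d + (l + m) • 1) * f) * t := by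
    have : tm * ((a - (d + l • 1) * f)) = (a - (d + (l + m) • 1) * f) * tm := by
      rw [mul_sub, hma, ← mul_assoc, mul_add, hmd, mul_smul_comm, mul_one, sub_mul, mul_assoc _ f,
        ← hmf, ← mul_assoc _ tm]
      simp only [add_mul, smul_mul_assoc, one_mul, add_smul, add_assoc]
      abel
    rw [← mul_assoc, this, mul_assoc, hml]
  rw [mul_assoc, h1, mul_assoc (b - (d + m • 1) * g), h2, ← mul_assoc (a - (d + l • 1) * f),
    ← mul_assoc (b - (d + m • 1) * g), ← smul_mul_assoc s (_ * _) t, ← sub_mul]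
  congr 1
  have c1 : ∀ x y : E, x * d = d * x → x * (d * y) = d * (x * y) := by
    intro x y h; rw [← mul_assoc, h, mul_assoc]
  have e1 : ∀ y : E, a * (d * y) = d * (a * y) := fun y => c1 a y hda
  have e2 : ∀ y : E, b * (d * y) = d * (b * y) := fun y => c1 b y hdb
  have e3 : ∀ y : E, f * (d * y) = d * (f * y) := fun y => c1 f y hdf
  have e4 : ∀ y : E, g * (d * y) = d * (g * y) := fun y => c1 g y hdg
  simp only [add_mul, mul_add, sub_mul, mul_sub, smul_mul_assoc, mul_smul_comm, one_mul,
    mul_assoc, e1, e2, e3, e4, hag, hbf, hgf, smul_add, smul_sub, smul_smul]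
  obtain rfl | rfl := mul_self_eq_one_iff.1 hs
  · match_scalars <;> ring
  · match_scalars <;> ring

theorem repGen_injective (l : ℂ) {u : Gen N} (h : repGen l u = 0) : u = 0 := by
  have key : ∀ g : Lam N, PolynomialModule.single ℂ 0 (u.op g)
      - (PolynomialModule.single ℂ 1 (u.fn * g) + l • PolynomialModule.single ℂ 0 (u.fn * g)) = 0 := by
    intro g
    have h1 := LinearMap.congr_fun h (PolynomialModule.single ℂ 0 g)
    rw [repGen_apply, Module.End.mul_apply, tau_single, pow_zero, Module.End.one_apply,
      LinearMap.sub_apply, opMap_single, Module.End.mul_apply, opMap_single] at h1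
    simpa using h1
  have h2 : u.fn = 0 := by
    have h3 := congrArg (fun p => PolynomialModule.coeff p 1) (sub_eq_zero.1 (key 1))
    simpa [← PolynomialModule.single_smul] using h3.symm
  refine Gen.ext (LinearMap.ext fun g => ?_) h2
  have := congrArg (fun p => PolynomialModule.coeff p 0) (sub_eq_zero.1 (key g))
  simpa [h2] using this

theorem repGen_bracket {i j : ZMod 2} {u v : Gen N} (hu : u ∈ genGrade N i)
    (hv : v ∈ genGrade N j) (l m : ℂ) :
    repGen (l + m) (brA u v + l • brB u v - (l + m) • brC u v) =
      repGen l u * repGen m v - sgn i j • (repGen m v * repGen l u) := by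
  have ha : u.op ∈ der N i := hu.1
  have hb : v.op ∈ der N j := hv.1
  have hf : u.fn ∈ par N i := hu.2
  have hg : v.fn ∈ par N j := hv.2
  have e1 : (brA u v + l • brB u v - (l + m) • brC u v).op =
      u.op * v.op - sgn i j • (v.op * u.op) - (l * sgn i j) • (lmul v.fn * u.op)
        + m • (lmul u.fn * v.op) := by
    change u.op * v.op - swapMul u.op v.op + l • (-swapLmul u.op v.fn - lmul u.fn * v.op)
      - (l + m) • -(lmul u.fn * v.op) = _
    rw [swapLmul, (isPar_der ha).swapMul (isPar_der hb), (isPar_der ha).swapMul (isPar_lmul hg)]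
    module
  have e2 : (brA u v + l • brB u v - (l + m) • brC u v).fn =
      u.op v.fn - sgn i j • v.op u.fn + (m - l) • (u.fn * v.fn) := by
    change u.op v.fn - swapApply v.op u.fn + l • -((2 : ℂ) • (u.fn * v.fn))
      - (l + m) • -(u.fn * v.fn) = _
    rw [swapApply_par (isPar_der hb) hf, sgn_comm j i]
    module
  rw [repGen_apply, repGen_apply, repGen_apply, e1, e2]
  simp only [lmul_add, lmul_sub, lmul_smul, lmul_lmul, map_add, map_sub, map_smul, opMap_mul]
  refine rep_identity l m (sgn i j) (sgn_mul_self i j) _ _ _ _ _ _ _ _ _ _ (opMap_shift _)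
    (opMap_shift _) (opMap_shift _) (opMap_shift _) (opMap_tau _ _) (opMap_tau _ _)
    (opMap_tau _ _) (opMap_tau _ _) ?_ ?_ (tau_mul l m) ?_ ?_ ?_ ?_
  · exact tau_shift l
  · exact tau_shift m
  · rw [tau_mul, add_comm]
  · rw [← opMap_mul, der_lmul ha hg, map_add, map_smul, opMap_mul]
  · rw [← opMap_mul, der_lmul hb hf, map_add, map_smul, opMap_mul, sgn_comm j i]
  · rw [← opMap_mul, ← opMap_mul, ← lmul_lmul, lam_comm hf hg, lmul_smul, map_smul, lmul_lmul]

theorem br_mem {i j : ZMod 2} {u v : Gen N} (hu : u ∈ genGrade N i) (hv : v ∈ genGrade N j) :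
    brA u v ∈ genGrade N (i + j) ∧ brB u v ∈ genGrade N (i + j) ∧
      brC u v ∈ genGrade N (i + j) := by
  have ha : u.op ∈ der N i := hu.1
  have hb : v.op ∈ der N j := hv.1
  have hf : u.fn ∈ par N i := hu.2
  have hg : v.fn ∈ par N j := hv.2
  have hfb : lmul u.fn * v.op ∈ der N (i + j) := by
    rw [add_comm]; exact lmul_der hb hf
  refine ⟨⟨?_, ?_⟩, ⟨?_, ?_⟩, ⟨?_, ?_⟩⟩
  · exact comm_der ha hb
  · refine Submodule.sub_mem _ (isPar_der ha _ _ hg) ?_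
    rw [swapApply_par (isPar_der hb) hf, add_comm]
    exact Submodule.smul_mem _ _ (isPar_der hb _ _ hf)
  · refine Submodule.sub_mem _ (Submodule.neg_mem _ ?_) hfb
    rw [swapLmul, (isPar_der ha).swapMul (isPar_lmul hg)]
    exact Submodule.smul_mem _ _ (lmul_der ha hg)
  · exact Submodule.neg_mem _ (Submodule.smul_mem _ _ (par_mul hf hg))
  · exact Submodule.neg_mem _ hfb
  · exact Submodule.neg_mem _ (par_mul hf hg)

theorem genGrade_isCompl (N : ℕ) : IsCompl (genGrade N 0) (genGrade N 1) := by
  constructor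
  · rw [Submodule.disjoint_def]
    rintro ⟨⟨a, ha⟩, f⟩ ⟨h1, h2⟩ ⟨h3, h4⟩
    have hf : f = 0 := Submodule.disjoint_def.1 (par_isCompl N).disjoint f h2 h4
    have h1' : a ∈ der N 0 := h1
    have h3' : a ∈ der N 1 := h3
    have ha0 : a = 0 := by
      apply end_ext
      intro i g hg
      have k0 := isPar_der h1' i g hg
      have k1 := isPar_der h3' i g hg
      rcases zmod_two_cases i with rfl | rfl
      · exact Submodule.disjoint_def.1 (par_isCompl N).disjoint _ k0 k1
      · exact Submodule.disjoint_def.1 (par_isCompl N).disjoint _ k1 k0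
    subst hf ha0
    rfl
  · rw [codisjoint_iff, eq_top_iff]
    rintro ⟨⟨a, ha⟩, f⟩ -
    obtain ⟨a0, h0, a1, h1, rfl⟩ := Submodule.mem_sup.1 ha
    obtain ⟨f0, k0, f1, k1, rfl⟩ := par_decomp f
    exact Submodule.mem_sup.2 ⟨(⟨a0, der_le _ h0⟩, f0), ⟨h0, k0⟩, (⟨a1, der_le _ h1⟩, f1),
      ⟨h1, k1⟩, rfl⟩

end Rep

/-- The Lie conformal superalgebra `W_N = ℂ[∂] ⊗ (W(N) ⊕ ∧(N))`. -/
def W (N : ℕ) : LieConformalSuperalgebra (WSpace N) where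
  grade i := coeffsIn (genGrade N i)
  isCompl := coeffsIn_isCompl (genGrade_isCompl N)
  D := shift
  D_mem _ _ h := shift_mem h
  bracket := wBracket
  bracket_mem _ _ _ _ ha hb :=
    free_mem (G := genGrade N) (A := brA) (B := brB) (C := brC)
      (fun _ _ _ _ hu hv => br_mem hu hv) ha hb
  sesq_left l a b := free_left (A := brA) (B := brB) (C := brC) l a b
  sesq_right l a b := free_right (A := brA) (B := brB) (C := brC) l a b
  skew i j a b ha hb l :=
    free_skew (G := genGrade N) (A := brA) (B := brB) (C := brC) repGen
    (fun l _ h => repGen_injective l h)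
    (fun _ _ _ _ hu hv l m => repGen_bracket hu hv l m) ha hb l
  jacobi i j a b c ha hb l m :=
    free_jacobi (G := genGrade N) (A := brA) (B := brB) (C := brC) repGen
    (fun l _ h => repGen_injective l h)
    (fun _ _ _ _ hu hv l m => repGen_bracket hu hv l m) (fun _ _ _ _ hu hv => br_mem hu hv)
    (genGrade_isCompl N) ha hb l m

/-! ### The table of values of a cocycle on `W_N` -/

/-- The monomial `ξ_s = ξ_{i₁} ⋯ ξ_{iₖ}`, where `i₁ < ⋯ < iₖ` are the elements of `s`. -/
def ξ {N : ℕ} (s : Finset (Fin N)) : Lam N :=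
  ((s.sort (· ≤ ·)).map fun i => ExteriorAlgebra.ι ℂ (Pi.single i (1 : ℂ) : Fin N → ℂ)).prod

/-- The monomial basis of `W(N) ⊕ ∧(N)`, as a subset of `W_N`: the pair `(s, some i)` gives
`ξ_s ∂ᵢ ∈ W(N)` and the pair `(s, none)` gives `ξ_s ∈ ∧(N)`. -/
def gen {N : ℕ} : Finset (Fin N) × Option (Fin N) → WSpace N
  | (s, some i) => PolynomialModule.single ℂ 0
      (Gen.mk ⟨lmul (ξ s) * dξ i, lmul_mem (der_le 1 (dξ_mem_der i)) (ξ s)⟩ 0)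
  | (s, none) => PolynomialModule.single ℂ 0 (Gen.mk 0 (ξ s))

/-- A list of nonzero entries of a cocycle on `W_N`; `(x, y, n, r)` stands for the entry
`α_n(x, y) = r`, where `α_λ(x, y) = ∑ α_n(x, y) λⁿ / n!`. -/
abbrev Table (N : ℕ) :=
  List ((Finset (Fin N) × Option (Fin N)) × (Finset (Fin N) × Option (Fin N)) × ℕ × ℂ)

/-- The cocycle has the entries of the table, and it vanishes on all pairs of elements of the basis
which are not listed in one of the two orders. -/
def HasTable {N : ℕ} (c : TwoCocycle (W N)) (T : Table N) : Prop :=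
  (∀ x y n r, (x, y, n, r) ∈ T →
    c.α (gen x) (gen y) = PolynomialModule.single ℂ n (r / (n.factorial : ℂ))) ∧
  ∀ x y, (∀ n r, (x, y, n, r) ∉ T ∧ (y, x, n, r) ∉ T) → c.α (gen x) (gen y) = 0

/-- `α_3(1, 1) = 1/2`. -/
def table0 : Table 0 := [((∅, none), (∅, none), 3, 1 / 2)]

/-- `α_1(ξ₁∂₁, ξ₁∂₁) = 1/3`, `α_2(ξ₁∂₁, 1) = 1/3`, `α_2(∂₁, ξ₁) = -1/3`. -/
def table1 : Table 1 :=
  [(({0}, some 0), ({0}, some 0), 1, 1 / 3),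
   (({0}, some 0), (∅, none), 2, 1 / 3),
   ((∅, some 0), ({0}, none), 2, -1 / 3)]

/-- `α_1(ξ₁∂₂, ξ₂∂₁) = 1/6`, `α_1(ξ₁∂₁, ξ₂∂₂) = -1/6`, `α_1(ξ₁ξ₂∂₂, ∂₁) = -1/6`,
`α_1(ξ₁ξ₂∂₁, ∂₂) = 1/6` (the indices `1, 2` are `0, 1` in the code). -/
def table2 : Table 2 :=
  [(({0}, some 1), ({1}, some 0), 1, 1 / 6),
   (({0}, some 0), ({1}, some 1), 1, -1 / 6),
   (({0, 1}, some 1), (∅, some 0), 1, -1 / 6),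
   (({0, 1}, some 0), (∅, some 1), 1, 1 / 6)]

/-- `W_N` has, up to isomorphism, exactly one non-trivial central extension with one-dimensional
kernel, and it is the one defined by the `2`-cocycle with the given table. -/
def HasUniqueCentralExtension.{u, v} (N : ℕ) (T : Table N) : Prop :=
  ∃ c : TwoCocycle (W N), HasTable c T ∧ ¬ c.centralExtension.IsTrivial ∧
    ∀ (K : Type u) (S : Type v) [AddCommGroup K] [Module ℂ K] [AddCommGroup S] [Module ℂ S]
      (𝓚 : LieConformalSuperalgebra K) (𝓢 : LieConformalSuperalgebra S)
      (E : CentralExtension 𝓚 𝓢 (W N)),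
      Module.finrank ℂ K = 1 → ¬ E.IsTrivial → E.IsIso c.centralExtension


end LieConf

end

universe u v

noncomputable section

namespace LieConf

/-! ### Sections of central extensions -/

section Extension

variable {R S K : Type*} [AddCommGroup R] [Module ℂ R] [AddCommGroup S] [Module ℂ S]
  [AddCommGroup K] [Module ℂ K] {𝓚 : LieConformalSuperalgebra K}
  {𝓢 : LieConformalSuperalgebra S} {𝓡 : LieConformalSuperalgebra R}

/-! A graded ℂ[∂]-splitting of a central extension turns its bracket into a 2-cocycle α with values
in the kernel K. As ∂K = 0, sesquilinearity replaces ∂ by -λ in the first argument of α_λ and by λ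
in the second, so α is known from its restriction to W(N) ⊕ ∧(N) at each number λ (`GenCocycle`).
Polynomial dependence on λ is not imposed on this restriction; the identities force it.

The element -1 ∈ ∧(N) is a Virasoro element for which W(N) has conformal weight 1 and ∧(N) weight 2.
The cocycle identity for (1, 1, x) forces α_λ(1, a) to be a combination of λ and λ², and α_λ(1, f)
one of λ and λ³. A change of splitting removes the linear terms (`exists_isNormalized`). The
identities for (1, x, y) then show that α_λ(a, b) = λB(a, b), that α_λ(a, f) is ±λ² α_1(1, fa), and
that α_1(1, ·) vanishes on commutators [a, b] and on values a(f) (`der_der`, `der_lam`). Every f is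
a sum of values of derivations if N ≥ 1, and W(N) is perfect if N ≥ 2, so for N ≥ 2 all of α(1, ·)
vanishes and only B is left.

The form B is invariant, and `swap` moves a coefficient across: B(a, f∂ₘ) = ±B(∂ₘ, fa). Hence B is
determined by the values B(∂ⱼ, f∂ₘ). By invariance these vanish if f is some ∂ₚg, and also if an
index p differs from j and m, because ξₚ∂ₚ commutes with ∂ⱼ. For N ≥ 3 such a p always exists, so α
= 0. For N = 2 only B(∂₁, ξ₁ξ₂∂₂) and B(∂₂, ξ₁ξ₂∂₁) survive, and both equal B(ξ₁∂₁, ξ₂∂₂) up to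
sign. For N = 1 everything depends on α_1(1, ξ₁∂₁), and for N = 0 on α_1(1, 1).

So for N ≤ 2 one value, at a pair of equal parity, determines a normalized cocycle. An explicit
normalized cocycle C with this value nonzero is checked in coordinates; it is not a coboundary,
because a coboundary puts only linear terms into α_λ(1, ·). Any other normalized cocycle is C ⊗ k
with k even, so an extension with one-dimensional kernel is trivial or isomorphic to that of C
(`hasUniqueCentralExtension_of_determined`). -/

theorem LieConformalSuperalgebra.decomp (𝓡 : LieConformalSuperalgebra R) (a : R) :
    ∃ b ∈ 𝓡.grade 0, ∃ c ∈ 𝓡.grade 1, b + c = a :=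
  Submodule.mem_sup.1 (𝓡.isCompl.sup_eq_top ▸ Submodule.mem_top)

theorem CentralExtension.bracket_ι (E : CentralExtension 𝓚 𝓢 𝓡) (x : S) (k : K) :
    𝓢.bracket x (E.ι.f k) = 0 := by
  have key : ∀ i j, ∀ x ∈ 𝓢.grade i, ∀ k ∈ 𝓚.grade j, 𝓢.bracket x (E.ι.f k) = 0 := by
    intro i j x hx k hk
    apply poly_ext
    intro l
    rw [𝓢.skew j i _ _ (E.ι.map_grade j k hk) hx, E.central]
    simp
  obtain ⟨x0, hx0, x1, hx1, rfl⟩ := 𝓢.decomp x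
  obtain ⟨k0, hk0, k1, hk1, rfl⟩ := 𝓚.decomp k
  simp only [map_add, LinearMap.add_apply, key 0 0 _ hx0 _ hk0, key 0 1 _ hx0 _ hk1,
    key 1 0 _ hx1 _ hk0, key 1 1 _ hx1 _ hk1, add_zero]

/-- The component of k of the wrong parity has an image that is both even and odd, hence zero, and ι
is injective. -/
theorem CentralExtension.ι_mem_iff (E : CentralExtension 𝓚 𝓢 𝓡) {i : ZMod 2} {k : K} :
    E.ι.f k ∈ 𝓢.grade i ↔ k ∈ 𝓚.grade i := by
  refine ⟨fun h => ?_, E.ι.map_grade i k⟩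
  obtain ⟨k0, hk0, k1, hk1, rfl⟩ := 𝓚.decomp k
  rw [map_add] at h
  have h0 := E.ι.map_grade _ _ hk0
  have h1 := E.ι.map_grade _ _ hk1
  rcases zmod_two_cases i with rfl | rfl
  · have : E.ι.f k1 ∈ 𝓢.grade 0 := by simpa using Submodule.sub_mem _ h h0
    have := Submodule.disjoint_def.1 𝓢.isCompl.disjoint _ this h1
    rw [E.ι_injective (this.trans (map_zero _).symm), add_zero]
    exact hk0
  · have : E.ι.f k0 ∈ 𝓢.grade 1 := by simpa using Submodule.sub_mem _ h h1
    have := Submodule.disjoint_def.1 𝓢.isCompl.disjoint _ h0 this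
    rw [E.ι_injective (this.trans (map_zero _).symm), zero_add]
    exact hk1

/-- A splitting of a central extension as a sequence of graded `ℂ[∂]`-modules. -/
structure CentralExtension.Section (E : CentralExtension 𝓚 𝓢 𝓡) where
  s : R →ₗ[ℂ] S
  map_grade : ∀ i a, a ∈ 𝓡.grade i → s a ∈ 𝓢.grade i
  map_D : ∀ a, s (𝓡.D a) = 𝓢.D (s a)
  π_s : ∀ a, E.π.f (s a) = a

/-! ### The cocycle of a splitting -/

namespace CentralExtension.Section

variable {E : CentralExtension 𝓚 𝓢 𝓡} (σ : E.Section)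

/-- The retraction `S → K` defined by a section. -/
def retr : S →ₗ[ℂ] K :=
  (LinearEquiv.ofInjective E.ι.f E.ι_injective).symm.toLinearMap ∘ₗ
    (LinearMap.id - σ.s ∘ₗ E.π.f).codRestrict (LinearMap.range E.ι.f) (fun x => by
      rw [E.exact, LinearMap.mem_ker]
      simp [σ.π_s])

theorem ι_retr (x : S) : E.ι.f (σ.retr x) = x - σ.s (E.π.f x) := by
  have := LinearEquiv.ofInjective_apply (f := E.ι.f) (h := E.ι_injective) (σ.retr x)
  rw [← this, retr, LinearMap.comp_apply, LinearEquiv.coe_coe, LinearEquiv.apply_symm_apply]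
  rfl

theorem eq_add (x : S) : x = σ.s (E.π.f x) + E.ι.f (σ.retr x) := by
  rw [ι_retr]; abel

theorem π_ι (k : K) : E.π.f (E.ι.f k) = 0 := by
  rw [← LinearMap.mem_ker, ← E.exact]; exact LinearMap.mem_range_self _ _

theorem retr_s (a : R) : σ.retr (σ.s a) = 0 := by
  apply E.ι_injective
  rw [ι_retr, σ.π_s, sub_self, map_zero]

theorem retr_ι (k : K) : σ.retr (E.ι.f k) = k := by
  apply E.ι_injective
  rw [ι_retr, π_ι, map_zero, sub_zero]

/-- The decomposition S = s(R) ⊕ K is stable under ∂, and ∂ is zero on K. -/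
theorem retr_D (x : S) : σ.retr (𝓢.D x) = 0 := by
  apply E.ι_injective
  rw [ι_retr, E.π.map_D, σ.map_D, ← map_sub, ← ι_retr, ← E.ι.map_D, E.D_zero]

theorem retr_mem {i : ZMod 2} {x : S} (h : x ∈ 𝓢.grade i) : σ.retr x ∈ 𝓚.grade i := by
  rw [← E.ι_mem_iff, ι_retr]
  exact Submodule.sub_mem _ h (σ.map_grade _ _ (E.π.map_grade _ _ h))

theorem π_bracket (l : ℂ) (x y : S) :
    E.π.f (ev l (𝓢.bracket x y)) = ev l (𝓡.bracket (E.π.f x) (E.π.f y)) := by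
  rw [E.π.map_bracket, ev_map]

/-- The value at `l` of the cocycle defined by a section. -/
def val (l : ℂ) : R →ₗ[ℂ] R →ₗ[ℂ] K := (𝓢.bracket.compl₁₂ σ.s σ.s).compr₂ (σ.retr ∘ₗ ev l)

theorem val_apply (l : ℂ) (a b : R) : σ.val l a b = σ.retr (ev l (𝓢.bracket (σ.s a) (σ.s b))) :=
  rfl

theorem bracket_s (l : ℂ) (a b : R) : ev l (𝓢.bracket (σ.s a) (σ.s b)) =
    σ.s (ev l (𝓡.bracket a b)) + E.ι.f (σ.val l a b) := by
  conv_lhs => rw [σ.eq_add (ev l (𝓢.bracket (σ.s a) (σ.s b))), π_bracket, σ.π_s, σ.π_s]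
  rfl

/-- K is central, so the bracket of S factors through R × R and any section computes it. -/
theorem bracket_eq (x y : S) :
    𝓢.bracket x y = 𝓢.bracket (σ.s (E.π.f x)) (σ.s (E.π.f y)) := by
  conv_lhs => rw [σ.eq_add x, σ.eq_add y]
  simp only [map_add, LinearMap.add_apply, E.bracket_ι, E.central, add_zero]

theorem val_mem {i j : ZMod 2} {a b : R} (ha : a ∈ 𝓡.grade i) (hb : b ∈ 𝓡.grade j) (l : ℂ) :
    σ.val l a b ∈ 𝓚.grade (i + j) :=
  σ.retr_mem (ev_mem (𝓢.bracket_mem i j _ _ (σ.map_grade _ _ ha) (σ.map_grade _ _ hb)) l)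

theorem val_D_left (l : ℂ) (a b : R) : σ.val l (𝓡.D a) b = -l • σ.val l a b := by
  rw [val_apply, val_apply, σ.map_D, 𝓢.sesq_left, map_neg, map_smul, neg_smul]

theorem val_D_right (l : ℂ) (a b : R) : σ.val l a (𝓡.D b) = l • σ.val l a b := by
  rw [val_apply, val_apply, σ.map_D, 𝓢.sesq_right, map_add, map_smul, retr_D, zero_add]

/-- The retraction kills ∂S, so the substitution λ ↦ -λ-∂ in S becomes λ ↦ -λ in K. -/
theorem val_skew {i j : ZMod 2} {a b : R} (ha : a ∈ 𝓡.grade i) (hb : b ∈ 𝓡.grade j) (l : ℂ) :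
    σ.val l b a = -(sgn i j • σ.val (-l) a b) := by
  rw [val_apply, val_apply, 𝓢.skew i j _ _ (σ.map_grade _ _ ha) (σ.map_grade _ _ hb), map_neg,
    map_smul, ← subst_map σ.retr (-(l • (1 : Module.End ℂ S)) - 𝓢.D)
      ((-l) • (1 : Module.End ℂ K)), subst_smul_one, ev_map]
  intro x
  simp [retr_D]

/-- The K-component of the Jacobi identity of S; the K-parts of the inner brackets are central and
drop out. -/
theorem val_jacobi {i j : ZMod 2} {a b : R} (ha : a ∈ 𝓡.grade i) (hb : b ∈ 𝓡.grade j)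
    (c : R) (l m : ℂ) : σ.val l a (ev m (𝓡.bracket b c)) =
      σ.val (l + m) (ev l (𝓡.bracket a b)) c + sgn i j • σ.val m b (ev l (𝓡.bracket a c)) := by
  have := congrArg σ.retr
    (𝓢.jacobi i j _ _ (σ.s c) (σ.map_grade _ _ ha) (σ.map_grade _ _ hb) l m)
  simpa only [bracket_s, map_add, LinearMap.add_apply, E.bracket_ι, E.central,
    add_zero, map_smul, retr_s, retr_ι, zero_add] using this

theorem isTrivial (h : ∀ l a b, σ.val l a b = 0) : E.IsTrivial := by
  refine ⟨⟨σ.s, σ.map_grade, σ.map_D, fun a b => ?_⟩, σ.π_s⟩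
  apply poly_ext
  intro l
  rw [ev_map, bracket_s, h, map_zero, add_zero]

/-- The change of a section by an even map `R → K` which vanishes on `∂R`. -/
def modify (φ : R →ₗ[ℂ] K) (hφ : ∀ i a, a ∈ 𝓡.grade i → φ a ∈ 𝓚.grade i)
    (hD : ∀ a, φ (𝓡.D a) = 0) : E.Section where
  s := σ.s + E.ι.f ∘ₗ φ
  map_grade i a h := Submodule.add_mem _ (σ.map_grade i a h) (E.ι.map_grade _ _ (hφ i a h))
  map_D a := by
    simp only [LinearMap.add_apply, LinearMap.comp_apply, map_add, hD, map_zero, ← E.ι.map_D,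
      E.D_zero, σ.map_D]
  π_s a := by simp [π_ι, σ.π_s]

theorem modify_val (φ : R →ₗ[ℂ] K) (hφ) (hD) (l : ℂ) (a b : R) :
    (σ.modify φ hφ hD).val l a b = σ.val l a b - φ (ev l (𝓡.bracket a b)) := by
  apply E.ι_injective
  have h := (σ.modify φ hφ hD).bracket_s l a b
  -- Both sections compute the same bracket of S, so the two expansions may be compared.
  rw [σ.bracket_eq, (σ.modify φ hφ hD).π_s, (σ.modify φ hφ hD).π_s, σ.bracket_s] at h
  change _ = σ.s _ + E.ι.f (φ _) + _ at h
  rw [add_assoc, add_right_inj] at h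
  rw [map_sub, h]; abel

/-- A central extension with one-dimensional kernel is isomorphic to the one defined by a cocycle
`c` if the cocycle of some section is `c ⊗ k` for some even `k ≠ 0`. -/
theorem isIso (c : TwoCocycle 𝓡) {k : K} (hk : k ∈ 𝓚.grade 0) (hk0 : k ≠ 0)
    (hK : Module.finrank ℂ K = 1) (h : ∀ l a b, σ.val l a b = ev l (c.α a b) • k) :
    E.IsIso c.centralExtension := by
  have hspan : ∀ x : K, ∃ r : ℂ, r • k = x := fun x =>
    (finrank_eq_one_iff_of_nonzero' k hk0).1 hK x
  let e : ℂ ≃ₗ[ℂ] K := LinearEquiv.ofBijective (LinearMap.toSpanSingleton ℂ K k)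
    ⟨fun x y hxy => smul_left_injective ℂ hk0 hxy, hspan⟩
  have he : ∀ r, e r = r • k := fun r => rfl
  have hes : ∀ r : ℂ, e.symm (r • k) = r := fun r => by rw [← he, e.symm_apply_apply]
  have hgr : ∀ i, ∀ x ∈ 𝓚.grade i, e.symm x ∈ lineGrade i := by
    intro i x hx
    rcases zmod_two_cases i with rfl | rfl
    · simp [lineGrade]
    · obtain ⟨r, rfl⟩ := hspan x
      have := Submodule.disjoint_def.1 𝓚.isCompl.disjoint _ (Submodule.smul_mem _ r hk) hx
      rw [this, map_zero]; exact Submodule.zero_mem _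
  have hbr : ∀ x y, 𝓚.bracket x y = 0 := by
    intro x y
    apply poly_ext
    intro l
    apply E.ι_injective
    rw [← ev_map, ← E.ι.map_bracket, E.central]
    simp
  -- The isomorphism is S = s(R) ⊕ K → R ⊕ ℂ, with K identified with ℂ by k ↦ 1.
  refine ⟨⟨E.π.f.prod (e.symm.toLinearMap ∘ₗ σ.retr), ?_, ?_, ?_⟩,
    ⟨e.symm.toLinearMap, hgr, ?_, ?_⟩, ?_, e.symm.bijective, ?_, ?_⟩
  · exact fun i x hx => ⟨E.π.map_grade i x hx, hgr i _ (σ.retr_mem hx)⟩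
  · intro x
    refine Prod.ext (E.π.map_D x) ?_
    change e.symm (σ.retr (𝓢.D x)) = 0
    rw [retr_D, map_zero]
  · intro x y
    apply poly_ext
    intro l
    rw [ev_map]
    change ev l (c.extBracket _ _) = _
    rw [c.ev_extBracket]
    refine Prod.ext (π_bracket l x y).symm ?_
    change ev l (c.α (E.π.f x) (E.π.f y)) = e.symm (σ.retr _)
    rw [σ.bracket_eq, ← val_apply, h, hes]
  · intro x
    rw [E.D_zero, map_zero]; rfl
  · intro x y
    rw [hbr, map_zero]; rfl
  · constructor
    · intro x y hxy
      have h1 : E.π.f x = E.π.f y := congrArg Prod.fst hxy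
      have h2 : e.symm (σ.retr x) = e.symm (σ.retr y) := congrArg Prod.snd hxy
      rw [σ.eq_add x, σ.eq_add y, h1, e.symm.injective h2]
    · rintro ⟨a, r⟩
      refine ⟨σ.s a + E.ι.f (e r), Prod.ext ?_ ?_⟩
      · change E.π.f _ = a
        rw [map_add, σ.π_s, π_ι, add_zero]
      · change e.symm (σ.retr _) = r
        rw [map_add, retr_s, retr_ι, zero_add, e.symm_apply_apply]
  · intro x
    refine Prod.ext (π_ι x) ?_
    change e.symm (σ.retr _) = e.symm x
    rw [retr_ι]
  · intro x; rfl

end CentralExtension.Section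

theorem CentralExtension.nonempty_section (E : CentralExtension 𝓚 𝓢 𝓡) : Nonempty E.Section := by
  obtain ⟨s, h1, h2, h3⟩ := E.split
  exact ⟨⟨s, h1, h2, h3⟩⟩

/-- The form ψ is the ℂ-component of a splitting homomorphism R → R ⊕ ℂ: it kills ∂R because ∂ is
zero on ℂ, and compatibility with the brackets makes the cocycle its coboundary. -/
theorem TwoCocycle.exists_of_isTrivial (c : TwoCocycle 𝓡) (h : c.centralExtension.IsTrivial) :
    ∃ ψ : R →ₗ[ℂ] ℂ, (∀ a, ψ (𝓡.D a) = 0) ∧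
      ∀ l a b, ev l (c.α a b) = ψ (ev l (𝓡.bracket a b)) := by
  obtain ⟨s, hs⟩ := h
  have hs' : ∀ a, (s.f a).1 = a := hs
  refine ⟨LinearMap.snd ℂ R ℂ ∘ₗ s.f, fun a => ?_, fun l a b => ?_⟩
  · change (s.f (𝓡.D a)).2 = 0
    rw [s.map_D]; rfl
  · have h1 := congrArg (ev l) (s.map_bracket a b)
    rw [ev_map] at h1
    change ev l (c.extBracket _ _) = _ at h1
    rw [c.ev_extBracket, hs', hs'] at h1
    exact congrArg Prod.snd h1

end Extension

/-! ### Cocycles on the generators of `W_N` -/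

section GenCocycle

variable {N : ℕ}

/-- The bracket `[u_λ v]` for `λ = l` and `∂ = -(l + m)`. -/
def exBracket (l m : ℂ) : Gen N →ₗ[ℂ] Gen N →ₗ[ℂ] Gen N := brA + l • brB - (l + m) • brC

theorem exBracket_apply (l m : ℂ) (u v : Gen N) :
    exBracket l m u v = brA u v + l • brB u v - (l + m) • brC u v := rfl

/-- The element `1 ⊗ u` of `W_N`. -/
abbrev gen₀ (u : Gen N) : WSpace N := PolynomialModule.single ℂ 0 u

theorem poly_induction {M : Type*} [AddCommGroup M] [Module ℂ M] {p : Poly M → Prop}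
    (hadd : ∀ x y, p x → p y → p (x + y))
    (h0 : ∀ u, p (PolynomialModule.single ℂ 0 u)) (hs : ∀ x, p x → p (shift x)) (x : Poly M) :
    p x := by
  induction x using PolynomialModule.induction_linear with
  | zero => simpa using h0 0
  | add x y hx hy => exact hadd x y hx hy
  | single n u =>
    induction n with
    | zero => exact h0 u
    | succ n ih => rw [← shift_single]; exact hs _ ih

theorem ev_single_zero {M : Type*} [AddCommGroup M] [Module ℂ M] (l : ℂ) (u : M) :
    ev l (PolynomialModule.single ℂ 0 u) = u := by
  simp

/-- At λ = l and ∂ = -(l + m), sesquilinearity turns ∂ in the first argument into -l and ∂ in the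
second into ∂ + λ = -m. -/
theorem ev_ev_wBracket (l m : ℂ) (p q : WSpace N) :
    ev (-(l + m)) (ev l (wBracket p q)) = exBracket l m (ev (-l) p) (ev (-m) q) := by
  induction p using poly_induction with
  | hadd x y hx hy => simp only [map_add, LinearMap.add_apply, hx, hy]
  | hs x hx =>
    rw [wBracket, sesqExtend_left, ← wBracket, map_neg, map_neg, ev_shift, map_smul, hx, ev_shift,
      map_smul, LinearMap.smul_apply, neg_smul]
  | h0 u =>
  induction q using poly_induction with
  | hadd x y hx hy => simp only [map_add, hx, hy]
  | hs x hx =>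
    rw [wBracket, sesqExtend_right, ← wBracket, map_add, map_add, ev_shift, map_smul,
      ev_innerShift, ev_shift, hx, ev_shift, map_smul]
    module
  | h0 v =>
    rw [wBracket, sesqExtend_single, pow_zero, pow_zero, one_mul, Module.End.one_apply,
      wGenBracket, genBracket_apply, exBracket_apply, mono_apply, mono_apply, mono_apply]
    simp only [map_add, map_smul, PolynomialModule.eval_single, pow_zero, one_smul, pow_one]
    module

/-- The restriction to `W(N) ⊕ ∧(N)` of a `2`-cocycle on `W_N`, as a family of bilinear maps
parametrized by the values of `λ`. -/
structure GenCocycle (N : ℕ) (V : Type*) [AddCommGroup V] [Module ℂ V] where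
  val : ℂ → Gen N →ₗ[ℂ] Gen N →ₗ[ℂ] V
  skew : ∀ i j u v, u ∈ genGrade N i → v ∈ genGrade N j → ∀ l,
    val l v u = -(sgn i j • val (-l) u v)
  jacobi : ∀ i j u v w, u ∈ genGrade N i → v ∈ genGrade N j → ∀ l m,
    val l u (exBracket m (-(l + m)) v w) =
      val (l + m) (exBracket l m u v) w + sgn i j • val m v (exBracket l (-(l + m)) u w)

theorem gen₀_smul (c : ℂ) (u : Gen N) : gen₀ (c • u) = c • gen₀ u :=
  PolynomialModule.single_smul _ _ _

theorem gen₀_mem {i : ZMod 2} {u : Gen N} (h : u ∈ genGrade N i) : gen₀ u ∈ (W N).grade i :=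
  single_mem 0 h

/-! ### From an extension to a cocycle on the generators -/

section FromExtension

variable {S K : Type*} [AddCommGroup S] [Module ℂ S] [AddCommGroup K] [Module ℂ K]
  {𝓚 : LieConformalSuperalgebra K} {𝓢 : LieConformalSuperalgebra S}
  {E : CentralExtension 𝓚 𝓢 (W N)} (σ : E.Section)

/-- Since ∂ is zero on K, the factor ∂ + λ from the second argument is just λ; the first argument
gives -λ. -/
theorem CentralExtension.Section.val_eq (l : ℂ) (p q : WSpace N) :
    σ.val l p q = σ.val l (gen₀ (ev (-l) p)) (gen₀ (ev l q)) := by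
  induction p using poly_induction with
  | hadd x y hx hy =>
    simp only [gen₀, map_add, PolynomialModule.single_add, LinearMap.add_apply, hx, hy]
  | hs x hx =>
    change σ.val l ((W N).D x) q = _
    rw [σ.val_D_left, hx, ev_shift, gen₀_smul, map_smul,
      LinearMap.smul_apply]
  | h0 u =>
  induction q using poly_induction with
  | hadd x y hx hy =>
    simp only [gen₀, map_add, PolynomialModule.single_add, hx, hy]
  | hs x hx =>
    change σ.val l _ ((W N).D x) = _
    rw [σ.val_D_right, hx, ev_shift, gen₀_smul, map_smul]
  | h0 v => rw [ev_single_zero, ev_single_zero]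

/-- The cocycle on the generators defined by a section of a central extension of `W_N`. -/
def CentralExtension.Section.genCocycle : GenCocycle N K where
  val l := (σ.val l).compl₁₂ (PolynomialModule.lsingle ℂ 0) (PolynomialModule.lsingle ℂ 0)
  skew i j u v hu hv l := σ.val_skew (gen₀_mem hu) (gen₀_mem hv) l
  jacobi i j u v w hu hv l m := by
    have key : ∀ (l m : ℂ) (u v : Gen N), exBracket l m u v =
        ev (-(l + m)) (ev l ((W N).bracket (gen₀ u) (gen₀ v))) := by
      intro l m u v
      have := ev_ev_wBracket l m (gen₀ u) (gen₀ v)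
      rw [ev_single_zero, ev_single_zero] at this
      exact this.symm
    have h := σ.val_jacobi (gen₀_mem hu) (gen₀_mem hv) (gen₀ w) l m
    rw [σ.val_eq l, σ.val_eq (l + m), σ.val_eq m, ev_single_zero, ev_single_zero, ev_single_zero]
      at h
    change σ.val l (gen₀ u) (gen₀ _) = σ.val (l + m) (gen₀ _) (gen₀ w)
      + sgn i j • σ.val m (gen₀ v) (gen₀ _)
    -- Inside α_l(u, ·) and α_m(v, ·) the operator ∂ acts as l and as m; this is why the second
    -- parameter of `exBracket` is -(l + m) there.
    rw [key, key, key, show -(m + -(l + m)) = l by ring, show -(l + -(l + m)) = m by ring, h]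

theorem CentralExtension.Section.val_eq_genCocycle (l : ℂ) (p q : WSpace N) :
    σ.val l p q = σ.genCocycle.val l (ev (-l) p) (ev l q) := σ.val_eq l p q

end FromExtension

/-- The extension to `ℂ[∂] ⊗ M` of a bilinear map `M × M → ℂ[λ]` by
`(∂ᵐu, ∂ⁿv) ↦ (-λ)ᵐ λⁿ g(u, v)`. -/
def formExtend {M : Type*} [AddCommGroup M] [Module ℂ M] (g : M →ₗ[ℂ] M →ₗ[ℂ] Poly ℂ) :
    Poly M →ₗ[ℂ] Poly M →ₗ[ℂ] Poly ℂ :=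
  lift fun m =>
    { toFun := fun u => lift fun n =>
        ((-shift) ^ m * shift ^ n : Module.End ℂ (Poly ℂ)) ∘ₗ g u
      map_add' := by
        intro u v
        apply PolynomialModule.hom_ext
        intro n
        refine LinearMap.ext fun x => ?_
        simp [PolynomialModule.lsingle, LinearMap.add_apply]
      map_smul' := by
        intro c u
        apply PolynomialModule.hom_ext
        intro n
        refine LinearMap.ext fun x => ?_
        simp [PolynomialModule.lsingle] }

theorem formExtend_single {M : Type*} [AddCommGroup M] [Module ℂ M]
    (g : M →ₗ[ℂ] M →ₗ[ℂ] Poly ℂ) (m n : ℕ) (u v : M) :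
    formExtend g (PolynomialModule.single ℂ m u) (PolynomialModule.single ℂ n v) =
      ((-shift) ^ m * shift ^ n : Module.End ℂ (Poly ℂ)) (g u v) := by
  simp [formExtend]

theorem ev_formExtend {M : Type*} [AddCommGroup M] [Module ℂ M]
    (g : M →ₗ[ℂ] M →ₗ[ℂ] Poly ℂ) (l : ℂ) (p q : Poly M) :
    ev l (formExtend g p q) = ev l (g (ev (-l) p) (ev l q)) := by
  have h1 : ∀ (n : ℕ) (z : Poly ℂ), ev l ((shift ^ n : Module.End ℂ (Poly ℂ)) z) =
      l ^ n • ev l z := by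
    intro n
    induction n with
    | zero => simp
    | succ n ih =>
      intro z
      rw [pow_succ, Module.End.mul_apply, ih, ev_shift, smul_smul, pow_succ]
  have h2 : ∀ (n : ℕ) (z : Poly ℂ), ev l (((-shift) ^ n : Module.End ℂ (Poly ℂ)) z) =
      (-l) ^ n • ev l z := by
    intro n
    induction n with
    | zero => simp
    | succ n ih =>
      intro z
      rw [pow_succ, Module.End.mul_apply, ih, LinearMap.neg_apply, map_neg, ev_shift, pow_succ,
        ← neg_smul, smul_smul]
  induction p using PolynomialModule.induction_linear with
  | zero => simp
  | add x y hx hy => simp only [map_add, LinearMap.add_apply, hx, hy]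
  | single m u =>
  induction q using PolynomialModule.induction_linear with
  | zero => simp
  | add x y hx hy => simp only [map_add, hx, hy]
  | single n v =>
    rw [formExtend_single, Module.End.mul_apply, h2, h1, PolynomialModule.eval_single,
      PolynomialModule.eval_single]
    simp only [map_smul, LinearMap.smul_apply]
    rw [smul_comm]

/-- The `2`-cocycle on `W_N` with a given restriction to the generators. -/
def GenCocycle.toTwoCocycle (C : GenCocycle N ℂ) (g : Gen N →ₗ[ℂ] Gen N →ₗ[ℂ] Poly ℂ)
    (hg : ∀ l u v, ev l (g u v) = C.val l u v)
    (heven : ∀ l, ∀ u ∈ genGrade N 0, ∀ v ∈ genGrade N 1, C.val l u v = 0) :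
    TwoCocycle (W N) where
  α := formExtend g
  even a b ha hb := by
    apply poly_ext
    intro l
    rw [ev_formExtend, hg, heven l _ (ev_mem ha _) _ (ev_mem hb _), map_zero]
  sesq_left l a b := by
    change ev l (formExtend g (shift a) b) = _
    rw [ev_formExtend, ev_formExtend, ev_shift]
    simp
  sesq_right l a b := by
    change ev l (formExtend g a (shift b)) = _
    rw [ev_formExtend, ev_formExtend, ev_shift]
    simp
  skew i j a b ha hb l := by
    rw [ev_formExtend, ev_formExtend, hg, hg, neg_neg,
      C.skew i j _ _ (ev_mem ha l) (ev_mem hb (-l))]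
    rfl
  cocycle i j a b c ha hb l m := by
    rw [ev_formExtend, ev_formExtend, ev_formExtend, hg, hg, hg]
    -- The three arguments enter through their values at ∂ = -l, -m and l + m, as sesquilinearity
    -- prescribes in all three terms.
    have h := C.jacobi i j _ _ (ev (l + m) c) (ev_mem ha (-l)) (ev_mem hb (-m)) l m
    have h1 := ev_ev_wBracket m (-(l + m)) b c
    have h2 := ev_ev_wBracket l (-(l + m)) a c
    have h3 := ev_ev_wBracket l m a b
    rw [neg_neg] at h1 h2
    rw [← h1, ← h2, ← h3] at h
    rw [show -(m + -(l + m)) = l by ring, show -(l + -(l + m)) = m by ring] at h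
    exact h

theorem GenCocycle.toTwoCocycle_gen₀ (C : GenCocycle N ℂ) (g hg heven) (u v : Gen N) :
    (C.toTwoCocycle g hg heven).α (gen₀ u) (gen₀ v) = g u v := by
  change formExtend g _ _ = _
  rw [formExtend_single]; rfl

theorem GenCocycle.ev_toTwoCocycle (C : GenCocycle N ℂ) (g hg heven) (l : ℂ) (p q : WSpace N) :
    ev l ((C.toTwoCocycle g hg heven).α p q) = C.val l (ev (-l) p) (ev l q) := by
  change ev l (formExtend g _ _) = _
  rw [ev_formExtend, hg]

end GenCocycle

/-! ### Brackets of generators at numerical values of λ and ∂ -/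

section GenCocycle

variable {N : ℕ}

/-- The inclusion of `W(N)` in `W(N) ⊕ ∧(N)`. -/
def ofDer : Der N →ₗ[ℂ] Gen N := LinearMap.inl ℂ (Der N) (Lam N)

/-- The inclusion of `∧(N)` in `W(N) ⊕ ∧(N)`. -/
def ofLam : Lam N →ₗ[ℂ] Gen N := LinearMap.inr ℂ (Der N) (Lam N)

@[simp] theorem ofDer_op (a : Der N) : (ofDer a).op = a := rfl
@[simp] theorem ofDer_fn (a : Der N) : (ofDer a).fn = 0 := rfl
@[simp] theorem ofLam_op (f : Lam N) : (ofLam f).op = 0 := rfl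
@[simp] theorem ofLam_fn (f : Lam N) : (ofLam f).fn = f := rfl

theorem ofDer_mem {i : ZMod 2} {a : Der N} (h : a.1 ∈ der N i) : ofDer a ∈ genGrade N i :=
  ⟨h, Submodule.zero_mem _⟩

theorem ofLam_mem {i : ZMod 2} {f : Lam N} (h : f ∈ par N i) : ofLam f ∈ genGrade N i :=
  ⟨Submodule.zero_mem _, h⟩

theorem gen_eq_add (u : Gen N) : u = ofDer u.1 + ofLam u.2 :=
  (Prod.fst_add_snd u).symm

/-- The product `f a` of `f ∈ ∧(N)` and `a ∈ W(N)`. -/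
def smulDer : Lam N →ₗ[ℂ] Der N →ₗ[ℂ] Der N :=
  LinearMap.mk₂ ℂ (fun f a => ⟨lmul f * a, lmul_mem a.2 f⟩)
    (fun f g a => Subtype.ext (by simp [lmul_add, add_mul]))
    (fun c f a => Subtype.ext (by simp [lmul_smul]))
    (fun f a b => Subtype.ext (by simp [mul_add]))
    (fun c f a => Subtype.ext (by simp))

@[simp] theorem coe_smulDer (f : Lam N) (a : Der N) : (smulDer f a : Module.End ℂ (Lam N)) =
    lmul f * a := rfl

/-- The bracket of `W(N)`. -/
def commDer (a b : Der N) : Der N := ⟨comm a b, comm_mem a.2 b.2⟩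

@[simp] theorem coe_commDer (a b : Der N) : (commDer a b : Module.End ℂ (Lam N)) = comm a b := rfl

theorem comm_eq {i j : ZMod 2} {a b : Module.End ℂ (Lam N)} (ha : a ∈ der N i)
    (hb : b ∈ der N j) : comm a b = a * b - sgn i j • (b * a) := by
  rw [comm, (isPar_der ha).swapMul (isPar_der hb)]

theorem swapApply_zero_left (f : Lam N) : swapApply 0 f = 0 := by
  simp [swapApply]

theorem swapApply_zero_right (a : Module.End ℂ (Lam N)) : swapApply a 0 = 0 := by
  simp [swapApply]

theorem op_exBracket (l m : ℂ) (u v : Gen N) : (exBracket l m u v).op =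
    comm u.op v.op - l • swapLmul u.op v.fn + m • (lmul u.fn * v.op) := by
  rw [exBracket_apply]
  change comm u.op v.op + l • (-swapLmul u.op v.fn - lmul u.fn * v.op)
    - (l + m) • -(lmul u.fn * v.op) = _
  module

theorem fn_exBracket (l m : ℂ) (u v : Gen N) : (exBracket l m u v).fn =
    u.op v.fn - swapApply v.op u.fn + (m - l) • (u.fn * v.fn) := by
  rw [exBracket_apply]
  change u.op v.fn - swapApply v.op u.fn + l • -((2 : ℂ) • (u.fn * v.fn))
    - (l + m) • -(u.fn * v.fn) = _
  module

theorem exBracket_der_der (l m : ℂ) (a b : Der N) :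
    exBracket l m (ofDer a) (ofDer b) = ofDer (commDer a b) := by
  refine Gen.ext ?_ ?_
  · simp [op_exBracket, swapLmul]
  · simp [fn_exBracket, swapApply_zero_right]

theorem exBracket_der_lam (l m : ℂ) {i j : ZMod 2} {a : Der N} (ha : a.1 ∈ der N i) {f : Lam N}
    (hf : f ∈ par N j) : exBracket l m (ofDer a) (ofLam f) =
      ofLam (a.1 f) - (l * sgn i j) • ofDer (smulDer f a) := by
  refine Gen.ext ?_ ?_
  · simp [op_exBracket, swapLmul, (isPar_der ha).swapMul (isPar_lmul hf), comm, mul_smul]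
  · simp [fn_exBracket, swapApply_zero_right]

theorem exBracket_lam_lam (l m : ℂ) (f g : Lam N) :
    exBracket l m (ofLam f) (ofLam g) = (m - l) • ofLam (f * g) := by
  refine Gen.ext ?_ ?_
  · simp [op_exBracket, swapLmul, comm]
  · simp [fn_exBracket, swapApply_zero_left]

/-- The element `1 ∈ ∧(N)`; its opposite is a Virasoro element of `W_N`. -/
def unit : Gen N := ofLam 1

theorem one_par : (1 : Lam N) ∈ par N 0 := by
  simpa using algebraMap_par (N := N) 1

theorem unit_mem : (unit : Gen N) ∈ genGrade N 0 := ofLam_mem one_par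

theorem der_one {i : ZMod 2} {a : Module.End ℂ (Lam N)} (ha : a ∈ der N i) : a 1 = 0 := by
  have h := (ha 0 1 one_par).2 1
  rw [sgn_zero_right] at h
  simpa using h

/-- With L = -1 this is [L_λ a] = (∂ + λ)a at ∂ = -(l + m): W(N) has conformal weight 1. In the same
way `exBracket_unit_lam` says that ∧(N) has weight 2. -/
theorem exBracket_unit_der (l m : ℂ) (a : Der N) :
    exBracket l m unit (ofDer a) = m • ofDer a := by
  have h1 : lmul (1 : Lam N) = 1 := LinearMap.ext fun h => by simp
  refine Gen.ext ?_ ?_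
  · simp [op_exBracket, unit, comm, swapLmul, h1]
  · obtain ⟨a0, h0, a1, h1, h⟩ := Submodule.mem_sup.1 a.2
    have hz : ∀ i, ∀ b ∈ der N i, swapApply b 1 = 0 := fun i b hb => by
      rw [swapApply_par (isPar_der hb) one_par, der_one hb, smul_zero]
    have : swapApply a.1 (1 : Lam N) = 0 := by
      rw [← h]
      have e : swapApply (a0 + a1) (1 : Lam N) = swapApply a0 1 + swapApply a1 1 := by
        simp only [swapApply, map_add, LinearMap.add_apply]; abel
      rw [e, hz 0 _ h0, hz 1 _ h1, add_zero]
    simp [fn_exBracket, unit, this]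

theorem exBracket_unit_lam (l m : ℂ) (f : Lam N) :
    exBracket l m unit (ofLam f) = (m - l) • ofLam f := by
  rw [unit, exBracket_lam_lam, one_mul]

/-! ### Normalization -/

section Weights

variable {V : Type*} [AddCommGroup V] [Module ℂ V]

/-- The solutions are spanned by λ and λ², for an arbitrary function p. The relations at (l, 1) and
(l + 1, -1) both contain p(l + 1); the multipliers eliminate it and leave p(l) with coefficient 1,
so no division by a function of l is needed. -/
theorem eq_of_weight_one {p : ℂ → V}
    (h : ∀ l m, (l - m) • p (l + m) = (l + m) • (p l - p m)) (l : ℂ) :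
    p l = (l * (l + 1) / 2) • p 1 + (l * (l - 1) / 2) • p (-1) := by
  have h1 := h l 1
  have h2 := h (l + 1) (-1)
  rw [show l + 1 + -1 = l by ring] at h2
  linear_combination (norm := module) (-l / 2) • h1 - ((l - 1) / 2) • h2

/-- The solutions are spanned by λ and λ³. The relations at (l, 1), (l + 1, 1) and (l, 2) are
combined so that p(l + 1) and p(l + 2) cancel and p(l) keeps coefficient 1. -/
theorem eq_of_weight_two {p : ℂ → V}
    (h : ∀ l m, (l - m) • p (l + m) = (l + 2 * m) • p l - (m + 2 * l) • p m) (l : ℂ) :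
    p l = (l * (l ^ 2 - 1) / 6) • p 2 - (l * (l ^ 2 - 4) / 3) • p 1 := by
  have h1 := h l 1
  have h2 := h (l + 1) 1
  have h3 := h l 2
  rw [show l + 1 + 1 = l + 2 by ring] at h2
  linear_combination (norm := module) ((l - 2) * (l + 3) / 12) • h1 + ((l - 2) * (l - 1) / 12) • h2
    - (l * (l - 1) / 12) • h3

variable (C : GenCocycle N V)

theorem GenCocycle.unit_der (l : ℂ) (a : Der N) : C.val l unit (ofDer a) =
    (l * (l + 1) / 2) • C.val 1 unit (ofDer a)
      + (l * (l - 1) / 2) • C.val (-1) unit (ofDer a) := by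
  refine eq_of_weight_one (p := fun l => C.val l unit (ofDer a)) (fun l m => ?_) l
  have h := C.jacobi 0 0 unit unit (ofDer a) unit_mem unit_mem l m
  have h2 : exBracket l m (unit : Gen N) unit = (m - l) • unit := exBracket_unit_lam _ _ _
  rw [h2, exBracket_unit_der, exBracket_unit_der, sgn_zero_left] at h
  simp only [map_smul, LinearMap.smul_apply] at h
  linear_combination (norm := module) h

theorem GenCocycle.unit_lam (l : ℂ) (f : Lam N) : C.val l unit (ofLam f) =
    (l * (l ^ 2 - 1) / 6) • C.val 2 unit (ofLam f)
      - (l * (l ^ 2 - 4) / 3) • C.val 1 unit (ofLam f) := by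
  refine eq_of_weight_two (p := fun l => C.val l unit (ofLam f)) (fun l m => ?_) l
  have h := C.jacobi 0 0 unit unit (ofLam f) unit_mem unit_mem l m
  have h2 : exBracket l m (unit : Gen N) unit = (m - l) • unit := exBracket_unit_lam _ _ _
  rw [h2, exBracket_unit_lam, exBracket_unit_lam, sgn_zero_left] at h
  simp only [map_smul, LinearMap.smul_apply] at h
  linear_combination (norm := module) h

/-- A cocycle is normalized if `α_λ(1, a)` and `α_λ(1, f)` have no linear terms. -/
structure GenCocycle.IsNormalized : Prop where
  quadratic : ∀ l a, C.val l unit (ofDer a) = l ^ 2 • C.val 1 unit (ofDer a)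
  cubic : ∀ l f, C.val l unit (ofLam f) = l ^ 3 • C.val 1 unit (ofLam f)

/-- The linear form whose coboundary removes the linear terms of `α_λ(1, a)` and `α_λ(1, f)`. -/
def GenCocycle.correction : Gen N →ₗ[ℂ] V :=
  LinearMap.coprod
    ((2⁻¹ : ℂ) • ((C.val (-1) unit - C.val 1 unit) ∘ₗ ofDer))
    ((12⁻¹ : ℂ) • ((C.val 2 unit - (8 : ℂ) • C.val 1 unit) ∘ₗ ofLam))

theorem GenCocycle.correction_der (a : Der N) : C.correction (ofDer a) =
    (2⁻¹ : ℂ) • (C.val (-1) unit (ofDer a) - C.val 1 unit (ofDer a)) := by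
  simp only [correction, ofDer]
  exact LinearMap.coprod_inl .. |> fun h => LinearMap.congr_fun h a

theorem GenCocycle.correction_lam (f : Lam N) : C.correction (ofLam f) =
    (12⁻¹ : ℂ) • (C.val 2 unit (ofLam f) - (8 : ℂ) • C.val 1 unit (ofLam f)) := by
  simp only [correction, ofLam]
  exact LinearMap.coprod_inr .. |> fun h => LinearMap.congr_fun h f

end Weights

/-! ### Existence of a normalized splitting -/

section FromExtension

variable {S K : Type*} [AddCommGroup S] [Module ℂ S] [AddCommGroup K] [Module ℂ K]
  {𝓚 : LieConformalSuperalgebra K} {𝓢 : LieConformalSuperalgebra S}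
  {E : CentralExtension 𝓚 𝓢 (W N)}

theorem CentralExtension.Section.genCocycle_mem (σ : E.Section) {i j : ZMod 2} {u v : Gen N}
    (hu : u ∈ genGrade N i) (hv : v ∈ genGrade N j) (l : ℂ) :
    σ.genCocycle.val l u v ∈ 𝓚.grade (i + j) :=
  σ.val_mem (gen₀_mem hu) (gen₀_mem hv) l

/-- Changing the splitting by φ adds λφ(a) to α_λ(1, a) and 2λφ(f) to α_λ(1, f). As φ is any even
map on the generators, the linear terms can be cancelled. -/
theorem CentralExtension.exists_isNormalized (E : CentralExtension 𝓚 𝓢 (W N)) :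
    ∃ σ : E.Section, σ.genCocycle.IsNormalized := by
  obtain ⟨σ⟩ := E.nonempty_section
  set C := σ.genCocycle with hC
  have hmem : ∀ i, ∀ u ∈ genGrade N i, ∀ l, C.val l unit u ∈ 𝓚.grade i := by
    intro i u hu l
    have := σ.genCocycle_mem unit_mem hu l
    rwa [zero_add] at this
  have hφ : ∀ i u, u ∈ genGrade N i → C.correction u ∈ 𝓚.grade i := by
    intro i u hu
    rw [gen_eq_add u, map_add, C.correction_der, C.correction_lam]
    have h1 := hmem i _ (ofDer_mem (a := u.1) hu.1)
    have h2 := hmem i _ (ofLam_mem (f := u.2) hu.2)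
    exact Submodule.add_mem _
      (Submodule.smul_mem _ _ (Submodule.sub_mem _ (h1 _) (h1 _)))
      (Submodule.smul_mem _ _ (Submodule.sub_mem _ (h2 _) (Submodule.smul_mem _ _ (h2 _))))
  -- `ev 0` takes the coefficient of ∂⁰, so the form vanishes on ∂W_N; accordingly the coboundary
  -- below uses `exBracket l (-l)`, the bracket at ∂ = 0.
  let τ : E.Section := σ.modify (C.correction ∘ₗ ev 0) (fun i a h => hφ i _ (ev_mem h 0))
    (fun a => by
      change C.correction (ev 0 (shift a)) = 0
      rw [ev_shift, zero_smul, map_zero])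
  have hτ : ∀ l u v, τ.genCocycle.val l u v = C.val l u v - C.correction (exBracket l (-l) u v) := by
    intro l u v
    have h := ev_ev_wBracket l (-l) (gen₀ u) (gen₀ v)
    rw [ev_single_zero, ev_single_zero, add_neg_cancel, neg_zero] at h
    rw [← h]
    exact σ.modify_val _ _ _ l _ _
  refine ⟨τ, ⟨fun l a => ?_, fun l f => ?_⟩⟩
  · rw [hτ, hτ, exBracket_unit_der, exBracket_unit_der, map_smul, map_smul, C.correction_der,
      C.unit_der l]
    module
  · rw [hτ, hτ, exBracket_unit_lam, exBracket_unit_lam, map_smul, map_smul, C.correction_lam,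
      C.unit_lam l]
    module

end FromExtension

end GenCocycle

section GenCocycle

variable {N : ℕ}

/-! ### Derivations of the Grassmann algebra -/

/-- The variable `ξᵢ`. -/
abbrev xi (i : Fin N) : Lam N := ExteriorAlgebra.ι ℂ (Pi.single i (1 : ℂ) : Fin N → ℂ)

/-- The derivation `∂ᵢ` as an element of `W(N)`. -/
def pd (i : Fin N) : Der N := ⟨dξ i, der_le 1 (dξ_mem_der i)⟩

@[simp] theorem coe_pd (i : Fin N) : (pd i : Module.End ℂ (Lam N)) = dξ i := rfl

theorem xi_par (i : Fin N) : xi i ∈ par N 1 := ι_par _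

theorem pd_mem (i : Fin N) : (pd i).1 ∈ der N 1 := dξ_mem_der i

theorem smulDer_mem {i j : ZMod 2} {f : Lam N} {a : Der N} (hf : f ∈ par N j)
    (ha : a.1 ∈ der N i) : (smulDer f a).1 ∈ der N (i + j) := lmul_der ha hf

theorem commDer_mem {i j : ZMod 2} {a b : Der N} (ha : a.1 ∈ der N i) (hb : b.1 ∈ der N j) :
    (commDer a b).1 ∈ der N (i + j) := comm_der ha hb

/-- The derivation `ξᵢ∂ᵢ`. -/
def euler (i : Fin N) : Der N := smulDer (xi i) (pd i)

theorem euler_mem (i : Fin N) : (euler i).1 ∈ der N 0 := by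
  have h := smulDer_mem (xi_par i) (pd_mem i)
  rwa [one_add_one] at h

theorem dξ_xi_mul (i j : Fin N) (f : Lam N) :
    dξ i (xi j * f) = (if i = j then f else 0) - xi j * dξ i f := by
  rw [dξ_ι_mul, Pi.single_apply]
  split_ifs <;> simp

theorem dξ_dξ (i j : Fin N) (f : Lam N) : dξ i (dξ j f) = -dξ j (dξ i f) :=
  CliffordAlgebra.contractLeft_comm (Q := (0 : QuadraticForm ℂ (Fin N → ℂ)))
    (LinearMap.proj i) (LinearMap.proj j) f

theorem dξ_self (i : Fin N) (f : Lam N) : dξ i (dξ i f) = 0 :=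
  CliffordAlgebra.contractLeft_contractLeft (Q := (0 : QuadraticForm ℂ (Fin N → ℂ)))
    (LinearMap.proj i) f

theorem xi_mul_self (i : Fin N) (f : Lam N) : xi i * (xi i * f) = 0 := by
  rw [← mul_assoc, ExteriorAlgebra.ι_sq_zero, zero_mul]

/-- The first term collects the monomials without ξᵢ, the second those with ξᵢ. -/
theorem lam_split (i : Fin N) (f : Lam N) : f = dξ i (xi i * f) + xi i * dξ i f := by
  rw [dξ_xi_mul, if_pos rfl]; abel

theorem commDer_smulDer {i j k : ZMod 2} {a b : Der N} {f : Lam N} (ha : a.1 ∈ der N i)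
    (hf : f ∈ par N j) (hb : b.1 ∈ der N k) :
    commDer a (smulDer f b) = smulDer (a.1 f) b + sgn i j • smulDer f (commDer a b) := by
  apply Subtype.ext
  change comm a.1 (lmul f * b.1) = lmul (a.1 f) * b.1 + sgn i j • (lmul f * comm a.1 b.1)
  rw [comm_eq ha (lmul_der hb hf), comm_eq ha hb, ← mul_assoc, der_lmul ha hf, sgn_add_right]
  simp only [add_mul, mul_sub, smul_sub, mul_assoc, smul_mul_assoc, mul_smul_comm, smul_smul,
    mul_comm (sgn i k)]
  abel

theorem commDer_pd_pd (i j : Fin N) : commDer (pd i) (pd j) = 0 := by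
  apply Subtype.ext
  change comm (dξ i) (dξ j) = 0
  rw [comm_eq (dξ_mem_der i) (dξ_mem_der j), sgn_one_one]
  refine LinearMap.ext fun f => ?_
  simp [dξ_dξ i j]

theorem commDer_pd_euler {i j : Fin N} (h : i ≠ j) : commDer (pd i) (euler j) = 0 := by
  rw [euler, commDer_smulDer (pd_mem i) (xi_par j) (pd_mem j), commDer_pd_pd, map_zero, smul_zero,
    add_zero, coe_pd, dξ_ι, Pi.single_apply, if_neg h, map_zero, map_zero, LinearMap.zero_apply]

theorem commDer_pd_euler_self (i : Fin N) : commDer (pd i) (euler i) = pd i := by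
  rw [euler, commDer_smulDer (pd_mem i) (xi_par i) (pd_mem i), commDer_pd_pd, map_zero, smul_zero,
    add_zero, coe_pd, dξ_ι, Pi.single_apply, if_pos rfl, map_one]
  exact Subtype.ext (LinearMap.ext fun h => by simp)

theorem commDer_swap {i j : ZMod 2} {a b : Der N} (ha : a.1 ∈ der N i) (hb : b.1 ∈ der N j) :
    commDer b a = -(sgn i j • commDer a b) := by
  apply Subtype.ext
  change comm b.1 a.1 = -(sgn i j • comm a.1 b.1)
  rw [comm_eq ha hb, comm_eq hb ha, smul_sub, smul_smul, sgn_mul_self, sgn_comm j i]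
  module

theorem commDer_euler_pd {i j : Fin N} (h : i ≠ j) : commDer (euler i) (pd j) = 0 := by
  rw [commDer_swap (pd_mem j) (euler_mem i), commDer_pd_euler h.symm, smul_zero]
  exact neg_zero (G := Der N)

theorem commDer_euler_self (i : Fin N) : commDer (euler i) (euler i) = 0 := by
  apply Subtype.ext
  change comm (euler i).1 (euler i).1 = 0
  rw [comm_eq (euler_mem i) (euler_mem i), sgn_zero_left, one_smul, sub_self]

/-- ∂ₚ commutes with ∂ₘ and acts on the coefficient only. Together with `smulDer_xi_mul` and
`lam_split` this writes every f∂ₘ as a sum of commutators when p ≠ m. -/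
theorem smulDer_dξ {j : ZMod 2} {f : Lam N} (hf : f ∈ par N j) (p m : Fin N) :
    smulDer (dξ p f) (pd m) = commDer (pd p) (smulDer f (pd m)) := by
  rw [commDer_smulDer (pd_mem p) hf (pd_mem m), commDer_pd_pd, map_zero, smul_zero, add_zero]
  rfl

/-- ξₚ∂ₚ commutes with ∂ₘ and fixes every coefficient divisible by ξₚ. -/
theorem smulDer_xi_mul {j : ZMod 2} {f : Lam N} (hf : f ∈ par N j) {p m : Fin N} (h : p ≠ m) :
    smulDer (xi p * dξ p f) (pd m) = commDer (euler p) (smulDer (xi p * dξ p f) (pd m)) := by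
  have h1 : xi p * dξ p f ∈ par N (1 + (1 + j)) :=
    par_mul (xi_par p) ((dξ_mem_der p) j f hf).1
  rw [commDer_smulDer (euler_mem p) h1 (pd_mem m), commDer_euler_pd h, map_zero, smul_zero,
    add_zero]
  congr 2
  change xi p * dξ p f = xi p * dξ p (xi p * dξ p f)
  rw [dξ_xi_mul, if_pos rfl, dξ_self, mul_zero, sub_zero]

theorem der_ext {i : ZMod 2} {a : Module.End ℂ (Lam N)} (ha : a ∈ der N i)
    (h : ∀ j, a (xi j) = 0) : a = 0 := by
  have hι : ∀ v, a (ExteriorAlgebra.ι ℂ v) = 0 := by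
    intro v
    have : a ∘ₗ ExteriorAlgebra.ι ℂ = 0 := by
      apply LinearMap.pi_ext'
      intro j
      apply LinearMap.ext_ring
      exact h j
    exact LinearMap.congr_fun this v
  have hs : ∀ r, a (algebraMap ℂ _ r) = 0 := fun r => by
    rw [Algebra.algebraMap_eq_smul_one, map_smul, der_one ha, smul_zero]
  refine end_ext fun k f hf => ?_
  rw [LinearMap.zero_apply]
  refine par_induction (p := fun f => a f = 0) (fun _ => hs) (fun _ => hι) ?_ ?_ hf
  · intro f g _ _ hf hg
    rw [map_add, hf, hg, add_zero]
  · intro v w f _ hf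
    rw [(ha 1 _ (ι_par v)).2, (ha 1 _ (ι_par w)).2, hι, hι, hf]
    simp

/-- Both sides agree on the variables, and a homogeneous derivation is determined there (`der_ext`);
the general case follows by additivity. -/
theorem der_eq_sum (a : Der N) : a = ∑ j, smulDer (a.1 (xi j)) (pd j) := by
  have key : ∀ i, ∀ b ∈ der N i, b - ∑ j, lmul (b (xi j)) * dξ j = 0 := by
    intro i b hb
    refine der_ext (i := i) (Submodule.sub_mem _ hb (Submodule.sum_mem _ fun j _ => ?_)) fun k => ?_
    · have := lmul_der (dξ_mem_der j) (isPar_der hb 1 _ (xi_par j))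
      rwa [add_comm i, ← add_assoc, one_add_one, zero_add] at this
    · rw [LinearMap.sub_apply, LinearMap.sum_apply, Finset.sum_eq_single k]
      · simp [dξ_ι]
      · intro j _ hj
        simp [dξ_ι, hj]
      · simp
  have key' : a.1 - ∑ j, lmul (a.1 (xi j)) * dξ j = 0 := by
    obtain ⟨b, hb, c, hc, h⟩ := Submodule.mem_sup.1 a.2
    have := congrArg₂ (· + ·) (key 0 b hb) (key 1 c hc)
    simp only [add_zero] at this
    rw [← h, ← this]
    simp only [LinearMap.add_apply, lmul_add, add_mul, Finset.sum_add_distrib]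
    abel
  apply Subtype.ext
  rw [AddSubmonoidClass.coe_finsetSum]
  exact sub_eq_zero.1 key'

theorem derivation_induction {p : Der N → Prop} (h : ∀ i, ∀ a : Der N, a.1 ∈ der N i → p a)
    (hadd : ∀ a b, p a → p b → p (a + b)) (a : Der N) : p a := by
  obtain ⟨b, hb, c, hc, e⟩ := Submodule.mem_sup.1 a.2
  have : a = ⟨b, der_le 0 hb⟩ + ⟨c, der_le 1 hc⟩ := Subtype.ext e.symm
  rw [this]
  exact hadd _ _ (h 0 _ hb) (h 1 _ hc)

/-! ### Normalized cocycles -/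

section Classification

variable {V : Type*} [AddCommGroup V] [Module ℂ V] {C : GenCocycle N V}

namespace GenCocycle.IsNormalized

/-- This is the cocycle identity for (1, a, b). At μ = 0 it equates λ² α_1(1, [a, b]) with -λ α_0(a,
b), an even with an odd function of λ, so both vanish; μ = 1 then gives linearity in λ. -/
theorem der_der (hC : C.IsNormalized) {i : ZMod 2} {a : Der N} (ha : a.1 ∈ der N i) (b : Der N) :
    C.val 1 unit (ofDer (commDer a b)) = 0 ∧
      ∀ l, C.val l (ofDer a) (ofDer b) = l • C.val 1 (ofDer a) (ofDer b) := by
  have h : ∀ l m : ℂ, l ^ 2 • C.val 1 unit (ofDer (commDer a b)) =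
      m • C.val (l + m) (ofDer a) (ofDer b) - (l + m) • C.val m (ofDer a) (ofDer b) := by
    intro l m
    have h := C.jacobi 0 i unit (ofDer a) (ofDer b) unit_mem (ofDer_mem ha) l m
    rw [exBracket_der_der, exBracket_unit_der, exBracket_unit_der, sgn_zero_left, hC.quadratic] at h
    simp only [map_smul, LinearMap.smul_apply] at h
    rw [h]; module
  have h0 : C.val 1 unit (ofDer (commDer a b)) = 0 := by
    have h1 := h 1 0
    have h2 := h (-1) 0
    linear_combination (norm := module) (1 / 2 : ℂ) • h1 + (1 / 2 : ℂ) • h2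
  refine ⟨h0, fun l => ?_⟩
  have h1 := h (l - 1) 1
  rw [h0, sub_add_cancel] at h1
  linear_combination (norm := module) -h1

/-- This is the cocycle identity for (1, a, f). At μ = 0 it equates λ³ α_1(1, a(f)) with -2λ α_0(a,
f), so both vanish. -/
theorem der_lam (hC : C.IsNormalized) {i j : ZMod 2} {a : Der N} (ha : a.1 ∈ der N i) {f : Lam N}
    (hf : f ∈ par N j) : C.val 1 unit (ofLam (a.1 f)) = 0 ∧ ∀ l, C.val l (ofDer a) (ofLam f) =
      -(l ^ 2 * sgn i j) • C.val 1 unit (ofDer (smulDer f a)) := by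
  have h : ∀ l m : ℂ, l ^ 3 • C.val 1 unit (ofLam (a.1 f)) -
      (m * sgn i j * l ^ 2) • C.val 1 unit (ofDer (smulDer f a)) =
      m • C.val (l + m) (ofDer a) (ofLam f) - (2 * l + m) • C.val m (ofDer a) (ofLam f) := by
    intro l m
    have h := C.jacobi 0 i unit (ofDer a) (ofLam f) unit_mem (ofDer_mem ha) l m
    rw [exBracket_der_lam _ _ ha hf, exBracket_unit_der, exBracket_unit_lam, sgn_zero_left, map_sub,
      map_smul, hC.quadratic, hC.cubic] at h
    simp only [map_smul, LinearMap.smul_apply] at h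
    linear_combination (norm := module) h
  have h0 : C.val 1 unit (ofLam (a.1 f)) = 0 := by
    have h1 := h 1 0
    have h2 := h 2 0
    linear_combination (norm := module) (-1 / 3 : ℂ) • h1 + (1 / 6 : ℂ) • h2
  refine ⟨h0, fun l => ?_⟩
  -- `h1` expresses α_l(a, f) through α_1(a, f), which `h2` and `h3` compute.
  have h1 := h (l - 1) 1
  have h2 := h (-1) 1
  have h3 := h 1 0
  rw [h0, sub_add_cancel] at h1
  rw [h0, neg_add_cancel] at h2
  rw [h0] at h3
  linear_combination (norm := module) -h1 - (2 * l - 1) • h2 - ((2 * l - 1) / 2) • h3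

/-- In the cocycle identity for (1, f, g) the term α_λ(1, fg) is absent. Equal arguments λ = μ = 1
give α_1(f, g) = 0, hence α_0(f, g) = 0, and μ = 0 reduces α_λ to α_0. -/
theorem lam_lam (hC : C.IsNormalized) (hF : ∀ f, C.val 1 unit (ofLam f) = 0) {i : ZMod 2}
    {f : Lam N} (hf : f ∈ par N i) (g : Lam N) (l : ℂ) : C.val l (ofLam f) (ofLam g) = 0 := by
  have h : ∀ l m : ℂ, (m - l) • C.val (l + m) (ofLam f) (ofLam g) =
      (2 * l + m) • C.val m (ofLam f) (ofLam g) := by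
    intro l m
    have h := C.jacobi 0 i unit (ofLam f) (ofLam g) unit_mem (ofLam_mem hf) l m
    rw [exBracket_lam_lam, exBracket_unit_lam, exBracket_unit_lam, sgn_zero_left, map_smul, hC.cubic,
      hF] at h
    simp only [map_smul, LinearMap.smul_apply] at h
    linear_combination (norm := module) -h
  have h0 : C.val 0 (ofLam f) (ofLam g) = 0 := by
    have h1 := h 1 1
    have h2 := h 1 0
    rw [add_zero] at h2
    linear_combination (norm := module) (1 / 6 : ℂ) • h1 - (1 / 2 : ℂ) • h2
  have h1 := h l 0
  rw [h0, add_zero, smul_zero, zero_sub] at h1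
  by_cases hl : l = 0
  · rw [hl, h0]
  · exact (smul_eq_zero.1 h1).resolve_left (neg_ne_zero.2 hl)

/-- The cocycle identity for (a, b, c) at λ = 1, μ = 0: the last term is a value of α_0, which
vanishes on W(N) by linearity in λ. -/
theorem invariant (hC : C.IsNormalized) {i j : ZMod 2} {a b : Der N} (ha : a.1 ∈ der N i)
    (hb : b.1 ∈ der N j) (c : Der N) :
    C.val 1 (ofDer a) (ofDer (commDer b c)) = C.val 1 (ofDer (commDer a b)) (ofDer c) := by
  have h := C.jacobi i j _ _ (ofDer c) (ofDer_mem ha) (ofDer_mem hb) 1 0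
  simp only [exBracket_der_der] at h
  rw [(hC.der_der hb _).2 0, zero_smul, smul_zero, add_zero, add_zero] at h
  exact h

/-- By `lam_split`, f is a value of ∂ᵢ plus a value of ξᵢ∂ᵢ, and `der_lam` kills both. One variable
is needed, so N = 0 escapes. -/
theorem lam_eq_zero (hC : C.IsNormalized) (i : Fin N) (f : Lam N) :
    C.val 1 unit (ofLam f) = 0 := by
  have key : ∀ j, ∀ a : Der N, a.1 ∈ der N j → ∀ f, C.val 1 unit (ofLam (a.1 f)) = 0 := by
    intro j a ha f
    refine lam_induction (p := fun f => C.val 1 unit (ofLam (a.1 f)) = 0)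
      (fun k f hf => (hC.der_lam ha hf).1) (fun f g hf hg => ?_) f
    rw [map_add, map_add, map_add, hf, hg, add_zero]
  have h1 := key 1 (pd i) (pd_mem i) (xi i * f)
  have h2 := key 0 (euler i) (euler_mem i) f
  rw [lam_split i f, map_add, map_add]
  exact (congrArg₂ _ h1 h2).trans (add_zero _)

/-- W(N) is perfect: f∂ₘ is a sum of commutators with ∂ₚ and ξₚ∂ₚ for any p ≠ m. The second index is
what N = 1 lacks. -/
theorem unit_der_eq_zero (hC : C.IsNormalized) (hN : 2 ≤ N) (a : Der N) :
    C.val 1 unit (ofDer a) = 0 := by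
  rw [der_eq_sum a, map_sum, map_sum]
  refine Finset.sum_eq_zero fun m _ => ?_
  obtain ⟨p, hp⟩ : ∃ p : Fin N, p ≠ m :=
    haveI := Fin.nontrivial_iff_two_le.2 hN; exists_ne m
  refine lam_induction (p := fun f => C.val 1 unit (ofDer (smulDer f (pd m))) = 0)
    (fun k f hf => ?_) (fun f g hf hg => ?_) _
  · have h1 : xi p * f ∈ par N (1 + k) := par_mul (xi_par p) hf
    rw [lam_split p f, map_add, LinearMap.add_apply, map_add, map_add, smulDer_dξ h1,
      smulDer_xi_mul hf hp, (hC.der_der (pd_mem p) _).1, (hC.der_der (euler_mem p) _).1, add_zero]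
  · rw [map_add, LinearMap.add_apply, map_add, map_add, hf, hg, add_zero]

/-- In the cocycle identity for (a, b, f) all values on W(N) × ∧(N) vanish, so only the λ-linear
parts fb of [b_μ f] and fa of [a_λ f] contribute. -/
theorem swap (hC : C.IsNormalized) (hA : ∀ a, C.val 1 unit (ofDer a) = 0) {i j k : ZMod 2}
    {a b : Der N} {f : Lam N} (ha : a.1 ∈ der N i) (hb : b.1 ∈ der N j) (hf : f ∈ par N k) :
    sgn j k • C.val 1 (ofDer a) (ofDer (smulDer f b)) =
      (sgn i j * sgn i k) • C.val 1 (ofDer b) (ofDer (smulDer f a)) := by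
  have h := C.jacobi i j _ _ (ofLam f) (ofDer_mem ha) (ofDer_mem hb) 1 1
  have hz : ∀ i, ∀ a : Der N, a.1 ∈ der N i → ∀ j, ∀ f ∈ par N j, ∀ l,
      C.val l (ofDer a) (ofLam f) = 0 := by
    intro i a ha j f hf l
    rw [(hC.der_lam ha hf).2, hA, smul_zero]
  rw [exBracket_der_der, exBracket_der_lam _ _ hb hf, exBracket_der_lam _ _ ha hf, map_sub, map_sub,
    hz i a ha _ _ (isPar_der hb k f hf), hz j b hb _ _ (isPar_der ha k f hf),
    hz _ _ (commDer_mem ha hb) _ f hf, map_smul, map_smul] at h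
  linear_combination (norm := module) -h

/-- A normalized cocycle with `α_λ(1, ·) = 0` is zero if it vanishes on the pairs
`(∂ⱼ, f ∂ₘ)`. -/
theorem eq_zero (hC : C.IsNormalized) (hF : ∀ f, C.val 1 unit (ofLam f) = 0)
    (hA : ∀ a, C.val 1 unit (ofDer a) = 0)
    (hB : ∀ j f m, C.val 1 (ofDer (pd j)) (ofDer (smulDer f (pd m))) = 0) (l : ℂ) (u v : Gen N) :
    C.val l u v = 0 := by
  have hB' : ∀ j b, C.val 1 (ofDer (pd j)) (ofDer b) = 0 := by
    intro j b
    rw [der_eq_sum b, map_sum, map_sum]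
    exact Finset.sum_eq_zero fun m _ => hB j _ m
  have hDD : ∀ i, ∀ a : Der N, a.1 ∈ der N i → ∀ b, C.val l (ofDer a) (ofDer b) = 0 := by
    intro i a ha b
    rw [(hC.der_der ha b).2, der_eq_sum b, map_sum, map_sum, Finset.sum_eq_zero, smul_zero]
    intro m _
    refine lam_induction (p := fun f => C.val 1 (ofDer a) (ofDer (smulDer f (pd m))) = 0)
      (fun k f hf => ?_) (fun f g hf hg => ?_) _
    -- Up to sign B(a, f∂ₘ) is B(∂ₘ, fa), whose first argument is a ∂ₘ; the sign is a unit.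
    · have h := hC.swap hA ha (pd_mem m) hf
      rw [hB', smul_zero] at h
      have := congrArg (sgn 1 k • ·) h
      simpa only [smul_smul, sgn_mul_self, one_smul, smul_zero] using this
    · rw [map_add, LinearMap.add_apply, map_add, map_add, hf, hg, add_zero]
  have hDL : ∀ i, ∀ a : Der N, a.1 ∈ der N i → ∀ j, ∀ f ∈ par N j, ∀ l,
      C.val l (ofDer a) (ofLam f) = 0 := by
    intro i a ha j f hf l
    rw [(hC.der_lam ha hf).2, hA, smul_zero]
  have h1 : ∀ a b, C.val l (ofDer a) (ofDer b) = 0 := by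
    intro a b
    refine derivation_induction (p := fun a => C.val l (ofDer a) (ofDer b) = 0)
      (fun i a ha => hDD i a ha b) (fun a a' h h' => ?_) a
    rw [map_add, map_add, LinearMap.add_apply, h, h', add_zero]
  have h2 : ∀ a f l, C.val l (ofDer a) (ofLam f) = 0 ∧ C.val l (ofLam f) (ofDer a) = 0 := by
    intro a f l
    refine derivation_induction (p := fun a => C.val l (ofDer a) (ofLam f) = 0 ∧
      C.val l (ofLam f) (ofDer a) = 0) (fun i a ha => ?_) (fun a a' h h' => ?_) a
    · refine lam_induction (p := fun f => C.val l (ofDer a) (ofLam f) = 0 ∧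
        C.val l (ofLam f) (ofDer a) = 0) (fun j f hf => ⟨hDL i a ha j f hf l, ?_⟩)
        (fun f g hf hg => ?_) f
      · rw [C.skew i j _ _ (ofDer_mem ha) (ofLam_mem hf), hDL i a ha j f hf, smul_zero, neg_zero]
      · simp only [map_add, LinearMap.add_apply, hf.1, hf.2, hg.1, hg.2, add_zero, and_self]
    · simp only [map_add, LinearMap.add_apply, h.1, h.2, h'.1, h'.2, add_zero, and_self]
  have h3 : ∀ f g, C.val l (ofLam f) (ofLam g) = 0 := by
    intro f g
    refine lam_induction (p := fun f => C.val l (ofLam f) (ofLam g) = 0)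
      (fun i f hf => hC.lam_lam hF hf g l) (fun a a' h h' => ?_) f
    rw [map_add, map_add, LinearMap.add_apply, h, h', add_zero]
  rw [gen_eq_add u, gen_eq_add v]
  simp only [map_add, LinearMap.add_apply, h1, (h2 _ _ _).1, (h2 _ _ _).2, h3, add_zero]

/-- The second argument is [∂ₚ, f∂ₘ]; invariance moves ∂ₚ next to ∂ⱼ, with which it commutes. Only
the top-degree part of a coefficient can survive. -/
theorem pd_smulDer_dξ (hC : C.IsNormalized) (j p m : Fin N) (f : Lam N) :
    C.val 1 (ofDer (pd j)) (ofDer (smulDer (dξ p f) (pd m))) = 0 := by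
  refine lam_induction (p := fun f =>
    C.val 1 (ofDer (pd j)) (ofDer (smulDer (dξ p f) (pd m))) = 0)
    (fun k f hf => ?_) (fun f g hf hg => ?_) f
  · rw [smulDer_dξ hf, hC.invariant (pd_mem j) (pd_mem p), commDer_pd_pd, map_zero, map_zero,
      LinearMap.zero_apply]
  · simp only [map_add, LinearMap.add_apply, hf, hg, add_zero]

/-- The part of f divisible by ξₚ is reproduced by the commutator with ξₚ∂ₚ (this uses p ≠ m);
invariance moves ξₚ∂ₚ next to ∂ⱼ, with which it commutes (this uses p ≠ j). -/
theorem pd_smulDer (hC : C.IsNormalized) {j p m : Fin N} (hj : p ≠ j) (hm : p ≠ m) (f : Lam N) :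
    C.val 1 (ofDer (pd j)) (ofDer (smulDer f (pd m))) = 0 := by
  rw [lam_split p f, map_add, LinearMap.add_apply, map_add, map_add, hC.pd_smulDer_dξ, zero_add]
  refine lam_induction (p := fun f =>
    C.val 1 (ofDer (pd j)) (ofDer (smulDer (xi p * dξ p f) (pd m))) = 0)
    (fun k f hf => ?_) (fun f g hf hg => ?_) f
  · rw [smulDer_xi_mul hf hm, hC.invariant (pd_mem j) (euler_mem p), commDer_pd_euler hj.symm,
      map_zero, map_zero, LinearMap.zero_apply]
  · simp only [map_add, mul_add, LinearMap.add_apply, hf, hg, add_zero]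

theorem eq_zero_of_three_le (hC : C.IsNormalized) (hN : 3 ≤ N) (l : ℂ) (u v : Gen N) :
    C.val l u v = 0 := by
  refine hC.eq_zero (hC.lam_eq_zero ⟨0, by omega⟩) (hC.unit_der_eq_zero (by omega))
    (fun j f m => ?_) l u v
  obtain ⟨p, hp⟩ : ∃ p : Fin N, p ∉ ({j, m} : Finset (Fin N)) := by
    by_contra! h
    have h1 := Finset.card_le_card (fun p _ => h p : Finset.univ ⊆ ({j, m} : Finset (Fin N)))
    have h2 := Finset.card_le_two (a := j) (b := m)
    rw [Finset.card_univ, Fintype.card_fin] at h1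
    omega
  simp only [Finset.mem_insert, Finset.mem_singleton, not_or] at hp
  exact hC.pd_smulDer hp.1 hp.2 f

end GenCocycle.IsNormalized

end Classification

end GenCocycle

/-- The cocycle of a normalized splitting is zero, so this splitting is itself a homomorphism,
whatever the dimension and parity of K. -/
theorem isTrivial_of_three_le {N : ℕ} (hN : 3 ≤ N) {S K : Type*} [AddCommGroup S] [Module ℂ S]
    [AddCommGroup K] [Module ℂ K] {𝓚 : LieConformalSuperalgebra K}
    {𝓢 : LieConformalSuperalgebra S} (E : CentralExtension 𝓚 𝓢 (W N)) : E.IsTrivial := by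
  obtain ⟨σ, hσ⟩ := E.exists_isNormalized
  refine σ.isTrivial fun l a b => ?_
  rw [σ.val_eq_genCocycle, hσ.eq_zero_of_three_le hN]

/-! ### Uniqueness from a single value -/

section Uniqueness

variable {N : ℕ} {V : Type*} [AddCommGroup V] [Module ℂ V]

/-- The cocycle `D - C ⊗ k`. -/
def GenCocycle.subSmul (D : GenCocycle N V) (C : GenCocycle N ℂ) (k : V) : GenCocycle N V where
  val l := D.val l - (C.val l).compr₂ (LinearMap.toSpanSingleton ℂ V k)
  skew i j u v hu hv l := by
    simp only [LinearMap.sub_apply, LinearMap.compr₂_apply, LinearMap.toSpanSingleton_apply]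
    rw [D.skew i j u v hu hv, C.skew i j u v hu hv, smul_eq_mul]
    module
  jacobi i j u v w hu hv l m := by
    simp only [LinearMap.sub_apply, LinearMap.compr₂_apply, LinearMap.toSpanSingleton_apply]
    rw [D.jacobi i j u v w hu hv, C.jacobi i j u v w hu hv, smul_eq_mul]
    module

theorem GenCocycle.subSmul_val (D : GenCocycle N V) (C : GenCocycle N ℂ) (k : V) (l : ℂ)
    (u v : Gen N) : (D.subSmul C k).val l u v = D.val l u v - C.val l u v • k := rfl

theorem GenCocycle.IsNormalized.subSmul {D : GenCocycle N V} {C : GenCocycle N ℂ}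
    (hD : D.IsNormalized) (hC : C.IsNormalized) (k : V) : (D.subSmul C k).IsNormalized := by
  refine ⟨fun l a => ?_, fun l f => ?_⟩
  · rw [subSmul_val, subSmul_val, hD.quadratic, hC.quadratic, smul_eq_mul]
    module
  · rw [subSmul_val, subSmul_val, hD.cubic, hC.cubic, smul_eq_mul]
    module

/-- The coboundary of ψ has α_λ(1, a) = -λψ(a) and α_λ(1, f) = -2λψ(f). A normalized cocycle is
quadratic and cubic there, and comparing λ = 2 with λ = 1 gives ψ = 0. -/
theorem GenCocycle.IsNormalized.not_coboundary {C : GenCocycle N ℂ} (hC : C.IsNormalized)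
    {l₀ : ℂ} {u₀ v₀ : Gen N} (h₀ : C.val l₀ u₀ v₀ ≠ 0) (ψ : Gen N →ₗ[ℂ] ℂ) :
    ¬ ∀ l u v, C.val l u v = ψ (exBracket l (-l) u v) := by
  intro h
  refine h₀ ?_
  suffices hψ : ψ = 0 by rw [h, hψ, LinearMap.zero_apply]
  have h1 : ∀ a, ψ (ofDer a) = 0 := by
    intro a
    have e1 := hC.quadratic 2 a
    have e2 := h 1 unit (ofDer a)
    rw [h, e2, exBracket_unit_der, exBracket_unit_der, map_smul, map_smul, smul_eq_mul,
      smul_eq_mul, smul_eq_mul] at e1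
    linear_combination e1 / 2
  have h2 : ∀ f, ψ (ofLam f) = 0 := by
    intro f
    have e1 := hC.cubic 2 f
    have e2 := h 1 unit (ofLam f)
    rw [h, e2, exBracket_unit_lam, exBracket_unit_lam, map_smul, map_smul, smul_eq_mul,
      smul_eq_mul, smul_eq_mul] at e1
    linear_combination e1 / 12
  refine LinearMap.ext fun u => ?_
  rw [gen_eq_add u, map_add, h1, h2, add_zero, LinearMap.zero_apply]

/-- If normalized cocycles are determined by one value, then a normalized cocycle for which this
value is nonzero defines the unique non-trivial central extension. -/
theorem hasUniqueCentralExtension_of_determined.{w, w'} {T : Table N} (C : GenCocycle N ℂ)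
    (g : Gen N →ₗ[ℂ] Gen N →ₗ[ℂ] Poly ℂ) (hg : ∀ l u v, ev l (g u v) = C.val l u v)
    (heven : ∀ l, ∀ u ∈ genGrade N 0, ∀ v ∈ genGrade N 1, C.val l u v = 0)
    (hT : HasTable (C.toTwoCocycle g hg heven) T) (hC : C.IsNormalized)
    {i : ZMod 2} {u₀ v₀ : Gen N} (hu : u₀ ∈ genGrade N i) (hv : v₀ ∈ genGrade N i)
    (h₀ : C.val 1 u₀ v₀ ≠ 0)
    (hdet : ∀ (K : Type w) [AddCommGroup K] [Module ℂ K] (D : GenCocycle N K), D.IsNormalized →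
      D.val 1 u₀ v₀ = 0 → ∀ l u v, D.val l u v = 0) :
    HasUniqueCentralExtension.{w, w'} N T := by
  refine ⟨C.toTwoCocycle g hg heven, hT, fun h => ?_, ?_⟩
  · obtain ⟨ψ, h1, h2⟩ := TwoCocycle.exists_of_isTrivial _ h
    refine hC.not_coboundary h₀ (ψ ∘ₗ PolynomialModule.lsingle ℂ 0) fun l u v => ?_
    -- ψ vanishes on ∂W_N, so only the coefficient of ∂⁰ matters and brackets are taken at ∂ = 0.
    have h3 : ∀ p : WSpace N, ψ p = ψ (gen₀ (ev 0 p)) := by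
      intro p
      induction p using poly_induction with
      | hadd x y hx hy => simp only [gen₀, map_add, PolynomialModule.single_add, hx, hy]
      | hs x _ =>
        rw [ev_shift, zero_smul, gen₀, PolynomialModule.single_zero, map_zero]
        exact h1 x
      | h0 u => rw [ev_single_zero]
    have h4 := h2 l (gen₀ u) (gen₀ v)
    have h5 := ev_ev_wBracket l (-l) (gen₀ u) (gen₀ v)
    rw [ev_single_zero, ev_single_zero, add_neg_cancel, neg_zero] at h5
    rw [C.ev_toTwoCocycle, ev_single_zero, ev_single_zero, h3] at h4
    rw [h4, ← h5]
    rfl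
  · intro K S _ _ _ _ 𝓚 𝓢 E hK hE
    obtain ⟨σ, hσ⟩ := E.exists_isNormalized
    set D := σ.genCocycle
    -- With this k the cocycle D - C ⊗ k vanishes at (u₀, v₀), hence everywhere. As u₀ and v₀ have
    -- equal parity, k is even; an odd K forces k = 0 and a trivial extension.
    set k : K := (C.val 1 u₀ v₀)⁻¹ • D.val 1 u₀ v₀ with hk
    have hkmem : k ∈ 𝓚.grade 0 := by
      have := σ.genCocycle_mem hu hv 1
      rw [show i + i = 0 by rcases zmod_two_cases i with rfl | rfl <;> rfl] at this
      exact Submodule.smul_mem _ _ this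
    have hz : ∀ l u v, D.val l u v = C.val l u v • k := by
      intro l u v
      have := hdet K (D.subSmul C k) (hσ.subSmul hC k) (by
        rw [GenCocycle.subSmul_val, hk, smul_smul, mul_inv_cancel₀ h₀, one_smul, sub_self]) l u v
      exact sub_eq_zero.1 this
    refine σ.isIso _ hkmem (fun hk0 => hE (σ.isTrivial fun l a b => ?_)) hK fun l a b => ?_
    · rw [σ.val_eq_genCocycle, hz, hk0, smul_zero]
    · rw [σ.val_eq_genCocycle, hz, C.ev_toTwoCocycle]

end Uniqueness

/-! ### Coordinates on the Grassmann algebra -/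

section Coordinates

variable {N : ℕ}

/-- The constant term of an element of `∧(N)`. -/
def eps : Lam N →ₗ[ℂ] ℂ := (ExteriorAlgebra.algebraMapInv (R := ℂ) (M := Fin N → ℂ)).toLinearMap

/-- The coefficient of `ξᵢ`. -/
def eps₁ (i : Fin N) : Lam N →ₗ[ℂ] ℂ := eps ∘ₗ dξ i

/-- The coefficient of `ξᵢξⱼ`. -/
def eps₂ (i j : Fin N) : Lam N →ₗ[ℂ] ℂ := eps ∘ₗ dξ j ∘ₗ dξ i

theorem eps_dξ (i : Fin N) (f : Lam N) : eps (dξ i f) = eps₁ i f := rfl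

theorem eps₁_dξ (i j : Fin N) (f : Lam N) : eps₁ j (dξ i f) = eps₂ i j f := rfl

@[simp] theorem eps_one : eps (1 : Lam N) = 1 := map_one ExteriorAlgebra.algebraMapInv

@[simp] theorem eps_mul (f g : Lam N) : eps (f * g) = eps f * eps g :=
  map_mul ExteriorAlgebra.algebraMapInv f g

@[simp] theorem eps_ι (v : Fin N → ℂ) : eps (ExteriorAlgebra.ι ℂ v) = 0 := by
  simp [eps, ExteriorAlgebra.algebraMapInv]

theorem eps_odd {f : Lam N} (hf : f ∈ par N 1) : eps f = 0 := by
  refine par_induction (p := fun f => eps f = 0) (fun h => absurd h (by decide))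
    (fun _ => eps_ι) (fun f g _ _ hf hg => by rw [map_add, hf, hg, add_zero])
    (fun v w f _ _ => by rw [eps_mul, eps_ι, zero_mul]) hf

theorem eps₁_even {f : Lam N} (hf : f ∈ par N 0) (i : Fin N) : eps₁ i f = 0 :=
  eps_odd ((dξ_mem_der i) 0 f hf).1

theorem eps₂_odd {f : Lam N} (hf : f ∈ par N 1) (i j : Fin N) : eps₂ i j f = 0 :=
  eps₁_even ((dξ_mem_der i) 1 f hf).1 j

@[simp] theorem eps₁_one (i : Fin N) : eps₁ i (1 : Lam N) = 0 := eps₁_even one_par i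

@[simp] theorem eps₁_xi (i j : Fin N) : eps₁ i (xi j) = if i = j then 1 else 0 := by
  rw [← eps_dξ, dξ_ι, Pi.single_apply]
  split_ifs <;> simp

@[simp] theorem eps₂_one (i j : Fin N) : eps₂ i j (1 : Lam N) = 0 := by
  rw [← eps₁_dξ, der_one (dξ_mem_der i), map_zero]

@[simp] theorem eps₂_xi (i j k : Fin N) : eps₂ i j (xi k) = 0 := eps₂_odd (xi_par k) i j

-- The sign of the super Leibniz rule is invisible: it is -1 only for odd f, whose constant term is
-- zero.
@[simp] theorem eps₁_mul (i : Fin N) (f g : Lam N) :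
    eps₁ i (f * g) = eps₁ i f * eps g + eps f * eps₁ i g := by
  refine lam_induction (p := fun f => eps₁ i (f * g) = eps₁ i f * eps g + eps f * eps₁ i g)
    (fun j f hf => ?_) (fun f f' h h' => ?_) f
  · rw [← eps_dξ, ((dξ_mem_der i) j f hf).2, map_add, map_smul, eps_mul, eps_mul, eps_dξ, eps_dξ]
    rcases zmod_two_cases j with rfl | rfl
    · rw [sgn_zero_right, one_smul]
    · rw [eps_odd hf]; simp
  · rw [add_mul, map_add, h, h', map_add, map_add]; ring

@[simp] theorem eps₂_mul (i j : Fin N) (f g : Lam N) : eps₂ i j (f * g) =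
    eps₂ i j f * eps g + eps₁ i f * eps₁ j g - eps₁ j f * eps₁ i g + eps f * eps₂ i j g := by
  refine lam_induction (p := fun f => eps₂ i j (f * g) =
    eps₂ i j f * eps g + eps₁ i f * eps₁ j g - eps₁ j f * eps₁ i g + eps f * eps₂ i j g)
    (fun k f hf => ?_) (fun f f' h h' => ?_) f
  · rw [← eps₁_dξ, ((dξ_mem_der i) k f hf).2, map_add, map_smul, eps₁_mul, eps₁_mul, eps₁_dξ,
      eps₁_dξ, eps_dξ, eps_dξ, smul_eq_mul]
    rcases zmod_two_cases k with rfl | rfl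
    · rw [sgn_zero_right, eps₁_even hf, eps₁_even hf]; ring
    · rw [eps_odd hf, sgn_one_one]; ring
  · rw [add_mul, map_add, h, h']; simp only [map_add]; ring

theorem eps₂_swap (i j : Fin N) (f : Lam N) : eps₂ j i f = -eps₂ i j f := by
  change eps _ = -eps _
  rw [← map_neg, LinearMap.comp_apply, LinearMap.comp_apply, dξ_dξ]

theorem eps₂_self (i : Fin N) (f : Lam N) : eps₂ i i f = 0 := by
  change eps (dξ i (dξ i f)) = 0
  rw [dξ_self, map_zero]

theorem eps₂_dξ_left (i j : Fin N) (f : Lam N) : eps₂ i j (dξ i f) = 0 := by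
  change eps (dξ j (dξ i (dξ i f))) = 0
  rw [dξ_self, map_zero, map_zero]

theorem eps₂_dξ_right (i j : Fin N) (f : Lam N) : eps₂ i j (dξ j f) = 0 := by
  rw [eps₂_swap, eps₂_dξ_left, neg_zero]

/-- Used to find spanning sets of ∧(N) for small N. -/
theorem mem_of_xi_mul_mem {P : Submodule ℂ (Lam N)} (h1 : 1 ∈ P)
    (hx : ∀ i, ∀ f ∈ P, xi i * f ∈ P) (f : Lam N) : f ∈ P := by
  have hι : ∀ v, ∀ f ∈ P, ExteriorAlgebra.ι ℂ v * f ∈ P := by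
    intro v f hf
    rw [← Finset.univ_sum_single v, map_sum, Finset.sum_mul]
    refine Submodule.sum_mem _ fun i _ => ?_
    have : (Pi.single i (v i) : Fin N → ℂ) = v i • Pi.single i 1 := by
      rw [← Pi.single_smul, smul_eq_mul, mul_one]
    rw [this, map_smul, smul_mul_assoc]
    exact Submodule.smul_mem _ _ (hx i f hf)
  induction f using CliffordAlgebra.left_induction with
  | algebraMap r => rw [Algebra.algebraMap_eq_smul_one]; exact Submodule.smul_mem _ _ h1
  | add x y hx hy => exact Submodule.add_mem _ hx hy
  | ι_mul x v hx => exact hι v x hx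

/-- The linear form `u ↦ φ(a(ξₖ))`, where `a` is the component of `u` in `W(N)`. -/
def opCoord (φ : Lam N →ₗ[ℂ] ℂ) (k : Fin N) : Gen N →ₗ[ℂ] ℂ where
  toFun u := φ (u.op (xi k))
  map_add' u v := by simp
  map_smul' c u := by simp

theorem opCoord_apply (φ : Lam N →ₗ[ℂ] ℂ) (k : Fin N) (u : Gen N) :
    opCoord φ k u = φ (u.op (xi k)) := rfl

/-- The linear form `u ↦ φ(f)`, where `f` is the component of `u` in `∧(N)`. -/
def fnCoord (φ : Lam N →ₗ[ℂ] ℂ) : Gen N →ₗ[ℂ] ℂ where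
  toFun u := φ u.fn
  map_add' u v := by simp
  map_smul' c u := by simp

theorem fnCoord_apply (φ : Lam N →ₗ[ℂ] ℂ) (u : Gen N) : fnCoord φ u = φ u.fn := rfl

/-- Reduces a derivation to its values on the variables, so that the axioms for an explicit cocycle
become polynomial identities between coordinates. -/
theorem op_apply (u : Gen N) (f : Lam N) : u.op f = ∑ k, u.op (xi k) * dξ k f := by
  have h := congrArg Subtype.val (der_eq_sum u.1)
  rw [AddSubmonoidClass.coe_finsetSum] at h
  change u.op = _ at h
  conv_lhs => rw [h, LinearMap.sum_apply]
  rfl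

theorem exBracket_op_xi {i j : ZMod 2} {u v : Gen N} (hu : u ∈ genGrade N i)
    (hv : v ∈ genGrade N j) (l m : ℂ) (k : Fin N) : (exBracket l m u v).op (xi k) =
      u.op (v.op (xi k)) - sgn i j • v.op (u.op (xi k)) - (l * sgn i j) • (v.fn * u.op (xi k))
        + m • (u.fn * v.op (xi k)) := by
  rw [op_exBracket, swapLmul, (isPar_der hu.1).swapMul (isPar_lmul hv.2), comm_eq hu.1 hv.1]
  simp [mul_smul]

theorem exBracket_fn {i j : ZMod 2} {u v : Gen N} (hu : u ∈ genGrade N i)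
    (hv : v ∈ genGrade N j) (l m : ℂ) : (exBracket l m u v).fn =
      u.op v.fn - sgn i j • v.op u.fn + (m - l) • (u.fn * v.fn) := by
  rw [fn_exBracket, swapApply_par (isPar_der hv.1) hu.2, sgn_comm j i]

theorem op_xi_par {i : ZMod 2} {u : Gen N} (hu : u ∈ genGrade N i) (k : Fin N) :
    u.op (xi k) ∈ par N (i + 1) := isPar_der hu.1 1 _ (xi_par k)

/-- The case split makes the signs numerical and kills the coordinates of the wrong parity, after
which the cocycle identities are within reach of `ring`. -/
theorem coord_of_mem {i : ZMod 2} {u : Gen N} (hu : u ∈ genGrade N i) :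
    i = 0 ∧ (∀ k, eps (u.op (xi k)) = 0) ∧ (∀ k a b, eps₂ a b (u.op (xi k)) = 0) ∧
      (∀ a, eps₁ a u.fn = 0) ∨
    i = 1 ∧ (∀ k a, eps₁ a (u.op (xi k)) = 0) ∧ eps u.fn = 0 ∧ ∀ a b, eps₂ a b u.fn = 0 := by
  rcases zmod_two_cases i with rfl | rfl
  · exact Or.inl ⟨rfl, fun k => eps_odd (op_xi_par hu k), fun k => eps₂_odd (op_xi_par hu k),
      eps₁_even hu.2⟩
  · exact Or.inr ⟨rfl, fun k => eps₁_even (op_xi_par hu k), eps_odd hu.2, eps₂_odd hu.2⟩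

theorem op_xi_par_even {u : Gen N} (hu : u ∈ genGrade N 0) (k : Fin N) :
    u.op (xi k) ∈ par N 1 := op_xi_par hu k

theorem op_xi_par_odd {u : Gen N} (hu : u ∈ genGrade N 1) (k : Fin N) :
    u.op (xi k) ∈ par N 0 := op_xi_par hu k

theorem gen_decomp (u : Gen N) : ∃ v ∈ genGrade N 0, ∃ w ∈ genGrade N 1, v + w = u :=
  Submodule.mem_sup.1 ((genGrade_isCompl N).sup_eq_top ▸ Submodule.mem_top)

/-- A family of polynomial bilinear maps is a cocycle if the axioms hold for homogeneous
elements. -/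
def GenCocycle.ofPoly (g : Gen N →ₗ[ℂ] Gen N →ₗ[ℂ] Poly ℂ)
    (skew : ∀ i j u v, u ∈ genGrade N i → v ∈ genGrade N j → ∀ l : ℂ,
      ev l (g v u) = -(sgn i j • ev (-l) (g u v)))
    (jacobi : ∀ i j k u v w, u ∈ genGrade N i → v ∈ genGrade N j → w ∈ genGrade N k → ∀ l m : ℂ,
      ev l (g u (exBracket m (-(l + m)) v w)) = ev (l + m) (g (exBracket l m u v) w)
        + sgn i j • ev m (g v (exBracket l (-(l + m)) u w))) : GenCocycle N ℂ where
  val l := g.compr₂ (ev l)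
  skew := skew
  jacobi i j u v w hu hv l m := by
    obtain ⟨w0, h0, w1, h1, rfl⟩ := gen_decomp w
    have e0 := jacobi i j 0 u v w0 hu hv h0 l m
    have e1 := jacobi i j 1 u v w1 hu hv h1 l m
    simp only [LinearMap.compr₂_apply, map_add, smul_add, e0, e1]
    abel

/-- The monomial basis of `W(N) ⊕ ∧(N)`. -/
def basisGen : Finset (Fin N) × Option (Fin N) → Gen N
  | (s, some i) => ofDer (smulDer (ξ s) (pd i))
  | (s, none) => ofLam (ξ s)

theorem gen_eq (x : Finset (Fin N) × Option (Fin N)) : gen x = gen₀ (basisGen x) := by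
  obtain ⟨s, _ | i⟩ := x <;> rfl

theorem opCoord_basisGen (φ : Lam N →ₗ[ℂ] ℂ) (k : Fin N) (s : Finset (Fin N))
    (i : Option (Fin N)) : opCoord φ k (basisGen (s, i)) = if i = some k then φ (ξ s) else 0 := by
  rcases i with _ | i
  · simp [opCoord_apply, basisGen]
  · simp only [opCoord_apply, basisGen, ofDer_op, coe_smulDer, coe_pd, Module.End.mul_apply, dξ_ι,
      Pi.single_apply, Option.some.injEq]
    split_ifs <;> simp

theorem fnCoord_basisGen (φ : Lam N →ₗ[ℂ] ℂ) (s : Finset (Fin N))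
    (i : Option (Fin N)) : fnCoord φ (basisGen (s, i)) = if i = none then φ (ξ s) else 0 := by
  rcases i with _ | i <;> simp [fnCoord_apply, basisGen]

end Coordinates

/-! ### `W_0` -/

section Zero

/-- The bilinear form `(u, v) ↦ φ(u) ψ(v)`. -/
abbrev form {N : ℕ} (φ ψ : Gen N →ₗ[ℂ] ℂ) : Gen N →ₗ[ℂ] Gen N →ₗ[ℂ] ℂ :=
  (LinearMap.mul ℂ ℂ).compl₁₂ φ ψ

/-- `α_λ(f, g) = λ³ f g / 12`. -/
def poly0 : Gen 0 →ₗ[ℂ] Gen 0 →ₗ[ℂ] Poly ℂ :=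
  ((12⁻¹ : ℂ) • form (fnCoord eps) (fnCoord eps)).compr₂ (PolynomialModule.lsingle ℂ 3)

theorem poly0_apply (u v : Gen 0) :
    poly0 u v = PolynomialModule.single ℂ 3 (12⁻¹ * (eps u.fn * eps v.fn)) := rfl

theorem ev_poly0 (l : ℂ) (u v : Gen 0) : ev l (poly0 u v) = l ^ 3 / 12 * (eps u.fn * eps v.fn) := by
  rw [poly0_apply, PolynomialModule.eval_single, smul_eq_mul]; ring

/-- The cocycle on `W_0`. -/
def cocycle0 : GenCocycle 0 ℂ :=
  GenCocycle.ofPoly poly0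
    (by
      intro i j u v hu hv l
      rw [ev_poly0, ev_poly0, smul_eq_mul]
      rcases zmod_two_cases i with rfl | rfl
      · rw [sgn_zero_left]; ring
      · rw [eps_odd hu.2]; ring)
    (by
      intro i j k u v w hu hv hw l m
      -- W(0) = 0: the sum over the variables is empty.
      have h : ∀ (u : Gen 0) (f : Lam 0), u.op f = 0 := fun u f => by rw [op_apply]; rfl
      simp only [ev_poly0, exBracket_fn hu hv, exBracket_fn hu hw, exBracket_fn hv hw, h, map_add,
        map_sub, map_smul, map_zero, eps_mul, smul_eq_mul]
      rcases zmod_two_cases i with rfl | rfl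
      · rw [sgn_zero_left]; ring
      · rw [eps_odd hu.2]; ring)

theorem cocycle0_val_eq (l : ℂ) (u v : Gen 0) : cocycle0.val l u v = ev l (poly0 u v) := rfl

theorem cocycle0_val (l : ℂ) (u v : Gen 0) :
    cocycle0.val l u v = l ^ 3 / 12 * (eps u.fn * eps v.fn) := ev_poly0 l u v

theorem hasUniqueCentralExtension_zero.{w, w'} :
    HasUniqueCentralExtension.{w, w'} 0 table0 := by
  have hξ : ∀ s : Finset (Fin 0), ξ s = 1 := fun s => by
    rw [Subsingleton.elim s ∅]; simp [ξ]
  refine hasUniqueCentralExtension_of_determined cocycle0 poly0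
    (fun l u v => (cocycle0_val_eq l u v).symm) ?_ ⟨?_, ?_⟩
    ⟨?_, ?_⟩ unit_mem unit_mem ?_ ?_
  · intro l u _ v hv
    rw [cocycle0_val, eps_odd hv.2]; ring
  · intro x y n r h
    simp only [table0, List.mem_singleton, Prod.mk.injEq] at h
    obtain ⟨rfl, rfl, rfl, rfl⟩ := h
    simp only [gen_eq]
    rw [GenCocycle.toTwoCocycle_gen₀, poly0_apply]
    -- The entry 1/2 of the table divided by 3! is the coefficient 1/12 of λ³.
    simp only [basisGen, ofLam_fn, hξ, eps_one, Nat.factorial]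
    norm_num
  · rintro ⟨s, _ | i⟩ ⟨t, _ | j⟩ h
    · exfalso
      have := (h 3 (1 / 2)).1
      rw [Subsingleton.elim s ∅, Subsingleton.elim t ∅] at this
      simp [table0] at this
    · exact j.elim0
    · exact i.elim0
    · exact i.elim0
  · intro l a
    simp [cocycle0_val]
  · intro l f
    simp only [cocycle0_val]
    rw [smul_eq_mul]; ring
  · simp [cocycle0_val, unit]
  · intro K _ _ D hD h0
    refine hD.eq_zero (fun f => ?_) (fun a => ?_) (fun j => j.elim0)
    -- ∧(0) is spanned by 1, so vanishing at (1, 1) is enough.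
    · refine mem_of_xi_mul_mem (P := LinearMap.ker (D.val 1 unit ∘ₗ ofLam)) h0
        (fun i => i.elim0) f
    · rw [der_eq_sum a]
      simp

end Zero

/-! ### `W_1` -/

section One

/-- `α_λ(a + f, b + g) = λ x₁ y₁ / 3 + λ² (x₁ g₀ - x₀ g₁ - f₀ y₁ - f₁ y₀) / 6`, where
`a(ξ) = x₀ + x₁ ξ`, `b(ξ) = y₀ + y₁ ξ`, `f = f₀ + f₁ ξ`, `g = g₀ + g₁ ξ`. -/
def poly1 : Gen 1 →ₗ[ℂ] Gen 1 →ₗ[ℂ] Poly ℂ :=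
  ((3⁻¹ : ℂ) • form (opCoord (eps₁ 0) 0) (opCoord (eps₁ 0) 0)).compr₂
      (PolynomialModule.lsingle ℂ 1)
    + ((6⁻¹ : ℂ) • (form (opCoord (eps₁ 0) 0) (fnCoord eps)
      - form (opCoord eps 0) (fnCoord (eps₁ 0)) - form (fnCoord eps) (opCoord (eps₁ 0) 0)
      - form (fnCoord (eps₁ 0)) (opCoord eps 0))).compr₂ (PolynomialModule.lsingle ℂ 2)

theorem poly1_apply (u v : Gen 1) : poly1 u v =
    PolynomialModule.single ℂ 1 (3⁻¹ * (opCoord (eps₁ 0) 0 u * opCoord (eps₁ 0) 0 v))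
    + PolynomialModule.single ℂ 2 (6⁻¹ * (opCoord (eps₁ 0) 0 u * fnCoord eps v
      - opCoord eps 0 u * fnCoord (eps₁ 0) v - fnCoord eps u * opCoord (eps₁ 0) 0 v
      - fnCoord (eps₁ 0) u * opCoord eps 0 v)) := rfl

theorem ev_poly1 (l : ℂ) (u v : Gen 1) : ev l (poly1 u v) =
    l / 3 * (eps₁ 0 (u.op (xi 0)) * eps₁ 0 (v.op (xi 0)))
    + l ^ 2 / 6 * (eps₁ 0 (u.op (xi 0)) * eps v.fn - eps (u.op (xi 0)) * eps₁ 0 v.fn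
      - eps u.fn * eps₁ 0 (v.op (xi 0)) - eps₁ 0 u.fn * eps (v.op (xi 0))) := by
  rw [poly1_apply, map_add, PolynomialModule.eval_single, PolynomialModule.eval_single]
  simp only [opCoord_apply, fnCoord_apply, smul_eq_mul]
  ring

/-- The cocycle on `W_1`. -/
def cocycle1 : GenCocycle 1 ℂ :=
  GenCocycle.ofPoly poly1
    (by
      intro i j u v hu hv l
      rw [ev_poly1, ev_poly1, smul_eq_mul]
      rcases coord_of_mem hu with ⟨rfl, hu1, -, hu2⟩ | ⟨rfl, hu1, hu2, -⟩ <;>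
      rcases coord_of_mem hv with ⟨rfl, hv1, -, hv2⟩ | ⟨rfl, hv1, hv2, -⟩ <;>
      simp only [sgn_zero_left, sgn_zero_right, sgn_one_one, hu1, hu2, hv1, hv2] <;> ring)
    (by
      intro i j k u v w hu hv hw l m
      -- Everything is expanded in coordinates of u, v, w; second-order coefficients disappear
      -- because ∂₁² = 0. The eight parity cases are then polynomial identities.
      simp only [ev_poly1, exBracket_fn hu hv, exBracket_fn hu hw, exBracket_fn hv hw,
        exBracket_op_xi hu hv, exBracket_op_xi hu hw, exBracket_op_xi hv hw, map_add, map_sub,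
        map_smul, op_apply _ (Gen.op _ _), op_apply _ (Gen.fn _), Fin.sum_univ_one, eps_mul,
        eps₁_mul, eps_dξ, eps₁_dξ, eps₂_self, smul_eq_mul]
      rcases coord_of_mem hu with ⟨rfl, hu1, -, hu2⟩ | ⟨rfl, hu1, hu2, -⟩ <;>
      rcases coord_of_mem hv with ⟨rfl, hv1, -, hv2⟩ | ⟨rfl, hv1, hv2, -⟩ <;>
      rcases coord_of_mem hw with ⟨rfl, hw1, -, hw2⟩ | ⟨rfl, hw1, hw2, -⟩ <;>
      simp only [sgn_zero_left, sgn_zero_right, sgn_one_one, hu1, hu2, hv1, hv2, hw1, hw2] <;>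
      ring)

theorem cocycle1_val_eq (l : ℂ) (u v : Gen 1) : cocycle1.val l u v = ev l (poly1 u v) := rfl

theorem cocycle1_val (l : ℂ) (u v : Gen 1) : cocycle1.val l u v =
    l / 3 * (eps₁ 0 (u.op (xi 0)) * eps₁ 0 (v.op (xi 0)))
    + l ^ 2 / 6 * (eps₁ 0 (u.op (xi 0)) * eps v.fn - eps (u.op (xi 0)) * eps₁ 0 v.fn
      - eps u.fn * eps₁ 0 (v.op (xi 0)) - eps₁ 0 u.fn * eps (v.op (xi 0))) := ev_poly1 l u v

theorem ξ_empty {N : ℕ} : ξ (∅ : Finset (Fin N)) = 1 := by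
  simp [ξ]

theorem ξ_singleton {N : ℕ} (i : Fin N) : ξ {i} = xi i := by
  simp [ξ]

theorem hasUniqueCentralExtension_one.{w, w'} :
    HasUniqueCentralExtension.{w, w'} 1 table1 := by
  refine hasUniqueCentralExtension_of_determined cocycle1 poly1
    (fun l u v => (cocycle1_val_eq l u v).symm) ?_ ⟨?_, ?_⟩
    ⟨?_, ?_⟩ unit_mem (ofDer_mem (euler_mem 0)) ?_ ?_
  · intro l u hu v hv
    rw [cocycle1_val, eps₁_even (op_xi_par_odd hv 0), eps_odd hv.2, eps_odd (op_xi_par_even hu 0),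
      eps₁_even hu.2]
    ring
  · intro x y n r h
    simp only [table1, List.mem_cons, List.not_mem_nil, or_false, Prod.mk.injEq] at h
    rcases h with ⟨rfl, rfl, rfl, rfl⟩ | ⟨rfl, rfl, rfl, rfl⟩ | ⟨rfl, rfl, rfl, rfl⟩ <;>
    simp only [gen_eq] <;> rw [GenCocycle.toTwoCocycle_gen₀, poly1_apply] <;>
    simp [opCoord_basisGen, fnCoord_basisGen, ξ_empty, ξ_singleton, Nat.factorial] <;> norm_num
  · intro x y h
    rw [gen_eq, gen_eq, GenCocycle.toTwoCocycle_gen₀, poly1_apply]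
    have hs : ∀ s : Finset (Fin 1), s = ∅ ∨ s = {0} := by decide
    have hi : ∀ i : Option (Fin 1), i = none ∨ i = some 0 := by decide
    have h1 := h 1 (1 / 3)
    have h2 := h 2 (1 / 3)
    have h3 := h 2 (-1 / 3)
    obtain ⟨s, i⟩ := x
    obtain ⟨t, j⟩ := y
    clear h
    -- For each of the sixteen pairs, either the coordinate formula gives zero or the pair is listed
    -- in one of the two orders, against `h1`, `h2`, `h3`.
    rcases hs s with rfl | rfl <;> rcases hi i with rfl | rfl <;> rcases hs t with rfl | rfl <;>
      rcases hi j with rfl | rfl <;>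
    first
    | simp [opCoord_basisGen, fnCoord_basisGen, ξ_empty, ξ_singleton]; done
    | (exfalso; simp [table1] at h1 h2 h3)
  · intro l a
    simp only [cocycle1_val, unit, ofLam_op, ofLam_fn, ofDer_op, ofDer_fn, LinearMap.zero_apply,
      map_zero, eps_one, eps₁_one, smul_eq_mul]
    ring
  · intro l f
    simp [cocycle1_val, unit]
  · simp [cocycle1_val, unit, euler, dξ_ι]
  · intro K _ _ D hD h0
    have hspan : ∀ f : Lam 1, f ∈ Submodule.span ℂ ({1, xi 0} : Set (Lam 1)) := by
      refine mem_of_xi_mul_mem (Submodule.subset_span (by simp)) fun i f hf => ?_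
      obtain ⟨a, b, rfl⟩ := Submodule.mem_span_pair.1 hf
      rw [Subsingleton.elim i 0, mul_add, mul_smul_comm, mul_smul_comm, mul_one,
        ExteriorAlgebra.ι_sq_zero, smul_zero, add_zero]
      exact Submodule.smul_mem _ _ (Submodule.subset_span (by simp))
    have hone : ∀ a : Der 1, smulDer 1 a = a := fun a =>
      Subtype.ext (LinearMap.ext fun h => by simp)
    have key : ∀ F : Der 1 →ₗ[ℂ] K, F (pd 0) = 0 → F (euler 0) = 0 → ∀ f, ∀ m,
        F (smulDer f (pd m)) = 0 := by
      intro F h1 h2 f m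
      obtain ⟨a, b, rfl⟩ := Submodule.mem_span_pair.1 (hspan f)
      rw [Subsingleton.elim m 0, map_add, LinearMap.add_apply, map_add, map_smul, map_smul,
        LinearMap.smul_apply, LinearMap.smul_apply, map_smul, map_smul, hone, h1, ← euler, h2]
      simp
    have hA : ∀ a, D.val 1 unit (ofDer a) = 0 := by
      intro a
      rw [der_eq_sum a, map_sum, map_sum]
      -- ∂₁ = [∂₁, ξ₁∂₁] is a commutator, so α_1(1, ∂₁) = 0. The other basis element ξ₁∂₁ is not in
      -- [W(1), W(1)]; its value is the one assumed zero.
      refine Finset.sum_eq_zero fun m _ => key (D.val 1 unit ∘ₗ ofDer) ?_ h0 _ _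
      have := (hD.der_der (pd_mem 0) (euler 0)).1
      rwa [commDer_pd_euler_self] at this
    refine hD.eq_zero (hD.lam_eq_zero 0) hA fun j f m => ?_
    rw [Subsingleton.elim j 0]
    refine key (D.val 1 (ofDer (pd 0)) ∘ₗ ofDer) ?_ ?_ _ _
    -- As ∂₁ is odd, skew-symmetry makes α_λ(∂₁, ∂₁) even in λ, while it is linear in λ.
    · have h1 := D.skew 1 1 _ _ (ofDer_mem (pd_mem 0)) (ofDer_mem (pd_mem 0)) 1
      rw [(hD.der_der (pd_mem 0) _).2 (-1), sgn_one_one] at h1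
      change D.val 1 (ofDer (pd 0)) (ofDer (pd 0)) = 0
      linear_combination (norm := module) (1 / 2 : ℂ) • h1
    -- Invariance with [ξ₁∂₁, ξ₁∂₁] = 0 and [∂₁, ξ₁∂₁] = ∂₁.
    · have h1 := hD.invariant (pd_mem 0) (euler_mem 0) (euler 0)
      rw [commDer_euler_self, commDer_pd_euler_self, map_zero, map_zero] at h1
      exact h1.symm

end One

/-! ### `W_2` -/

section Two

/-- The form `6 B(a, b)`, the coefficient of `ξ₁ξ₂` in `σ(a(ξ₁)) b(ξ₂) - σ(a(ξ₂)) b(ξ₁)`, where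
`σ` is the parity automorphism. -/
def form2 : Gen 2 →ₗ[ℂ] Gen 2 →ₗ[ℂ] ℂ :=
  form (opCoord eps 0) (opCoord (eps₂ 0 1) 1) + form (opCoord (eps₂ 0 1) 0) (opCoord eps 1)
    - form (opCoord (eps₁ 0) 0) (opCoord (eps₁ 1) 1)
    + form (opCoord (eps₁ 1) 0) (opCoord (eps₁ 0) 1)
    - form (opCoord eps 1) (opCoord (eps₂ 0 1) 0) - form (opCoord (eps₂ 0 1) 1) (opCoord eps 0)
    + form (opCoord (eps₁ 0) 1) (opCoord (eps₁ 1) 0)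
    - form (opCoord (eps₁ 1) 1) (opCoord (eps₁ 0) 0)

theorem form2_apply (u v : Gen 2) : form2 u v =
    opCoord eps 0 u * opCoord (eps₂ 0 1) 1 v + opCoord (eps₂ 0 1) 0 u * opCoord eps 1 v
    - opCoord (eps₁ 0) 0 u * opCoord (eps₁ 1) 1 v + opCoord (eps₁ 1) 0 u * opCoord (eps₁ 0) 1 v
    - opCoord eps 1 u * opCoord (eps₂ 0 1) 0 v - opCoord (eps₂ 0 1) 1 u * opCoord eps 0 v
    + opCoord (eps₁ 0) 1 u * opCoord (eps₁ 1) 0 v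
    - opCoord (eps₁ 1) 1 u * opCoord (eps₁ 0) 0 v := rfl

/-- `α_λ(a + f, b + g) = λ B(a, b)`. -/
def poly2 : Gen 2 →ₗ[ℂ] Gen 2 →ₗ[ℂ] Poly ℂ :=
  ((6⁻¹ : ℂ) • form2).compr₂ (PolynomialModule.lsingle ℂ 1)

theorem poly2_apply (u v : Gen 2) :
    poly2 u v = PolynomialModule.single ℂ 1 (6⁻¹ * form2 u v) := rfl

theorem ev_poly2 (l : ℂ) (u v : Gen 2) : ev l (poly2 u v) = l / 6 * form2 u v := by
  rw [poly2_apply, PolynomialModule.eval_single, smul_eq_mul]; ring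

/-- The cocycle on `W_2`. -/
def cocycle2 : GenCocycle 2 ℂ :=
  GenCocycle.ofPoly poly2
    (by
      intro i j u v hu hv l
      rw [ev_poly2, ev_poly2, smul_eq_mul, form2_apply, form2_apply]
      simp only [opCoord_apply]
      rcases coord_of_mem hu with ⟨rfl, hu1, hu2, -⟩ | ⟨rfl, hu1, hu2, -⟩ <;>
      rcases coord_of_mem hv with ⟨rfl, hv1, hv2, -⟩ | ⟨rfl, hv1, hv2, -⟩ <;>
      simp only [sgn_zero_left, sgn_zero_right, sgn_one_one, hu1, hu2, hv1, hv2] <;> ring)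
    (by
      intro i j k u v w hu hv hw l m
      -- Leaves a single second-order coordinate, so that `ring` sees no hidden relation.
      have e1 : ∀ f : Lam 2, eps₂ 1 0 f = -eps₂ 0 1 f := eps₂_swap 0 1
      simp only [ev_poly2, form2_apply, opCoord_apply, exBracket_op_xi hu hv,
        exBracket_op_xi hu hw, exBracket_op_xi hv hw, map_add, map_sub,
        map_smul, op_apply _ (Gen.op _ _), Fin.sum_univ_two, eps_mul, eps₁_mul, eps₂_mul,
        eps_dξ, eps₁_dξ, eps₂_self, e1, eps₂_dξ_left, eps₂_dξ_right, smul_eq_mul]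
      rcases coord_of_mem hu with ⟨rfl, hu1, hu2, hu3⟩ | ⟨rfl, hu1, hu2, hu3⟩ <;>
      rcases coord_of_mem hv with ⟨rfl, hv1, hv2, hv3⟩ | ⟨rfl, hv1, hv2, hv3⟩ <;>
      rcases coord_of_mem hw with ⟨rfl, hw1, hw2, hw3⟩ | ⟨rfl, hw1, hw2, hw3⟩ <;>
      simp only [sgn_zero_left, sgn_zero_right, sgn_one_one, hu1, hu2, hu3, hv1, hv2, hv3, hw1,
        hw2, hw3] <;>
      ring)

theorem cocycle2_val_eq (l : ℂ) (u v : Gen 2) : cocycle2.val l u v = ev l (poly2 u v) := rfl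

theorem cocycle2_val (l : ℂ) (u v : Gen 2) : cocycle2.val l u v = l / 6 * form2 u v :=
  ev_poly2 l u v

theorem ξ_pair : ξ ({0, 1} : Finset (Fin 2)) = xi 0 * xi 1 := by
  have : ({0, 1} : Finset (Fin 2)).sort (· ≤ ·) = [0, 1] := by
    exact (Finset.sort_insert (· ≤ ·) (by simp) (by simp)).trans (by rw [Finset.sort_singleton])
  simp [ξ, this]

theorem mem_span_two (f : Lam 2) : f ∈ Submodule.span ℂ ({1, xi 0, xi 1, xi 0 * xi 1} : Set (Lam 2)) := by
  refine mem_of_xi_mul_mem (Submodule.subset_span (by simp)) (fun i f hf => ?_) f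
  have h01 : xi 1 * xi 0 = -(xi 0 * xi 1 : Lam 2) := ι_swap _ _
  refine Submodule.span_induction (p := fun f _ => xi i * f ∈ Submodule.span ℂ
    ({1, xi 0, xi 1, xi 0 * xi 1} : Set (Lam 2))) (fun f hf => ?_) (by simp)
    (fun f g _ _ hf hg => by rw [mul_add]; exact Submodule.add_mem _ hf hg)
    (fun c f _ hf => by rw [mul_smul_comm]; exact Submodule.smul_mem _ c hf) hf
  simp only [Set.mem_insert_iff, Set.mem_singleton_iff] at hf
  fin_cases i <;> rcases hf with rfl | rfl | rfl | rfl
  · exact Submodule.subset_span (by simp)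
  · simp
  · exact Submodule.subset_span (by simp)
  · simp [xi_mul_self]
  · exact Submodule.subset_span (by simp)
  · change xi 1 * xi 0 ∈ _
    rw [h01]
    exact Submodule.neg_mem _ (Submodule.subset_span (by simp))
  · simp
  · change xi 1 * (xi 0 * xi 1) ∈ _
    rw [← mul_assoc, h01, neg_mul, mul_assoc, ExteriorAlgebra.ι_sq_zero]
    simp

/-- The monomials 1, ξ₁, ξ₂ are partial derivatives, of ξ₁, ξ₂ξ₁ and ξ₁ξ₂, and are covered by
`pd_smulDer_dξ`; only the top monomial needs the hypothesis. -/
theorem GenCocycle.IsNormalized.pd_smulDer_two {V : Type*} [AddCommGroup V] [Module ℂ V]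
    {D : GenCocycle 2 V} (hD : D.IsNormalized) (j m : Fin 2)
    (h : D.val 1 (ofDer (pd j)) (ofDer (smulDer (xi 0 * xi 1) (pd m))) = 0) (f : Lam 2) :
    D.val 1 (ofDer (pd j)) (ofDer (smulDer f (pd m))) = 0 := by
  have h1 := hD.pd_smulDer_dξ j 0 m (xi 0)
  have h2 := hD.pd_smulDer_dξ j 1 m (xi 1 * xi 0)
  have h3 := hD.pd_smulDer_dξ j 0 m (xi 0 * xi 1)
  rw [dξ_ι, Pi.single_eq_same, map_one] at h1
  rw [dξ_xi_mul, if_pos rfl, dξ_ι, Pi.single_eq_of_ne (by decide), map_zero, mul_zero,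
    sub_zero] at h2 h3
  have : Submodule.span ℂ ({1, xi 0, xi 1, xi 0 * xi 1} : Set (Lam 2)) ≤
      LinearMap.ker (D.val 1 (ofDer (pd j)) ∘ₗ ofDer ∘ₗ smulDer.flip (pd m)) := by
    rw [Submodule.span_le]
    rintro f (rfl | rfl | rfl | rfl)
    · exact h1
    · exact h2
    · exact h3
    · exact h
  exact this (mem_span_two f)

theorem GenCocycle.IsNormalized.eq_zero_of_two {V : Type*} [AddCommGroup V] [Module ℂ V]
    {D : GenCocycle 2 V} (hD : D.IsNormalized)
    (h₀ : D.val 1 (ofDer (pd 0)) (ofDer (smulDer (xi 0 * xi 1) (pd 1))) = 0) (l : ℂ)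
    (u v : Gen 2) : D.val l u v = 0 := by
  have hA := hD.unit_der_eq_zero le_rfl
  -- By `swap`, the values B(∂₁, ξ₁ξ₂∂₂) and B(∂₂, ξ₁ξ₂∂₁) are, up to sign, B(ξ₂∂₂, ξ₁∂₁) and
  -- B(ξ₁∂₁, ξ₂∂₂). These agree, since B is symmetric on even elements.
  have h₁ : D.val 1 (ofDer (pd 1)) (ofDer (smulDer (xi 0 * xi 1) (pd 0))) = 0 := by
    have e (i j : Fin 2) : smulDer (xi i) (euler j) = smulDer (xi i * xi j) (pd j) :=
      Subtype.ext (by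
        change lmul _ * (lmul _ * _) = lmul _ * _
        rw [lmul_lmul, mul_assoc])
    have s1 := hD.swap hA (euler_mem 1) (pd_mem 0) (xi_par 0)
    have s2 := hD.swap hA (euler_mem 0) (pd_mem 1) (xi_par 1)
    have s3 := D.skew 0 0 _ _ (ofDer_mem (euler_mem 0)) (ofDer_mem (euler_mem 1)) 1
    rw [(hD.der_der (euler_mem 0) _).2 (-1), sgn_zero_left] at s3
    rw [← euler, e, h₀, smul_zero, sgn_one_one, s3] at s1
    rw [← euler, e, sgn_one_one, sgn_zero_left,
      show xi 1 * xi 0 = (-1 : ℂ) • (xi 0 * xi 1 : Lam 2) by rw [ι_swap, neg_one_smul], map_smul,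
      LinearMap.smul_apply, map_smul, map_smul] at s2
    linear_combination (norm := module) s2 - s1
  refine hD.eq_zero (hD.lam_eq_zero 0) hA (fun j f m => ?_) l u v
  -- For j = m the other index lies outside {j, m}, and the argument for N ≥ 3 applies.
  by_cases hjm : j = m
  · subst hjm
    obtain ⟨p, hp⟩ := exists_ne j
    exact hD.pd_smulDer hp hp f
  · refine hD.pd_smulDer_two j m ?_ f
    fin_cases j <;> fin_cases m
    · exact absurd rfl hjm
    · exact h₀
    · exact h₁
    · exact absurd rfl hjm

theorem hasUniqueCentralExtension_two.{w, w'} :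
    HasUniqueCentralExtension.{w, w'} 2 table2 := by
  have hmem : ofDer (smulDer (xi 0 * xi 1) (pd 1)) ∈ genGrade 2 1 := by
    have h := ofDer_mem (smulDer_mem (par_mul (xi_par (N := 2) 0) (xi_par 1)) (pd_mem 1))
    rwa [one_add_one, add_zero] at h
  refine hasUniqueCentralExtension_of_determined cocycle2 poly2
    (fun l u v => (cocycle2_val_eq l u v).symm) ?_ ⟨?_, ?_⟩ ⟨?_, ?_⟩ (ofDer_mem (pd_mem 0)) hmem ?_
    (fun K _ _ D hD h => hD.eq_zero_of_two h)
  · intro l u hu v hv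
    rw [cocycle2_val, form2_apply]
    rcases coord_of_mem hu with ⟨-, hu1, hu2, -⟩ | ⟨h, -⟩
    · rcases coord_of_mem hv with ⟨h, -⟩ | ⟨-, hv1, -⟩
      · exact absurd h (by decide)
      · simp only [opCoord_apply, hu1, hu2, hv1]; ring
    · exact absurd h (by decide)
  · intro x y n r h
    simp only [table2, List.mem_cons, List.not_mem_nil, or_false, Prod.mk.injEq] at h
    rcases h with ⟨rfl, rfl, rfl, rfl⟩ | ⟨rfl, rfl, rfl, rfl⟩ | ⟨rfl, rfl, rfl, rfl⟩ |
      ⟨rfl, rfl, rfl, rfl⟩ <;>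
    simp only [gen_eq] <;> rw [GenCocycle.toTwoCocycle_gen₀, poly2_apply, form2_apply] <;>
    simp [opCoord_basisGen, ξ_empty, ξ_singleton, ξ_pair] <;> norm_num
  · intro x y h
    rw [gen_eq, gen_eq, GenCocycle.toTwoCocycle_gen₀, poly2_apply, form2_apply]
    have hs : ∀ s : Finset (Fin 2), s = ∅ ∨ s = {0} ∨ s = {1} ∨ s = {0, 1} := by decide
    have hi : ∀ i : Option (Fin 2), i = none ∨ i = some 0 ∨ i = some 1 := by decide
    have h1 := h 1 (1 / 6)
    have h2 := h 1 (-1 / 6)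
    obtain ⟨s, i⟩ := x
    obtain ⟨t, j⟩ := y
    clear h
    simp only [opCoord_basisGen]
    -- Each term of the form pairs a coefficient of ∂₁ with one of ∂₂, so it vanishes if an argument
    -- lies in ∧(2) or the indices agree. The remaining monomials are compared with the table.
    rcases hi i with rfl | rfl | rfl <;> rcases hi j with rfl | rfl | rfl <;>
    first
    | simp; done
    | rcases hs s with rfl | rfl | rfl | rfl <;> rcases hs t with rfl | rfl | rfl | rfl <;>
      first
      | simp [ξ_empty, ξ_singleton, ξ_pair]; done
      | (exfalso; simp [table2] at h1 h2)
  · intro l a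
    simp [cocycle2_val, form2_apply, opCoord_apply, unit]
  · intro l f
    simp [cocycle2_val, form2_apply, opCoord_apply, unit]
  · simp [cocycle2_val, form2_apply, opCoord_apply, dξ_ι]

end Two

end LieConf

end

theorem mainTheorem10 :
    LieConf.HasUniqueCentralExtension.{u, v} 0 LieConf.table0 ∧
    LieConf.HasUniqueCentralExtension.{u, v} 1 LieConf.table1 ∧
    LieConf.HasUniqueCentralExtension.{u, v} 2 LieConf.table2 ∧
    ∀ N : ℕ, 3 ≤ N →
      ∀ (K : Type u) (S : Type v) [AddCommGroup K] [Module ℂ K] [AddCommGroup S] [Module ℂ S]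
        (𝓚 : LieConf.LieConformalSuperalgebra K) (𝓢 : LieConf.LieConformalSuperalgebra S)
        (E : LieConf.CentralExtension 𝓚 𝓢 (LieConf.W N)), E.IsTrivial :=
  ⟨LieConf.hasUniqueCentralExtension_zero, LieConf.hasUniqueCentralExtension_one,
    LieConf.hasUniqueCentralExtension_two,
    fun _ hN _ _ _ _ _ _ _ _ E => LieConf.isTrivial_of_three_le hN E⟩
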